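/- Let $n\in\{1,2,3\}$, let $0\le r\le q$ be integers and let $\sigma,\Lambda>0$. **Setting.** Let $\Omega\subset\mathbb R^n$ be a bounded open set (for instance a bounded Lipschitz domain) with a conforming triangulation $\mathcal T_H$ (the macro-mesh), so that $\overline\Omega=\bigcup_{T\in\mathcal T_H}\overline T$. Put $H_T=\operatorname{diam}T$ and $H=\max_T H_T$, and assume that $\mathcal T_H$ is shape regular with constant $\sigma$: every $T$ contains a ball of diameter $\rho_T>0$ with $H_T\le\sigma\rho_T$. Let $K:\Omega\to\mathbb R^{n\times n}$ be symmetric, $a(u,v)=\int_\Omega\nabla u^\top K\nabla v\,dx$ on $H^1_0(\Omega)$, and $|K|_{W^{r+1,\infty}(\mathcal T_H)}=\max_{T,a,b}|K_{ab}|_{W^{r+1,\infty}(T)}$. For $m\ge 0$ let $\mathcal S^m(\mathcal T_H)$ be the mesh obtained by $m$ uniform refinements of every macro-element (bisection for $n=1$, four triangles for $n=2$, Bey's eight tetrahedra for $n=3$), with vertices $x_i$ and hat functions $\phi_i$. Let $T_m$ be the set of vertices in $\overline T$, $\mathring T_m=T_m\cap T$, $\partial T_m=T_m\setminus\mathring T_m$,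 $\partial\mathbb X_m=\bigcup_T\partial T_m$, and $V_h=\{v\in H^1_0(\Omega): v|_t\in\mathcal P_1(t)\ \forall t\in\mathcal S^m(\mathcal T_H)\}$. Set $\mathsf A_{ij}=\int_\Omega\nabla\phi_j^\top K\nabla\phi_i\,dx$ for all vertices $x_i,x_j$, including those on $\partial\Omega$. For $T\in\mathcal T_H$ let $\phi(y)=\phi_i(y+x_i)$ with $x_i\in\mathring T_m$ (independent of $i$), and let $\mathscr D(\mathring T_m)$ be the set of all $\delta=x_j-x_i$ with $x_i\in\mathring T_m$, $x_j\in T_m$ and $\{\phi_i\ne0\}\cap\{\phi_j\ne0\}\ne\emptyset$. For such $\delta$ put $\phi_\delta(y)=\phi(y-\delta)$, $\Omega_\delta=\{\phi\neq0\}\cap\{\phi_\delta\ne0\}$, $T_\delta=\{x\in T: x+y\in T\ \forall y\in\Omega_\delta\}$ and $$\Phi^\delta_T(x)=\int_{\Omega_\delta}\nabla\phi_\delta(y)^\top K(x+y)\nabla\phi(y)\,dy,\qquad x\in\overline{T_\delta}.$$ Let $\Pi^\delta_T:C^0(\overline{T_\delta})\to\mathcal P_q(T_\delta)$ be linear projections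 onto the polynomials of degree at most $q$ with $\|\Pi^\delta_Tf\|_{L^\infty(T_\delta)}\le\Lambda\|f\|_{L^\infty(T_\delta)}$ which are related for opposite directions by $(\Pi^\delta_T\Phi^\delta_T)(x)=(\Pi^{-\delta}_T\Phi^{-\delta}_T)(x+\delta)$ on $\overline{T_\delta}$. The surrogate stiffness matrix is defined, for $i\neq j$, by $$\tilde{\mathsf A}_{ij}=\begin{cases}\mathsf A_{ij},& x_i,x_j\in\partial\mathbb X_m,\\ (\Pi^\delta_T\Phi^\delta_T)(x_i),&\delta=x_j-x_i\in\mathscr D(\mathring T_m)\text{ and }x_i\text{ or }x_j\in\mathring T_m\text{ for some }T\in\mathcal T_H,\\0,&\text{otherwise,}\end{cases}$$ and its diagonal is fixed by the zero row sum property $$\tilde{\mathsf A}_{ii}=-\sum_{x_j\in\Omega,\,j\ne i}\tilde{\mathsf A}_{ij}-\sum_{x_j\in\partial\Omega}\mathsf A_{ij}.$$ The surrogate bilinear form is $\tilde a(v,w)=\sum_{x_i,x_j\in\Omega}\tilde{\mathsf A}_{ij}\,v(x_j)\,w(x_i)$ on $V_h$. **Theorem.** There is a constant $C>0$ depending only on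 $n,q,r,\sigma,\Lambda$ such that the following holds for all $\Omega$ and all $K$ as above. 1. For every $\mathcal T_H$ as above with $K\in[W^{r+1,\infty}(\mathcal T_H)]^{n\times n}$, every $m\ge0$, every admissible family of projections and every $v\in V_h$, $$|a(v,v)-\tilde a(v,v)|\le C\,H^{r+1}\,|K|_{W^{r+1,\infty}(\mathcal T_H)}\,\|\nabla v\|_{L^2(\Omega)}^2 .$$ 2. If $a$ is coercive on $H^1_0(\Omega)$, i.e. $a(u,u)\ge\alpha\|u\|_{H^1(\Omega)}^2$ for some $\alpha>0$ and all $u\in H^1_0(\Omega)$, then $\tilde a$ is coercive on $V_h$ for every sufficiently fine macro-mesh: there are $H_0>0$ and $\tilde\alpha>0$ such that, for every $\mathcal T_H$ as above with $K\in[W^{r+1,\infty}(\mathcal T_H)]^{n\times n}$ and $H<H_0$, every $m\ge0$ and every admissible family of projections, $$\tilde a(v,v)\ge\tilde\alpha\,\|v\|_{H^1(\Omega)}^2\qquad\text{for all }v\in V_h .$$ -/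

import Mathlib

open MeasureTheory Set
open scoped ContDiff ENNReal

namespace Surrogate

/-- `ℝⁿ` with the Euclidean norm. -/
abbrev E (n : ℕ) := EuclideanSpace ℝ (Fin n)

/-! ### Sobolev spaces -/

/-- Smooth test functions with compact support inside `U`. -/
def IsTestFunction {n : ℕ} (U : Set (E n)) (φ : E n → ℝ) : Prop :=
  ContDiff ℝ ∞ φ ∧ HasCompactSupport φ ∧ tsupport φ ⊆ U

/-- `g` is the weak partial derivative `∂_{ι 0} ⋯ ∂_{ι (k-1)} f` on the open set `U`. -/
def IsWeakDeriv {n k : ℕ} (U : Set (E n)) (ι : Fin k → Fin n) (f g : E n → ℝ) : Prop :=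
  LocallyIntegrableOn f U ∧ LocallyIntegrableOn g U ∧
  ∀ φ : E n → ℝ, IsTestFunction U φ →
    ∫ x in U, f x * iteratedFDeriv ℝ k φ x (fun i => EuclideanSpace.single (ι i) (1 : ℝ)) =
      (-1 : ℝ) ^ k * ∫ x in U, g x * φ x

/-- `f ∈ W^{k,∞}(U)`. -/
def MemSobolevInf {n : ℕ} (U : Set (E n)) (k : ℕ) (f : E n → ℝ) : Prop :=
  MemLp f ∞ (volume.restrict U) ∧
  ∀ j ≤ k, ∀ ι : Fin j → Fin n,
    ∃ g : E n → ℝ, IsWeakDeriv U ι f g ∧ MemLp g ∞ (volume.restrict U)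

/-- The seminorm `|f|_{W^{k,∞}(U)}`: the largest `L^∞(U)`-norm of a weak derivative of order `k`.
The weak derivative is unique almost everywhere, so the infimum only selects it. -/
noncomputable def sobolevInfSeminorm {n : ℕ} (U : Set (E n)) (k : ℕ) (f : E n → ℝ) : ℝ≥0∞ :=
  ⨆ ι : Fin k → Fin n, ⨅ (g : E n → ℝ) (_ : IsWeakDeriv U ι f g),
    eLpNorm g ∞ (volume.restrict U)

/-- `u ∈ H¹₀(Ω)` with weak gradient `g`: both are square integrable, `g` is the weak gradient of
`u`, and `u` is a limit of test functions in the `H¹(Ω)`-norm. -/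
structure IsH10 {n : ℕ} (Ω : Set (E n)) (u : E n → ℝ) (g : E n → E n) : Prop where
  memLp : MemLp u 2 (volume.restrict Ω)
  memLp_grad : MemLp g 2 (volume.restrict Ω)
  weak_grad : ∀ a : Fin n, IsWeakDeriv Ω (fun _ : Fin 1 => a) u (fun x => g x a)
  approx : ∀ ε : ℝ, 0 < ε → ∃ φ : E n → ℝ, IsTestFunction Ω φ ∧
    (∫ x in Ω, (u x - φ x) ^ 2) + (∫ x in Ω, ‖g x - gradient φ x‖ ^ 2) < ε

/-- The squared norm `‖u‖₁²` of `H¹(Ω)`, where `g` is the weak gradient of `u`. -/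
noncomputable def h1NormSq {n : ℕ} (Ω : Set (E n)) (u : E n → ℝ) (g : E n → E n) : ℝ :=
  (∫ x in Ω, u x ^ 2) + ∫ x in Ω, ‖g x‖ ^ 2

/-! ### The bilinear form of the variable coefficient Poisson equation -/

/-- `a(u, v) = ∫_Ω ∇uᵀ K ∇v`, as a function of the gradients `g` of `u` and `g'` of `v`. -/
noncomputable def poissonForm {n : ℕ} (Ω : Set (E n)) (K : E n → Matrix (Fin n) (Fin n) ℝ)
    (g g' : E n → E n) : ℝ :=
  ∫ x in Ω, ∑ a, ∑ b, g x a * K x a b * g' x b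

/-- `a` is coercive on `H¹₀(Ω)`. -/
def PoissonCoercive {n : ℕ} (Ω : Set (E n)) (K : E n → Matrix (Fin n) (Fin n) ℝ) : Prop :=
  ∃ α : ℝ, 0 < α ∧ ∀ (u : E n → ℝ) (g : E n → E n), IsH10 Ω u g →
    α * h1NormSq Ω u g ≤ poissonForm Ω K g g

/-! ### Macro-meshes and their uniform refinements -/

/-- A simplex, given by the ordered list of its vertices. -/
abbrev Simplex (n : ℕ) := Fin (n + 1) → E n

/-- The closed simplex. -/
def closedSimplex {n : ℕ} (y : Simplex n) : Set (E n) := convexHull ℝ (range y)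

/-- The open simplex. -/
def openSimplex {n : ℕ} (y : Simplex n) : Set (E n) := interior (closedSimplex y)

/-- `𝒯` is a conforming triangulation of `Ω` by nondegenerate simplices. -/
structure IsMacroMesh {n : ℕ} (Ω : Set (E n)) (𝒯 : Finset (Simplex n)) : Prop where
  nondegenerate : ∀ y ∈ 𝒯, AffineIndependent ℝ y
  subset : ∀ y ∈ 𝒯, openSimplex y ⊆ Ω
  cover : closure Ω = ⋃ y ∈ 𝒯, closedSimplex y
  disjoint : ∀ y ∈ 𝒯, ∀ z ∈ 𝒯, y ≠ z → Disjoint (openSimplex y) (openSimplex z)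
  conforming : ∀ y ∈ 𝒯, ∀ z ∈ 𝒯, y ≠ z →
    closedSimplex y ∩ closedSimplex z = convexHull ℝ (range y ∩ range z)

/-- Shape regularity with constant `σ`: every `T` contains a ball of diameter `ρ` with
`diam T ≤ σ ρ`. -/
def ShapeRegular {n : ℕ} (σ : ℝ) (𝒯 : Finset (Simplex n)) : Prop :=
  ∀ y ∈ 𝒯, ∃ (c : E n) (ρ : ℝ), 0 < ρ ∧ Metric.ball c (ρ / 2) ⊆ closedSimplex y ∧
    Metric.diam (closedSimplex y) ≤ σ * ρ

/-- The mesh size `H = max_T diam T`. -/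
noncomputable def meshSize {n : ℕ} (𝒯 : Finset (Simplex n)) : ℝ :=
  ⨆ y : 𝒯, Metric.diam (closedSimplex y.1)

/-- The children of a simplex `[y₀, …, yₙ]` under uniform refinement, in dimensions 1, 2 and 3
(bisection, the four-triangle subdivision, and Bey's subdivision into eight tetrahedra).
A pair `(i, j)` stands for the point `(yᵢ + yⱼ) / 2`. -/
def children : (n : ℕ) → List (Fin (n + 1) → Fin (n + 1) × Fin (n + 1))
  | 1 => [![(0, 0), (0, 1)], ![(0, 1), (1, 1)]]
  | 2 => [![(0, 0), (0, 1), (0, 2)], ![(0, 1), (1, 1), (1, 2)],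
          ![(0, 2), (1, 2), (2, 2)], ![(0, 1), (1, 2), (0, 2)]]
  | 3 => [![(0, 0), (0, 1), (0, 2), (0, 3)], ![(0, 1), (1, 1), (1, 2), (1, 3)],
          ![(0, 2), (1, 2), (2, 2), (2, 3)], ![(0, 3), (1, 3), (2, 3), (3, 3)],
          ![(0, 1), (0, 2), (0, 3), (1, 3)], ![(0, 1), (0, 2), (1, 2), (1, 3)],
          ![(0, 2), (0, 3), (1, 3), (2, 3)], ![(0, 2), (1, 2), (1, 3), (2, 3)]]
  | _ => []

open scoped Classical in
/-- `𝒮(T)`. -/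
noncomputable def subdivide {n : ℕ} (y : Simplex n) : Finset (Simplex n) :=
  ((children n).map fun c k => midpoint ℝ (y (c k).1) (y (c k).2)).toFinset

open scoped Classical in
/-- `𝒮^m(T)`. -/
noncomputable def iterSubdivide {n : ℕ} (y : Simplex n) : ℕ → Finset (Simplex n)
  | 0 => {y}
  | m + 1 => (iterSubdivide y m).biUnion subdivide

open scoped Classical in
/-- The fine mesh `𝒮^m(𝒯)`. -/
noncomputable def fineMesh {n : ℕ} (𝒯 : Finset (Simplex n)) (m : ℕ) : Finset (Simplex n) :=
  𝒯.biUnion fun y => iterSubdivide y m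

open scoped Classical in
/-- The lattice `T_m`: the points of `T` with barycentric coordinates in `2^{-m} ℤ`. -/
noncomputable def lattice {n : ℕ} (y : Simplex n) (m : ℕ) : Finset (E n) :=
  (Finset.univ.piAntidiag (2 ^ m)).image
    fun c : Fin (n + 1) → ℕ => ∑ k, ((c k : ℝ) / 2 ^ m) • y k

open scoped Classical in
/-- The interior lattice points of `T_m`. -/
noncomputable def interiorLattice {n : ℕ} (y : Simplex n) (m : ℕ) : Finset (E n) :=
  (lattice y m).filter (· ∈ openSimplex y)

open scoped Classical in
/-- The boundary lattice points `∂T_m`. -/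
noncomputable def boundaryLattice {n : ℕ} (y : Simplex n) (m : ℕ) : Finset (E n) :=
  lattice y m \ interiorLattice y m

open scoped Classical in
/-- The set `𝕏_m` of all vertices of the fine mesh. -/
noncomputable def vertices {n : ℕ} (𝒯 : Finset (Simplex n)) (m : ℕ) : Finset (E n) :=
  𝒯.biUnion fun y => lattice y m

open scoped Classical in
/-- The set `∂𝕏_m` of all vertices on macro-element boundaries. -/
noncomputable def interfaceVertices {n : ℕ} (𝒯 : Finset (Simplex n)) (m : ℕ) : Finset (E n) :=
  𝒯.biUnion fun y => boundaryLattice y m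

open scoped Classical in
/-- The vertices inside `Ω`: the degrees of freedom under homogeneous Dirichlet conditions. -/
noncomputable def dofs {n : ℕ} (Ω : Set (E n)) (𝒯 : Finset (Simplex n)) (m : ℕ) : Finset (E n) :=
  (vertices 𝒯 m).filter (· ∈ Ω)

/-! ### The finite element space and the true stiffness matrix -/

/-- `w` are barycentric coordinates of the point `x` of the closed simplex `t`. -/
def IsBarycentric {n : ℕ} (t : Simplex n) (x : E n) (w : Fin (n + 1) → ℝ) : Prop :=
  (∀ k, 0 ≤ w k) ∧ ∑ k, w k = 1 ∧ ∑ k, w k • t k = x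

open scoped Classical in
/-- The vertex (hat) function `φ_p` of the mesh `𝒮` at the vertex `p`: on each `t ∈ 𝒮` the
barycentric coordinate belonging to `p`, which is zero if `p` is not a vertex of `t`.
It vanishes off the mesh. On a conforming mesh the choice of `t` and `w` is immaterial. -/
noncomputable def vertexFun {n : ℕ} (𝒮 : Finset (Simplex n)) (p : E n) (x : E n) : ℝ :=
  if h : ∃ tw : Simplex n × (Fin (n + 1) → ℝ), tw.1 ∈ 𝒮 ∧ IsBarycentric tw.1 x tw.2 then
    ∑ k with h.choose.1 k = p, h.choose.2 k
  else 0

/-- `V_h = {v ∈ H¹₀(Ω) : v|_t ∈ 𝒫₁(t) for all t ∈ 𝒮}`, every element being represented by its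
continuous representative, extended by zero. -/
def feSpace {n : ℕ} (Ω : Set (E n)) (𝒮 : Finset (Simplex n)) : Set (E n → ℝ) :=
  {v | Continuous v ∧ (∀ x, x ∉ Ω → v x = 0) ∧ (∃ g : E n → E n, IsH10 Ω v g) ∧
    ∀ t ∈ 𝒮, ∃ f : E n →ᵃ[ℝ] ℝ, EqOn v f (closedSimplex t)}

/-- The entry `a(φ_q, φ_p)` in row `p` and column `q` of the (extended) stiffness matrix. Vertex
functions are affine on each fine simplex: their gradients exist off the faces. -/
noncomputable def stiffness {n : ℕ} (Ω : Set (E n)) (K : E n → Matrix (Fin n) (Fin n) ℝ)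
    (𝒯 : Finset (Simplex n)) (m : ℕ) (p q : E n) : ℝ :=
  poissonForm Ω K (gradient (vertexFun (fineMesh 𝒯 m) q)) (gradient (vertexFun (fineMesh 𝒯 m) p))

/-! ### Stencil functions -/

open scoped Classical in
/-- The test function `φ(y) = φ_i(y + x_i)` of the macro-element `T`, for an arbitrary
`x_i ∈ T̊_m`; all of them give the same `φ`. -/
noncomputable def refFun {n : ℕ} (𝒯 : Finset (Simplex n)) (m : ℕ) (T : Simplex n) (y : E n) : ℝ :=
  if h : (interiorLattice T m).Nonempty then
    vertexFun (fineMesh 𝒯 m) h.choose (y + h.choose)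
  else 0

/-- `φ_δ(y) = φ(y - δ)`. -/
noncomputable def refFunShift {n : ℕ} (𝒯 : Finset (Simplex n)) (m : ℕ) (T : Simplex n) (δ : E n)
    (y : E n) : ℝ :=
  refFun 𝒯 m T (y - δ)

/-- `Ω_δ = supp φ ∩ supp φ_δ`. -/
def overlap {n : ℕ} (𝒯 : Finset (Simplex n)) (m : ℕ) (T : Simplex n) (δ : E n) : Set (E n) :=
  Function.support (refFun 𝒯 m T) ∩ Function.support (refFunShift 𝒯 m T δ)

/-- The closure of `T_δ = {x ∈ T : x + y ∈ T for all y ∈ Ω_δ}`. -/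
def stencilDomain {n : ℕ} (𝒯 : Finset (Simplex n)) (m : ℕ) (T : Simplex n) (δ : E n) :
    Set (E n) :=
  closure {x | x ∈ openSimplex T ∧ ∀ y ∈ overlap 𝒯 m T δ, x + y ∈ openSimplex T}

/-- The translations `x_j - x_i`, `x_i ∈ T̊_m`, `x_j ∈ T_m`, between vertices whose vertex
functions interact. -/
def directions {n : ℕ} (𝒯 : Finset (Simplex n)) (m : ℕ) (T : Simplex n) : Set (E n) :=
  {δ | ∃ p ∈ interiorLattice T m, ∃ q ∈ lattice T m, δ = q - p ∧
    (Function.support (vertexFun (fineMesh 𝒯 m) p) ∩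
      Function.support (vertexFun (fineMesh 𝒯 m) q)).Nonempty}

/-- The local stencil function `Φ^δ_T(x) = ∫_{Ω_δ} ∇φ_δ(y)ᵀ K(x + y) ∇φ(y) dy`. -/
noncomputable def stencil {n : ℕ} (K : E n → Matrix (Fin n) (Fin n) ℝ)
    (𝒯 : Finset (Simplex n)) (m : ℕ) (T : Simplex n) (δ x : E n) : ℝ :=
  ∫ y in overlap 𝒯 m T δ, ∑ a, ∑ b,
    gradient (refFunShift 𝒯 m T δ) y a * K (x + y) a b * gradient (refFun 𝒯 m T) y b

/-- `P` is a linear projection of `C⁰(S)` onto the polynomials of degree at most `q` on `S` whose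
norm with respect to the maximum norm on `S` is at most `Λ`. Elements of `C⁰(S)` are represented
by functions on `ℝⁿ`, of which only the values on `S` matter. -/
structure IsPolyProjection {n : ℕ} (S : Set (E n)) (q : ℕ) (Λ : ℝ)
    (P : (E n → ℝ) → E n → ℝ) : Prop where
  map_add : ∀ f g : E n → ℝ, ContinuousOn f S → ContinuousOn g S →
    EqOn (P (f + g)) (P f + P g) S
  map_smul : ∀ (c : ℝ) (f : E n → ℝ), ContinuousOn f S → EqOn (P (c • f)) (c • P f) S
  range_poly : ∀ f : E n → ℝ, ContinuousOn f S → ∃ p : MvPolynomial (Fin n) ℝ,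
    p.totalDegree ≤ q ∧ EqOn (P f) (fun x => MvPolynomial.eval (fun a => x a) p) S
  apply_poly : ∀ p : MvPolynomial (Fin n) ℝ, p.totalDegree ≤ q →
    EqOn (P fun x => MvPolynomial.eval (fun a => x a) p)
      (fun x => MvPolynomial.eval (fun a => x a) p) S
  bound : ∀ (f : E n → ℝ) (B : ℝ), ContinuousOn f S → (∀ x ∈ S, |f x| ≤ B) →
    ∀ x ∈ S, |P f x| ≤ Λ * B

/-- `Π` is an admissible family of stencil projections: `Π T δ` is a projection onto polynomials
of degree at most `q` on the domain of `Φ^δ_T`, with norm at most `Λ`, and the projections for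
opposite directions are related by `(Π^δ_T Φ^δ_T)(x) = (Π^{-δ}_T Φ^{-δ}_T)(x + δ)`. -/
structure IsProjectionFamily {n : ℕ} (K : E n → Matrix (Fin n) (Fin n) ℝ)
    (𝒯 : Finset (Simplex n)) (m q : ℕ) (Λ : ℝ)
    (P : Simplex n → E n → (E n → ℝ) → E n → ℝ) : Prop where
  proj : ∀ T ∈ 𝒯, ∀ δ ∈ directions 𝒯 m T,
    IsPolyProjection (stencilDomain 𝒯 m T δ) q Λ (P T δ)
  related : ∀ T ∈ 𝒯, ∀ δ ∈ directions 𝒯 m T, ∀ x ∈ stencilDomain 𝒯 m T δ,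
    P T δ (stencil K 𝒯 m T δ) x = P T (-δ) (stencil K 𝒯 m T (-δ)) (x + δ)

/-! ### The surrogate stiffness matrix and the surrogate bilinear form -/

open scoped Classical in
/-- The off-diagonal surrogate entries: the true entry if both vertices lie on macro-element
boundaries, `(Π^δ_T Φ^δ_T)(p)` with `δ = q - p` if `δ ∈ 𝒟(T̊_m)` and `p` or `q` lies in `T̊_m`
(at most one `T` qualifies), and zero otherwise. -/
noncomputable def surrogateOffDiag {n : ℕ} (Ω : Set (E n)) (K : E n → Matrix (Fin n) (Fin n) ℝ)
    (𝒯 : Finset (Simplex n)) (m : ℕ) (P : Simplex n → E n → (E n → ℝ) → E n → ℝ)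
    (p q : E n) : ℝ :=
  if p ∈ interfaceVertices 𝒯 m ∧ q ∈ interfaceVertices 𝒯 m then stiffness Ω K 𝒯 m p q
  else ∑ T ∈ 𝒯,
    if q - p ∈ directions 𝒯 m T ∧ (p ∈ interiorLattice T m ∨ q ∈ interiorLattice T m) then
      P T (q - p) (stencil K 𝒯 m T (q - p)) p
    else 0

open scoped Classical in
/-- The surrogate stiffness matrix. Its diagonal is fixed by the zero row sum property of the
extended matrix, whose columns for vertices on `∂Ω` carry the true entries. -/
noncomputable def surrogateStiffness {n : ℕ} (Ω : Set (E n))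
    (K : E n → Matrix (Fin n) (Fin n) ℝ) (𝒯 : Finset (Simplex n)) (m : ℕ)
    (P : Simplex n → E n → (E n → ℝ) → E n → ℝ) (p q : E n) : ℝ :=
  if p = q then
    -((∑ z ∈ (dofs Ω 𝒯 m).erase p, surrogateOffDiag Ω K 𝒯 m P p z) +
      ∑ z ∈ vertices 𝒯 m \ dofs Ω 𝒯 m, stiffness Ω K 𝒯 m p z)
  else surrogateOffDiag Ω K 𝒯 m P p q

/-- The surrogate bilinear form `ã(v, w) = ∑_{i,j} Ã_{ij} v(x_j) w(x_i)` on `V_h`. -/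
noncomputable def surrogateForm {n : ℕ} (Ω : Set (E n)) (K : E n → Matrix (Fin n) (Fin n) ℝ)
    (𝒯 : Finset (Simplex n)) (m : ℕ) (P : Simplex n → E n → (E n → ℝ) → E n → ℝ)
    (v w : E n → ℝ) : ℝ :=
  ∑ p ∈ dofs Ω 𝒯 m, ∑ q ∈ dofs Ω 𝒯 m, surrogateStiffness Ω K 𝒯 m P p q * v q * w p

/-- `K ∈ [W^{k,∞}(𝒯)]^{n × n}`. -/
def MemBrokenSobolev {n : ℕ} (K : E n → Matrix (Fin n) (Fin n) ℝ) (𝒯 : Finset (Simplex n))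
    (k : ℕ) : Prop :=
  ∀ T ∈ 𝒯, ∀ a b : Fin n, MemSobolevInf (openSimplex T) k (fun x => K x a b)

/-- `|K|_{W^{k,∞}(𝒯)}`, the maximum over all macro-elements and all components of `K`. -/
noncomputable def brokenSeminorm {n : ℕ} (K : E n → Matrix (Fin n) (Fin n) ℝ)
    (𝒯 : Finset (Simplex n)) (k : ℕ) : ℝ≥0∞ :=
  ⨆ T ∈ 𝒯, ⨆ (a : Fin n) (b : Fin n), sobolevInfSeminorm (openSimplex T) k (fun x => K x a b)

end Surrogate

namespace Surrogate

/-! ### The hat function of the Kuhn triangulation of the integer lattice -/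

/-! Let `M` be the difference of the true and the surrogate stiffness matrix, restricted to the
vertices in `Ω`. Both matrices have the same row sums there: the hat functions sum to one, and the
surrogate diagonal is defined so that the row sums match. `M` is symmetric, because opposite stencil
projections are related. Hence `sum_mul_mul_eq_of_row_sum_zero` turns the error `a(v,v) - ã(v,v)`
into `-½ ∑ M_pq (v_q - v_p)²`, in which the diagonal no longer appears.

An off-diagonal `M_pq` is zero or the projection error of a stencil function at `p`
(`stencil_eq_stiffness`). A bounded projection is quasi-optimal, so it suffices to find one good
polynomial. Replacing `K` on the macro-element by its averaged-free Taylor polynomial of degree `r`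
turns the stencil function into a polynomial of degree at most `r ≤ q` (`exists_poly_correlation`).
The remainder is of order `H^(r+1) |K|` (`MemSobolevInf.exists_taylor_approx`), which gives
`abs_stencil_sub_proj_le`: the error is at most a constant times `|∇φ|² |Ω_δ| H^(r+1) |K|`.

No inverse power of the fine mesh width survives. On the common support of `φ_p` and `φ_q` the
gradient of `v` satisfies `∇v · (q - p) = v_q - v_p`, so `|Ω_δ| (v_q - v_p)²` is at most `|q - p|²`
times the integral of `|∇v|²` over that support. Here `|∇φ|` is of order `2^m / ρ` and `|q - p|` of
order `diam T / 2^m`; their product is bounded by shape regularity, uniformly in `m`. Almost every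
point lies in at most `(n + 1)²` of the common supports, so summation loses only a constant.

All the geometry rests on one formula. In cumulative barycentric coordinates scaled by `2^m`, the
lattice of a macro-element becomes integral and the refined simplices have vertices whose pairwise
differences have spread at most one, as in the Kuhn triangulation. The hat function is then `max 0
(1 - spread)` of these coordinates (`sum_weights_eq_kuhnHat`). Translation invariance, the Lipschitz
bound, the supports and the set of directions are read off from it.

Coercivity follows by perturbation. The threshold `H₀` may not depend on the mesh, which requires
the broken seminorm of `K` to be the same for all admissible meshes; `brokenSeminorm_le_of_mesh`
supplies this. -/

/-- The largest difference of two entries of a vector. -/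
noncomputable def spread {ι : Type*} (z : ι → ℝ) : ℝ := ⨆ ij : ι × ι, (z ij.1 - z ij.2)

lemma spread_le {ι : Type*} [Nonempty ι] {z : ι → ℝ} {c : ℝ} (h : ∀ i j, z i - z j ≤ c) :
    spread z ≤ c :=
  ciSup_le fun ij => h ij.1 ij.2

section Spread

variable {ι κ : Type*} [Finite ι]

lemma sub_le_spread (z : ι → ℝ) (i j : ι) : z i - z j ≤ spread z :=
  le_ciSup (f := fun ij : ι × ι => z ij.1 - z ij.2) (Set.finite_range _).bddAbove (i, j)

lemma spread_eq_of_extremes [Nonempty ι] {z : ι → ℝ} {i j : ι} (hi : ∀ k, z k ≤ z i)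
    (hj : ∀ k, z j ≤ z k) : spread z = z i - z j :=
  le_antisymm (spread_le fun k l => by linarith [hi k, hj l]) (sub_le_spread z i j)

lemma spread_neg [Nonempty ι] (z : ι → ℝ) : spread (-z) = spread z := by
  apply le_antisymm
  · exact spread_le fun i j => by
      have := sub_le_spread z j i
      simp only [Pi.neg_apply]; linarith
  · exact spread_le fun i j => by
      have := sub_le_spread (-z) j i
      simp only [Pi.neg_apply] at this; linarith

/-- A finite family of integer vectors whose pairwise differences have spread at most one has a
common index of a maximal entry. -/
lemma exists_common_argmax [Nonempty ι] [Fintype κ] (z : κ → ι → ℤ)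
    (hz : ∀ k l i j, (z k i - z l i) - (z k j - z l j) ≤ 1) : ∃ i, ∀ k j, z k j ≤ z k i := by
  -- An index maximising the sum works. If `j` beat `i` in one vector, it would do so by at least
  -- one, and the hypothesis would make `j` at least as good as `i` in all the others, so its sum
  -- would be larger.
  obtain ⟨i, hi⟩ := Finite.exists_max fun i => ∑ k, z k i
  refine ⟨i, fun k j => ?_⟩
  by_contra! h
  have : ∑ l, z l i < ∑ l, z l j := by
    refine Finset.sum_lt_sum (fun l _ => ?_) ⟨k, Finset.mem_univ _, h⟩
    have := hz k l j i
    omega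
  exact absurd (hi j) (not_le.mpr this)

lemma exists_common_argmin [Nonempty ι] [Fintype κ] (z : κ → ι → ℤ)
    (hz : ∀ k l i j, (z k i - z l i) - (z k j - z l j) ≤ 1) : ∃ i, ∀ k j, z k i ≤ z k j := by
  obtain ⟨i, hi⟩ := exists_common_argmax (fun k i => -z k i) fun k l i j => by
    have := hz l k i j
    omega
  exact ⟨i, fun k j => by have := hi k j; omega⟩

/-- The hat function is affine on families of integer vectors with pairwise spread at most one. -/
lemma hat_sum_eq [Fintype κ] (z : κ → ι → ℤ) (i₀ : ι) (h0 : ∀ k, z k i₀ = 0)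
    (hz : ∀ k l i j, (z k i - z l i) - (z k j - z l j) ≤ 1) (w : κ → ℝ) (hw : ∀ k, 0 ≤ w k)
    (hw1 : ∑ k, w k = 1) [∀ k, Decidable (z k = 0)] :
    max 0 (1 - spread (fun i => ∑ k, w k * (z k i : ℝ))) = ∑ k, if z k = 0 then w k else 0 := by
  have : Nonempty ι := ⟨i₀⟩
  obtain ⟨i, hi⟩ := exists_common_argmax z hz
  obtain ⟨j, hj⟩ := exists_common_argmin z hz
  have hi' : ∀ k l, (z k l : ℝ) ≤ z k i := fun k l => by exact_mod_cast hi k l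
  have hj' : ∀ k l, (z k j : ℝ) ≤ z k l := fun k l => by exact_mod_cast hj k l
  -- Since all vectors share the positions of their extremes, the spread of the convex combination
  -- is the convex combination of the spreads.
  have hs : spread (fun i => ∑ k, w k * (z k i : ℝ)) = ∑ k, w k * ((z k i : ℝ) - z k j) := by
    rw [spread_eq_of_extremes (i := i) (j := j)]
    · rw [← Finset.sum_sub_distrib]; exact Finset.sum_congr rfl fun k _ => by ring
    · exact fun l => Finset.sum_le_sum fun k _ => mul_le_mul_of_nonneg_left (hi' k l) (hw k)
    · exact fun l => Finset.sum_le_sum fun k _ => mul_le_mul_of_nonneg_left (hj' k l) (hw k)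
  -- The entry at `i₀` is zero, so a vector of zero spread vanishes.
  have hzero : ∀ k, z k = 0 ↔ z k i - z k j = 0 := by
    intro k
    constructor
    · intro h; simp [h]
    · intro h
      ext l
      have h1 := hi k l
      have h2 := hj k l
      have h3 := hi k i₀
      have h4 := hj k i₀
      have h5 := h0 k
      simp only [Pi.zero_apply]
      omega
  rw [hs]
  -- If some vector vanishes, all spreads are 0 or 1 and no truncation occurs. Otherwise all spreads
  -- are at least 1 and both sides vanish.
  by_cases hex : ∃ k, z k = 0
  · obtain ⟨k₀, hk₀⟩ := hex
    have hterm : ∀ k, (if z k = 0 then w k else 0) = w k * (1 - ((z k i : ℝ) - z k j)) := by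
      intro k
      split_ifs with h
      · simp [h]
      · have h1 : z k i - z k j ≠ 0 := fun h' => h ((hzero k).mpr h')
        have h2 := hz k k₀ i j
        have h3 := hi k j
        simp only [hk₀, Pi.zero_apply] at h2
        have h4 : z k i - z k j = 1 := by omega
        have h5 : (z k i : ℝ) - z k j = 1 := by exact_mod_cast h4
        rw [h5]; ring
    have hsum : ∑ k, (if z k = 0 then w k else 0) = 1 - ∑ k, w k * ((z k i : ℝ) - z k j) := by
      rw [← hw1, ← Finset.sum_sub_distrib]
      exact Finset.sum_congr rfl fun k _ => by rw [hterm k]; ring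
    rw [← hsum]
    exact max_eq_right (Finset.sum_nonneg fun k _ => by split_ifs; exacts [hw k, le_rfl])
  · push Not at hex
    have h1 : ∀ k, (1 : ℝ) ≤ (z k i : ℝ) - z k j := by
      intro k
      have h1 : z k i - z k j ≠ 0 := fun h' => hex k ((hzero k).mpr h')
      have h3 := hi k j
      have : 1 ≤ z k i - z k j := by omega
      exact_mod_cast this
    have h2 : 1 ≤ ∑ k, w k * ((z k i : ℝ) - z k j) := by
      rw [← hw1]
      exact Finset.sum_le_sum fun k _ => le_mul_of_one_le_right (hw k) (h1 k)
    rw [max_eq_left (by linarith)]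
    exact (Finset.sum_eq_zero fun k _ => if_neg (hex k)).symm

end Spread

/-! ### Barycentric coordinates -/

lemma mem_closedSimplex_iff (t : Simplex n) (x : E n) :
    x ∈ closedSimplex t ↔ ∃ w, IsBarycentric t x w := by
  constructor
  · intro hx
    have hsub : closedSimplex t ⊆ {x | ∃ w, IsBarycentric t x w} := by
      refine convexHull_min ?_ ?_
      · rintro _ ⟨k, rfl⟩
        refine ⟨Pi.single k 1, fun j => ?_, by simp, ?_⟩
        · by_cases h : j = k
          · subst h; simp
          · simp [h]
        · simp [Pi.single_apply]
      · rintro x ⟨w, hw, hw1, rfl⟩ y ⟨w', hw', hw1', rfl⟩ a c ha hc hac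
        refine ⟨fun k => a * w k + c * w' k, fun k => ?_, ?_, ?_⟩
        · have := hw k; have := hw' k; positivity
        · rw [Finset.sum_add_distrib, ← Finset.mul_sum, ← Finset.mul_sum, hw1, hw1']; linarith
        · simp only [add_smul, Finset.sum_add_distrib, Finset.smul_sum, mul_smul]
    exact hsub hx
  · rintro ⟨w, hw, hw1, rfl⟩
    exact (convex_convexHull ℝ _).sum_mem (fun k _ => hw k) hw1
      fun k _ => subset_convexHull ℝ _ (mem_range_self k)

lemma exists_affineBasis {t : Simplex n} (ht : AffineIndependent ℝ t) :
    ∃ b : AffineBasis (Fin (n + 1)) ℝ (E n), ⇑b = t :=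
  ⟨⟨t, ht, by rw [ht.affineSpan_eq_top_iff_card_eq_finrank_add_one]; simp⟩, rfl⟩

lemma isCompact_closedSimplex (t : Simplex n) : IsCompact (closedSimplex t) :=
  (Set.finite_range t).isCompact_convexHull ℝ

lemma convex_closedSimplex (t : Simplex n) : Convex ℝ (closedSimplex t) := convex_convexHull ℝ _

lemma isOpen_openSimplex (t : Simplex n) : IsOpen (openSimplex t) := isOpen_interior

lemma convex_openSimplex (t : Simplex n) : Convex ℝ (openSimplex t) :=
  (convex_closedSimplex t).interior

lemma openSimplex_subset (t : Simplex n) : openSimplex t ⊆ closedSimplex t := interior_subset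

lemma closedSimplex_diff_openSimplex_null (t : Simplex n) :
    volume (closedSimplex t \ openSimplex t) = 0 :=
  measure_mono_null (sdiff_subset_sdiff_left subset_closure)
    ((convex_closedSimplex t).addHaar_frontier volume)

/-- A simplex with nonempty interior is nondegenerate. -/
lemma exists_affineBasis_of_interior {t : Simplex n} (ht : (openSimplex t).Nonempty) :
    ∃ b : AffineBasis (Fin (n + 1)) ℝ (E n), ⇑b = t := by
  have h := interior_convexHull_nonempty_iff_affineSpan_eq_top.mp ht
  refine exists_affineBasis ?_
  rw [affineIndependent_iff_le_finrank_vectorSpan ℝ t (n := n) (by simp),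
    ← direction_affineSpan, h, AffineSubspace.direction_top, finrank_top]
  simp

section Basis

variable (b : AffineBasis (Fin (n + 1)) ℝ (E n))

lemma coord_sum_smul {κ : Type*} [Fintype κ] (w : κ → ℝ) (hw : ∑ j, w j = 1) (t : κ → E n)
    (k : Fin (n + 1)) : b.coord k (∑ j, w j • t j) = ∑ j, w j * b.coord k (t j) := by
  rw [← Finset.affineCombination_eq_linear_combination _ _ _ hw,
    Finset.map_affineCombination _ _ _ hw, Finset.affineCombination_eq_linear_combination _ _ _ hw]
  simp

lemma coord_of_isBarycentric {x : E n} {w : Fin (n + 1) → ℝ} (h : IsBarycentric b x w)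
    (k : Fin (n + 1)) : b.coord k x = w k := by
  obtain ⟨-, h1, rfl⟩ := h
  rw [coord_sum_smul b w h1]
  simp [AffineBasis.coord_apply]

lemma mem_closedSimplex_basis (x : E n) : x ∈ closedSimplex b ↔ ∀ k, 0 ≤ b.coord k x := by
  rw [closedSimplex, AffineBasis.convexHull_eq_nonneg_coord]; rfl

lemma mem_openSimplex_basis (x : E n) : x ∈ openSimplex b ↔ ∀ k, 0 < b.coord k x := by
  rw [openSimplex, closedSimplex, AffineBasis.interior_convexHull]; rfl

lemma mem_lattice_iff (m : ℕ) (p : E n) :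
    p ∈ lattice b m ↔ ∀ k, ∃ c : ℕ, 2 ^ m * b.coord k p = c := by
  have h2 : (0 : ℝ) < 2 ^ m := by positivity
  constructor
  · intro h k
    obtain ⟨c, hc, rfl⟩ := Finset.mem_image.mp h
    have hc1 : ∑ k, (c k : ℝ) = 2 ^ m := by
      have := (Finset.mem_piAntidiag.mp hc).1
      exact_mod_cast this
    refine ⟨c k, ?_⟩
    rw [coord_sum_smul b _ (by rw [← Finset.sum_div, hc1, div_self h2.ne'])]
    simp [AffineBasis.coord_apply]
    field_simp
  · intro h
    choose c hc using h
    refine Finset.mem_image.mpr ⟨c, ?_, ?_⟩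
    · rw [Finset.mem_piAntidiag]
      refine ⟨?_, fun _ _ => Finset.mem_univ _⟩
      have : ∑ k, (c k : ℝ) = 2 ^ m := by
        simp_rw [← hc, ← Finset.mul_sum, b.sum_coord_apply_eq_one, mul_one]
      exact_mod_cast this
    · rw [← b.linear_combination_coord_eq_self p]
      refine Finset.sum_congr rfl fun k _ => ?_
      simp only [← hc]
      congr 1
      field_simp

lemma lattice_subset (m : ℕ) {p : E n} (hp : p ∈ lattice b m) : p ∈ closedSimplex b := by
  rw [mem_lattice_iff] at hp
  rw [mem_closedSimplex_basis]
  intro k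
  obtain ⟨c, hc⟩ := hp k
  have h2 : (0 : ℝ) < 2 ^ m := by positivity
  have : 0 ≤ 2 ^ m * b.coord k p := by rw [hc]; positivity
  exact nonneg_of_mul_nonneg_right this h2

lemma mem_interiorLattice_iff (m : ℕ) (p : E n) :
    p ∈ interiorLattice b m ↔ p ∈ lattice b m ∧ p ∈ openSimplex b := by
  simp [interiorLattice]

/-! ### Cumulative coordinates and the hat function they define -/

/-- The cumulative barycentric coordinates, scaled to integers on the lattice. -/
noncomputable def cumCoord (m : ℕ) (i : Fin (n + 1)) : E n →ₗ[ℝ] ℝ :=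
  (2 : ℝ) ^ m • ∑ k with i ≤ k, (b.coord k).linear

lemma cumCoord_sub (m : ℕ) (i : Fin (n + 1)) (x y : E n) :
    cumCoord b m i (x - y) = 2 ^ m * ∑ k with i ≤ k, (b.coord k x - b.coord k y) := by
  simp only [cumCoord, LinearMap.smul_apply, LinearMap.sum_apply, smul_eq_mul]
  congr 1
  refine Finset.sum_congr rfl fun k _ => ?_
  exact (b.coord k).linearMap_vsub x y

lemma cumCoord_zero (m : ℕ) (u : E n) : cumCoord b m 0 u = 0 := by
  have := cumCoord_sub b m 0 u 0
  rw [sub_zero] at this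
  rw [this]
  simp [b.sum_coord_apply_eq_one, Finset.sum_sub_distrib]

lemma cumCoord_succ_level (m : ℕ) (i : Fin (n + 1)) (u : E n) :
    cumCoord b (m + 1) i u = 2 * cumCoord b m i u := by
  simp only [cumCoord, LinearMap.smul_apply, smul_eq_mul, pow_succ]; ring

/-- Consecutive tail sums differ by one barycentric coordinate; for the last one the subtrahend is
the tail sum from 0, which vanishes. Spread bounds thereby become bounds on barycentric coordinates.
-/
lemma exists_cumCoord_sub (m : ℕ) (k : Fin (n + 1)) :
    ∃ i j, ∀ u, 2 ^ m * (b.coord k).linear u = cumCoord b m i u - cumCoord b m j u := by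
  by_cases h : k = Fin.last n
  · refine ⟨k, 0, fun u => ?_⟩
    have : ({j | Fin.last n ≤ j} : Finset (Fin (n + 1))) = {Fin.last n} := by
      ext j; simp [Fin.last_le_iff]
    rw [cumCoord_zero, h]
    simp only [cumCoord, this, LinearMap.smul_apply, Finset.sum_singleton, smul_eq_mul, sub_zero]
  · obtain ⟨i, rfl⟩ : ∃ i : Fin n, k = i.castSucc := ⟨k.castPred h, by simp⟩
    refine ⟨i.castSucc, i.succ, fun u => ?_⟩
    have : ({j | i.castSucc ≤ j} : Finset (Fin (n + 1))) =
        insert i.castSucc ({j | i.succ ≤ j} : Finset (Fin (n + 1))) := by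
      ext j
      simp only [Finset.mem_filter, Finset.mem_univ, true_and, Finset.mem_insert, Fin.le_def,
        Fin.ext_iff, Fin.val_castSucc, Fin.val_succ]
      omega
    simp only [cumCoord, this]
    rw [Finset.sum_insert (by simp)]
    simp only [LinearMap.smul_apply, LinearMap.add_apply, smul_eq_mul]
    ring

lemma exists_int_cumCoord_sub {m : ℕ} {p q : E n} (hp : p ∈ lattice b m) (hq : q ∈ lattice b m)
    (i : Fin (n + 1)) : ∃ c : ℤ, cumCoord b m i (p - q) = c := by
  rw [mem_lattice_iff] at hp hq
  choose c hc using hp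
  choose d hd using hq
  refine ⟨∑ k with i ≤ k, ((c k : ℤ) - d k), ?_⟩
  rw [cumCoord_sub, Finset.mul_sum]
  push_cast
  exact Finset.sum_congr rfl fun k _ => by rw [← hc, ← hd]; ring

lemma eq_zero_of_cumCoord_eq_zero {m : ℕ} {u : E n} (h : ∀ i, cumCoord b m i u = 0) : u = 0 := by
  refine b.ext_elem fun k => ?_
  obtain ⟨i, j, hij⟩ := exists_cumCoord_sub b m k
  have h1 := hij u
  rw [h, h, sub_self] at h1
  have h2 : (b.coord k).linear u = 0 := by
    rcases mul_eq_zero.mp h1 with h' | h'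
    · exact absurd h' (by positivity)
    · exact h'
  have h3 := (b.coord k).linearMap_vsub u 0
  simp only [vsub_eq_sub, sub_zero, h2] at h3
  linarith

/-- The hat function of the lattice point `0` on the Kuhn triangulation belonging to a simplex. -/
noncomputable def kuhnHat (m : ℕ) (u : E n) : ℝ :=
  max 0 (1 - spread fun i => cumCoord b m i u)

lemma kuhnHat_ne_zero_iff (m : ℕ) (u : E n) :
    kuhnHat b m u ≠ 0 ↔ spread (fun i => cumCoord b m i u) < 1 := by
  rw [kuhnHat]
  constructor
  · intro h
    by_contra! h'
    exact h (max_eq_left (by linarith))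
  · intro h
    exact (lt_max_of_lt_right (by linarith)).ne'

end Basis

/-! ### Uniform refinement produces Kuhn simplices -/

lemma mem_subdivide_iff {y t : Simplex n} :
    t ∈ subdivide y ↔ ∃ c ∈ children n, t = fun k => midpoint ℝ (y (c k).1) (y (c k).2) := by
  simp only [subdivide, List.mem_toFinset, List.mem_map, eq_comm]

lemma mem_iterSubdivide_succ {y t : Simplex n} {m : ℕ} :
    t ∈ iterSubdivide y (m + 1) ↔ ∃ s ∈ iterSubdivide y m, t ∈ subdivide s := by
  simp [iterSubdivide]

/-- The pairwise differences of the columns of `L` have spread at most one. -/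
def IsKuhnFamily (L : Fin (n + 1) → Fin (n + 1) → ℝ) : Prop :=
  ∀ k l i j, (L i k - L i l) - (L j k - L j l) ≤ 1

/-- The columns of `L` increase by at most one altogether. -/
def IsKuhnChain (L : Fin 4 → Fin 4 → ℝ) : Prop :=
  ∀ i, L i 0 ≤ L i 1 ∧ L i 1 ≤ L i 2 ∧ L i 2 ≤ L i 3 ∧ L i 3 ≤ L i 0 + 1

/-- By `cumCoord_midpoint`, the level `m + 1` coordinates of a midpoint are the sums of the level
`m` coordinates of its ends. A refinement step therefore replaces the columns by sums of two
columns. -/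
lemma IsKuhnFamily.children_one {L : Fin 2 → Fin 2 → ℝ} (h : IsKuhnFamily (n := 1) L)
    {c : Fin 2 → Fin 2 × Fin 2} (hc : c ∈ children 1) :
    IsKuhnFamily (n := 1) fun i k => L i (c k).1 + L i (c k).2 := by
  intro k l i j
  have h1 := h 0 1 i j
  have h2 := h 1 0 i j
  simp only [children, List.mem_cons, List.not_mem_nil, or_false] at hc
  rcases hc with rfl | rfl <;> fin_cases k <;> fin_cases l <;> simp <;> linarith

lemma IsKuhnFamily.children_two {L : Fin 3 → Fin 3 → ℝ} (h : IsKuhnFamily (n := 2) L)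
    {c : Fin 3 → Fin 3 × Fin 3} (hc : c ∈ children 2) :
    IsKuhnFamily (n := 2) fun i k => L i (c k).1 + L i (c k).2 := by
  intro k l i j
  have h1 := h 0 1 i j
  have h2 := h 1 0 i j
  have h3 := h 0 2 i j
  have h4 := h 2 0 i j
  have h5 := h 1 2 i j
  have h6 := h 2 1 i j
  simp only [children, List.mem_cons, List.not_mem_nil, or_false] at hc
  rcases hc with rfl | rfl | rfl | rfl <;> fin_cases k <;> fin_cases l <;> simp <;> linarith

/-- In three dimensions the pairwise condition alone is not inherited: the inner diagonal joins the
midpoints of edges 02 and 13, and the two increments on it could add up to 2. Monotonicity along the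
vertex order excludes this, and it survives because of the order in which Bey's children list their
vertices. -/
lemma IsKuhnChain.children {L : Fin 4 → Fin 4 → ℝ} (h : IsKuhnChain L)
    {c : Fin 4 → Fin 4 × Fin 4} (hc : c ∈ children 3) :
    IsKuhnChain fun i k => L i (c k).1 + L i (c k).2 := by
  intro i
  obtain ⟨h1, h2, h3, h4⟩ := h i
  simp only [Surrogate.children, List.mem_cons, List.not_mem_nil, or_false] at hc
  rcases hc with rfl | rfl | rfl | rfl | rfl | rfl | rfl | rfl <;> simp <;>
    refine ⟨?_, ?_, ?_, ?_⟩ <;> linarith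

lemma IsKuhnChain.isKuhnFamily {L : Fin 4 → Fin 4 → ℝ} (h : IsKuhnChain L) :
    IsKuhnFamily (n := 3) L := by
  intro k l i j
  obtain ⟨h1, h2, h3, h4⟩ := h i
  obtain ⟨g1, g2, g3, g4⟩ := h j
  fin_cases k <;> fin_cases l <;> simp <;> linarith

section Basis

variable (b : AffineBasis (Fin (n + 1)) ℝ (E n))

lemma cumCoord_midpoint (m : ℕ) (i : Fin (n + 1)) (x y : E n) :
    cumCoord b (m + 1) i (midpoint ℝ x y) = cumCoord b m i x + cumCoord b m i y := by
  rw [cumCoord_succ_level, midpoint_eq_smul_add, map_smul, map_add, invOf_eq_inv, smul_eq_mul]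
  ring

lemma cumCoord_vertex_sub (i k l : Fin (n + 1)) :
    cumCoord b 0 i (b k - b l) = (if i ≤ k then 1 else 0) - if i ≤ l then 1 else 0 := by
  rw [cumCoord_sub]
  simp [AffineBasis.coord_apply, Finset.sum_sub_distrib]

lemma midpoint_mem_lattice {m : ℕ} {p q : E n} (hp : p ∈ lattice b m) (hq : q ∈ lattice b m) :
    midpoint ℝ p q ∈ lattice b (m + 1) := by
  rw [mem_lattice_iff] at *
  intro k
  obtain ⟨c, hc⟩ := hp k
  obtain ⟨d, hd⟩ := hq k
  refine ⟨c + d, ?_⟩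
  rw [AffineMap.map_midpoint, midpoint_eq_smul_add, invOf_eq_inv, smul_eq_mul]
  push_cast
  rw [← hc, ← hd]
  ring

lemma vertex_mem_lattice (k : Fin (n + 1)) : b k ∈ lattice b 0 := by
  rw [mem_lattice_iff]
  intro j
  refine ⟨if j = k then 1 else 0, ?_⟩
  simp [AffineBasis.coord_apply]

lemma mem_lattice_of_mem_iterSubdivide {m : ℕ} {t : Simplex n} (ht : t ∈ iterSubdivide b m)
    (k : Fin (n + 1)) : t k ∈ lattice b m := by
  induction m generalizing t k with
  | zero =>
    simp only [iterSubdivide, Finset.mem_singleton] at ht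
    rw [ht]; exact vertex_mem_lattice b k
  | succ m ih =>
    obtain ⟨s, hs, hts⟩ := mem_iterSubdivide_succ.mp ht
    obtain ⟨c, -, rfl⟩ := mem_subdivide_iff.mp hts
    exact midpoint_mem_lattice b (ih hs _) (ih hs _)

/-- The invariant `C` is left open because dimensions 1 and 2 propagate the pairwise condition and
dimension 3 the stronger chain condition. -/
lemma isKuhnFamily_of_step (m : ℕ) (C : (Fin (n + 1) → Fin (n + 1) → ℝ) → Prop)
    (h0 : C fun i k => cumCoord b 0 i (b k))
    (hstep : ∀ L, C L → ∀ c ∈ children n, C fun i k => L i (c k).1 + L i (c k).2)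
    {t : Simplex n} (ht : t ∈ iterSubdivide b m) : C fun i k => cumCoord b m i (t k) := by
  induction m generalizing t with
  | zero =>
    simp only [iterSubdivide, Finset.mem_singleton] at ht
    rw [ht]; exact h0
  | succ m ih =>
    obtain ⟨s, hs, hts⟩ := mem_iterSubdivide_succ.mp ht
    obtain ⟨c, hc, rfl⟩ := mem_subdivide_iff.mp hts
    simp_rw [cumCoord_midpoint]
    exact hstep _ (ih hs) c hc

lemma isKuhnFamily_basis : IsKuhnFamily fun i k => cumCoord b 0 i (b k) := by
  intro k l i j
  simp only [← map_sub, cumCoord_vertex_sub]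
  split_ifs <;> simp_all
  · omega
  all_goals norm_num

lemma isKuhnFamily_of_mem_iterSubdivide (hn : n = 1 ∨ n = 2 ∨ n = 3) {m : ℕ} {t : Simplex n}
    (ht : t ∈ iterSubdivide b m) : IsKuhnFamily fun i k => cumCoord b m i (t k) := by
  rcases hn with rfl | rfl | rfl
  · exact isKuhnFamily_of_step b m _ (isKuhnFamily_basis b) (fun L hL c hc => hL.children_one hc) ht
  · exact isKuhnFamily_of_step b m _ (isKuhnFamily_basis b) (fun L hL c hc => hL.children_two hc) ht
  · refine (isKuhnFamily_of_step b m IsKuhnChain ?_ (fun L hL c hc => hL.children hc)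
      ht).isKuhnFamily
    intro i
    have h1 := cumCoord_vertex_sub b i 0 1
    have h2 := cumCoord_vertex_sub b i 1 2
    have h3 := cumCoord_vertex_sub b i 2 3
    have h4 := cumCoord_vertex_sub b i 3 0
    simp only [map_sub] at h1 h2 h3 h4
    fin_cases i <;> simp [Fin.le_def] at h1 h2 h3 h4 <;> simp <;>
      refine ⟨?_, ?_, ?_, ?_⟩ <;> linarith

/-- Barycentric coordinates of a fine simplex are values of hat functions. -/
lemma sum_weights_eq_kuhnHat (hn : n = 1 ∨ n = 2 ∨ n = 3) {m : ℕ} {t : Simplex n}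
    (ht : t ∈ iterSubdivide b m) {x : E n} {w : Fin (n + 1) → ℝ} (hw : IsBarycentric t x w)
    {p : E n} (hp : p ∈ lattice b m) [∀ k, Decidable (t k = p)] :
    ∑ k with t k = p, w k = kuhnHat b m (x - p) := by
  classical
  choose z hz using fun k i =>
    exists_int_cumCoord_sub b (mem_lattice_of_mem_iterSubdivide b ht k) hp i
  obtain ⟨hw0, hw1, rfl⟩ := hw
  have hfam := isKuhnFamily_of_mem_iterSubdivide b hn ht
  have key := hat_sum_eq z 0 (fun k => by
      have := hz k 0
      rw [cumCoord_zero] at this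
      exact_mod_cast this.symm)
    (fun k l i j => by
      have := hfam k l i j
      have h1 := hz k i
      have h2 := hz l i
      have h3 := hz k j
      have h4 := hz l j
      simp only [map_sub] at h1 h2 h3 h4
      have : ((z k i : ℝ) - z l i) - (z k j - z l j) ≤ 1 := by
        rw [← h1, ← h2, ← h3, ← h4]; linarith
      exact_mod_cast this) w hw0 hw1
  have hx : (fun i => ∑ k, w k * (z k i : ℝ)) =
      fun i => cumCoord b m i (∑ k, w k • t k - p) := by
    ext i
    simp_rw [← hz, map_sub, mul_sub, Finset.sum_sub_distrib, ← Finset.sum_mul, hw1, one_mul,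
      map_sum, map_smul, smul_eq_mul]
  rw [kuhnHat, ← hx, key, Finset.sum_filter]
  refine Finset.sum_congr rfl fun k _ => ?_
  have : t k = p ↔ z k = 0 := by
    constructor
    · intro h
      ext i
      have := hz k i
      rw [h, sub_self, map_zero] at this
      exact_mod_cast this.symm
    · intro h
      refine sub_eq_zero.mp (eq_zero_of_cumCoord_eq_zero b (m := m) fun i => ?_)
      rw [hz, h]; simp
  simp only [this]

end Basis

/-! ### The children cover the parent -/

/-- `w'` are barycentric coordinates, with respect to the child `c`, of the point with barycentric
coordinates `w`. -/
def IsChildWeights (c : Fin (n + 1) → Fin (n + 1) × Fin (n + 1)) (w w' : Fin (n + 1) → ℝ) : Prop :=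
  (∀ k, 0 ≤ w' k) ∧ ∑ k, w' k = 1 ∧
    ∀ j, w j = ∑ k, w' k * ((if (c k).1 = j then 1 / 2 else 0) + if (c k).2 = j then 1 / 2 else 0)

lemma exists_childWeights_one {w : Fin 2 → ℝ} (h0 : ∀ k, 0 ≤ w k) (h1 : ∑ k, w k = 1) :
    ∃ c ∈ children 1, ∃ w', IsChildWeights (n := 1) c w w' := by
  rw [Fin.sum_univ_two] at h1
  have g0 := h0 0
  have g1 := h0 1
  rcases le_total (1 / 2) (w 0) with h | h
  · refine ⟨![(0, 0), (0, 1)], by simp [children], ![2 * w 0 - 1, 2 * w 1], ?_, ?_, ?_⟩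
    · intro k; fin_cases k <;> simp <;> linarith
    · simp [Fin.sum_univ_two]; linarith
    · intro j; fin_cases j <;> simp [Fin.sum_univ_two] <;> linarith
  · refine ⟨![(0, 1), (1, 1)], by simp [children], ![2 * w 0, 2 * w 1 - 1], ?_, ?_, ?_⟩
    · intro k; fin_cases k <;> simp <;> linarith
    · simp [Fin.sum_univ_two]; linarith
    · intro j; fin_cases j <;> simp [Fin.sum_univ_two] <;> linarith

lemma exists_childWeights_two {w : Fin 3 → ℝ} (h0 : ∀ k, 0 ≤ w k) (h1 : ∑ k, w k = 1) :
    ∃ c ∈ children 2, ∃ w', IsChildWeights (n := 2) c w w' := by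
  rw [Fin.sum_univ_three] at h1
  have g0 := h0 0
  have g1 := h0 1
  have g2 := h0 2
  -- The child at corner `k` consists of the points whose `k`-th coordinate is at least 1/2; the
  -- middle triangle is what remains.
  by_cases e0 : 1 / 2 ≤ w 0
  · refine ⟨![(0, 0), (0, 1), (0, 2)], by simp [children], ![2 * w 0 - 1, 2 * w 1, 2 * w 2], ?_, ?_, ?_⟩
    · intro k; fin_cases k <;> simp <;> linarith
    · simp [Fin.sum_univ_three]; linarith
    · intro j; fin_cases j <;> simp [Fin.sum_univ_three] <;> linarith
  by_cases e1 : 1 / 2 ≤ w 1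
  · refine ⟨![(0, 1), (1, 1), (1, 2)], by simp [children], ![2 * w 0, 2 * w 1 - 1, 2 * w 2], ?_, ?_, ?_⟩
    · intro k; fin_cases k <;> simp <;> linarith
    · simp [Fin.sum_univ_three]; linarith
    · intro j; fin_cases j <;> simp [Fin.sum_univ_three] <;> linarith
  by_cases e2 : 1 / 2 ≤ w 2
  · refine ⟨![(0, 2), (1, 2), (2, 2)], by simp [children], ![2 * w 0, 2 * w 1, 2 * w 2 - 1], ?_, ?_, ?_⟩
    · intro k; fin_cases k <;> simp <;> linarith
    · simp [Fin.sum_univ_three]; linarith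
    · intro j; fin_cases j <;> simp [Fin.sum_univ_three] <;> linarith
  push Not at e0 e1 e2
  · refine ⟨![(0, 1), (1, 2), (0, 2)], by simp [children], ![1 - 2 * w 2, 1 - 2 * w 0, 1 - 2 * w 1], ?_, ?_, ?_⟩
    · intro k; fin_cases k <;> simp <;> linarith
    · simp [Fin.sum_univ_three]; linarith
    · intro j; fin_cases j <;> simp [Fin.sum_univ_three] <;> linarith

lemma exists_childWeights_three {w : Fin 4 → ℝ} (h0 : ∀ k, 0 ≤ w k) (h1 : ∑ k, w k = 1) :
    ∃ c ∈ children 3, ∃ w', IsChildWeights (n := 3) c w w' := by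
  rw [Fin.sum_univ_four] at h1
  have g0 := h0 0
  have g1 := h0 1
  have g2 := h0 2
  have g3 := h0 3
  by_cases e0 : 1 / 2 ≤ w 0
  · refine ⟨![(0, 0), (0, 1), (0, 2), (0, 3)], by simp [children], ![2 * w 0 - 1, 2 * w 1, 2 * w 2, 2 * w 3], ?_, ?_, ?_⟩
    · intro k; fin_cases k <;> simp <;> linarith
    · simp [Fin.sum_univ_four]; linarith
    · intro j; fin_cases j <;> simp [Fin.sum_univ_four] <;> linarith
  by_cases e1 : 1 / 2 ≤ w 1
  · refine ⟨![(0, 1), (1, 1), (1, 2), (1, 3)], by simp [children], ![2 * w 0, 2 * w 1 - 1, 2 * w 2, 2 * w 3], ?_, ?_, ?_⟩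
    · intro k; fin_cases k <;> simp <;> linarith
    · simp [Fin.sum_univ_four]; linarith
    · intro j; fin_cases j <;> simp [Fin.sum_univ_four] <;> linarith
  by_cases e2 : 1 / 2 ≤ w 2
  · refine ⟨![(0, 2), (1, 2), (2, 2), (2, 3)], by simp [children], ![2 * w 0, 2 * w 1, 2 * w 2 - 1, 2 * w 3], ?_, ?_, ?_⟩
    · intro k; fin_cases k <;> simp <;> linarith
    · simp [Fin.sum_univ_four]; linarith
    · intro j; fin_cases j <;> simp [Fin.sum_univ_four] <;> linarith
  by_cases e3 : 1 / 2 ≤ w 3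
  · refine ⟨![(0, 3), (1, 3), (2, 3), (3, 3)], by simp [children], ![2 * w 0, 2 * w 1, 2 * w 2, 2 * w 3 - 1], ?_, ?_, ?_⟩
    · intro k; fin_cases k <;> simp <;> linarith
    · simp [Fin.sum_univ_four]; linarith
    · intro j; fin_cases j <;> simp [Fin.sum_univ_four] <;> linarith
  push Not at e0 e1 e2 e3
  -- What remains after removing the corners is an octahedron. The planes `w 0 + w 1 = 1/2` and `w 1
  -- + w 2 = 1/2` both contain the diagonal between the midpoints of edges 02 and 13 and cut the
  -- octahedron into the four inner children.
  rcases le_total (1 / 2) (w 0 + w 1) with f | f <;>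
    rcases le_total (1 / 2) (w 1 + w 2) with f' | f'
  · refine ⟨![(0, 1), (0, 2), (1, 2), (1, 3)], by simp [children], ![2 * w 0 + 2 * w 1 - 1, 1 - 2 * w 1, 2 * w 1 + 2 * w 2 - 1, 2 * w 3], ?_, ?_, ?_⟩
    · intro k; fin_cases k <;> simp <;> linarith
    · simp [Fin.sum_univ_four]; linarith
    · intro j; fin_cases j <;> simp [Fin.sum_univ_four] <;> linarith
  · refine ⟨![(0, 1), (0, 2), (0, 3), (1, 3)], by simp [children], ![2 * w 0 + 2 * w 1 - 1, 2 * w 2, 2 * w 3 + 2 * w 0 - 1, 1 - 2 * w 0], ?_, ?_, ?_⟩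
    · intro k; fin_cases k <;> simp <;> linarith
    · simp [Fin.sum_univ_four]; linarith
    · intro j; fin_cases j <;> simp [Fin.sum_univ_four] <;> linarith
  · refine ⟨![(0, 2), (1, 2), (1, 3), (2, 3)], by simp [children], ![2 * w 0, 2 * w 1 + 2 * w 2 - 1, 1 - 2 * w 2, 2 * w 2 + 2 * w 3 - 1], ?_, ?_, ?_⟩
    · intro k; fin_cases k <;> simp <;> linarith
    · simp [Fin.sum_univ_four]; linarith
    · intro j; fin_cases j <;> simp [Fin.sum_univ_four] <;> linarith
  · refine ⟨![(0, 2), (0, 3), (1, 3), (2, 3)], by simp [children], ![1 - 2 * w 3, 2 * w 0 + 2 * w 3 - 1, 2 * w 1, 2 * w 2 + 2 * w 3 - 1], ?_, ?_, ?_⟩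
    · intro k; fin_cases k <;> simp <;> linarith
    · simp [Fin.sum_univ_four]; linarith
    · intro j; fin_cases j <;> simp [Fin.sum_univ_four] <;> linarith

lemma exists_child_of_isBarycentric (hn : n = 1 ∨ n = 2 ∨ n = 3) {y : Simplex n} {x : E n}
    {w : Fin (n + 1) → ℝ} (hw : IsBarycentric y x w) :
    ∃ t ∈ subdivide y, ∃ w', IsBarycentric t x w' := by
  obtain ⟨h0, h1, rfl⟩ := hw
  obtain ⟨c, hc, w', hw0, hw1, hw2⟩ : ∃ c ∈ children n, ∃ w', IsChildWeights c w w' := by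
    rcases hn with rfl | rfl | rfl
    exacts [exists_childWeights_one h0 h1, exists_childWeights_two h0 h1,
      exists_childWeights_three h0 h1]
  refine ⟨_, mem_subdivide_iff.mpr ⟨c, hc, rfl⟩, w', hw0, hw1, ?_⟩
  simp_rw [hw2, Finset.sum_smul]
  rw [Finset.sum_comm]
  refine Finset.sum_congr rfl fun k _ => ?_
  simp_rw [mul_smul, ← Finset.smul_sum, add_smul, Finset.sum_add_distrib, ite_smul, zero_smul,
    Finset.sum_ite_eq, Finset.mem_univ, if_true]
  rw [midpoint_eq_smul_add, invOf_eq_inv, smul_add, one_div]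

lemma exists_mem_iterSubdivide (hn : n = 1 ∨ n = 2 ∨ n = 3) (m : ℕ) {y : Simplex n} {x : E n}
    (hx : x ∈ closedSimplex y) : ∃ t ∈ iterSubdivide y m, ∃ w, IsBarycentric t x w := by
  induction m with
  | zero => exact ⟨y, by simp [iterSubdivide], (mem_closedSimplex_iff y x).mp hx⟩
  | succ m ih =>
    obtain ⟨t, ht, w, hw⟩ := ih
    obtain ⟨s, hs, hs'⟩ := exists_child_of_isBarycentric hn hw
    exact ⟨s, mem_iterSubdivide_succ.mpr ⟨t, ht, hs⟩, hs'⟩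

/-! ### Lipschitz bound for the hat function -/

section Basis

variable (b : AffineBasis (Fin (n + 1)) ℝ (E n))

lemma openSimplex_nonempty : (openSimplex b).Nonempty :=
  ⟨_, b.centroid_mem_interior_convexHull⟩

lemma abs_cumCoord_sub_le (m : ℕ) (i : Fin (n + 1)) {x y : E n} (hx : x ∈ closedSimplex b)
    (hy : y ∈ closedSimplex b) : |cumCoord b m i (x - y)| ≤ 2 ^ m := by
  have key : ∀ z ∈ closedSimplex b, 0 ≤ ∑ k with i ≤ k, b.coord k z ∧
      ∑ k with i ≤ k, b.coord k z ≤ 1 := by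
    intro z hz
    rw [mem_closedSimplex_basis] at hz
    refine ⟨Finset.sum_nonneg fun k _ => hz k, ?_⟩
    rw [← b.sum_coord_apply_eq_one z]
    exact Finset.sum_le_sum_of_subset_of_nonneg (Finset.filter_subset _ _) fun k _ _ => hz k
  rw [cumCoord_sub, Finset.sum_sub_distrib, abs_mul, abs_of_pos (by positivity : (0 : ℝ) < 2 ^ m)]
  refine mul_le_of_le_one_right (by positivity) ?_
  have h1 := key x hx
  have h2 := key y hy
  rw [abs_le]
  constructor <;> linarith

-- A tail sum varies by at most `2 ^ m` over the simplex, so the difference of two of them is at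
-- most `2 * 2 ^ m` on small displacements from the centre `c`; linearity extends the bound. The
-- radius `ρ / 4` is used because a closed ball must fit into the open ball of radius `ρ / 2`.
variable {b} in
lemma cumCoord_sub_cumCoord_le {c : E n} {ρ : ℝ} (hρ : 0 < ρ)
    (hball : Metric.ball c (ρ / 2) ⊆ closedSimplex b) (m : ℕ) (i j : Fin (n + 1)) (u : E n) :
    cumCoord b m i u - cumCoord b m j u ≤ 8 * 2 ^ m / ρ * ‖u‖ := by
  have h := LinearMap.bound_of_ball_bound' (𝕜 := ℝ) (r := ρ / 4) (by positivity) (2 * 2 ^ m)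
    (cumCoord b m i - cumCoord b m j) (fun z hz => ?_) u
  · rw [LinearMap.sub_apply, Real.norm_eq_abs] at h
    refine (le_abs_self _).trans (h.trans_eq ?_)
    field_simp
    ring
  · have hz' : ‖z‖ ≤ ρ / 4 := by simpa using hz
    have h1 : c + z ∈ closedSimplex b := hball (by simp; linarith)
    have h2 : c ∈ closedSimplex b := hball (by simp; linarith)
    have h3 := abs_cumCoord_sub_le b m i h1 h2
    have h4 := abs_cumCoord_sub_le b m j h1 h2
    rw [add_sub_cancel_left] at h3 h4
    rw [LinearMap.sub_apply, Real.norm_eq_abs]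
    exact (abs_sub _ _).trans (by linarith)

-- The spread is a supremum of linear functionals with a common Lipschitz constant, and truncation
-- at 0 does not enlarge it.
variable {b} in
lemma abs_kuhnHat_sub_le {c : E n} {ρ : ℝ} (hρ : 0 < ρ)
    (hball : Metric.ball c (ρ / 2) ⊆ closedSimplex b) (m : ℕ) (u v : E n) :
    |kuhnHat b m u - kuhnHat b m v| ≤ 8 * 2 ^ m / ρ * ‖u - v‖ := by
  have key : ∀ u v : E n, spread (fun i => cumCoord b m i u) ≤
      spread (fun i => cumCoord b m i v) + 8 * 2 ^ m / ρ * ‖u - v‖ := by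
    intro u v
    refine spread_le fun i j => ?_
    have h1 := cumCoord_sub_cumCoord_le hρ hball m i j (u - v)
    have h2 := sub_le_spread (fun i => cumCoord b m i v) i j
    simp only [map_sub] at h1 h2 ⊢
    linarith
  have h1 := key u v
  have h2 := key v u
  rw [norm_sub_rev] at h2
  rw [kuhnHat, kuhnHat, max_comm 0, max_comm 0]
  refine (abs_max_sub_max_le_abs _ _ _).trans ?_
  rw [abs_le]
  constructor <;> linarith

lemma continuous_kuhnHat (m : ℕ) : Continuous (kuhnHat b m) := by
  obtain ⟨c, hc⟩ := openSimplex_nonempty b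
  obtain ⟨r, hr, hball⟩ := Metric.isOpen_iff.mp (isOpen_openSimplex b) c hc
  have hball' : Metric.ball c ((2 * r) / 2) ⊆ closedSimplex b := by
    rw [mul_div_cancel_left₀ _ two_ne_zero]; exact hball.trans (openSimplex_subset b)
  have : LipschitzWith (8 * 2 ^ m / (2 * r)).toNNReal (kuhnHat b m) := by
    refine LipschitzWith.of_dist_le_mul fun u v => ?_
    rw [Real.dist_eq, dist_eq_norm, Real.coe_toNNReal _ (by positivity)]
    exact abs_kuhnHat_sub_le (by positivity) hball' m u v
  exact this.continuous

/-- The gradient of a nonnegative function vanishes at its zeros. -/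
lemma gradient_eq_zero_of_eq_zero {f : E n → ℝ} (hf : ∀ x, 0 ≤ f x) {x : E n} (hx : f x = 0) :
    gradient f x = 0 := by
  have : IsLocalMin f x := Filter.Eventually.of_forall fun y => by rw [hx]; exact hf y
  rw [gradient, this.fderiv_eq_zero, map_zero]

lemma gradient_congr {f g : E n → ℝ} {x : E n} (h : f =ᶠ[nhds x] g) :
    gradient f x = gradient g x := by
  rw [gradient, gradient, h.fderiv_eq]

lemma gradient_comp_sub (f : E n → ℝ) (a x : E n) :
    gradient (fun y => f (y - a)) x = gradient f (x - a) := by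
  rw [gradient, gradient, fderiv_comp_sub]

variable {b} in
lemma norm_gradient_kuhnHat_le {c : E n} {ρ : ℝ} (hρ : 0 < ρ)
    (hball : Metric.ball c (ρ / 2) ⊆ closedSimplex b) (m : ℕ) (u : E n) :
    ‖gradient (kuhnHat b m) u‖ ≤ 8 * 2 ^ m / ρ := by
  rw [gradient, LinearIsometryEquiv.norm_map]
  have : LipschitzWith (8 * 2 ^ m / ρ).toNNReal (kuhnHat b m) := by
    refine LipschitzWith.of_dist_le_mul fun u v => ?_
    rw [Real.dist_eq, dist_eq_norm, Real.coe_toNNReal _ (by positivity)]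
    exact abs_kuhnHat_sub_le hρ hball m u v
  have h := norm_fderiv_le_of_lipschitz ℝ this (x₀ := u)
  rwa [Real.coe_toNNReal _ (by positivity)] at h

-- Neighbouring lattice points differ by at most `2⁻ᵐ` in each barycentric coordinate; expanding the
-- displacement in the edges at the vertex `b 0` gives the length.
variable {b} in
lemma norm_le_of_spread_le_one {m : ℕ} {δ : E n}
    (h : spread (fun i => cumCoord b m i δ) ≤ 1) :
    ‖δ‖ ≤ (n + 1) * Metric.diam (closedSimplex b) / 2 ^ m := by
  have hlin : ∀ k, (b.coord k).linear δ = b.coord k δ - b.coord k 0 := fun k => by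
    simpa using (b.coord k).linearMap_vsub δ 0
  have hsum : ∑ k, (b.coord k).linear δ = 0 := by
    simp_rw [hlin, Finset.sum_sub_distrib, b.sum_coord_apply_eq_one, sub_self]
  have hδ : δ = ∑ k, (b.coord k).linear δ • (b k - b 0) := by
    simp_rw [smul_sub, Finset.sum_sub_distrib, ← Finset.sum_smul, hsum, zero_smul, sub_zero, hlin,
      sub_smul, Finset.sum_sub_distrib, b.linear_combination_coord_eq_self, sub_zero]
  have hbd : ∀ k, ‖(b.coord k).linear δ • (b k - b 0)‖ ≤
      Metric.diam (closedSimplex b) / 2 ^ m := by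
    intro k
    have h2 : (0 : ℝ) < 2 ^ m := by positivity
    obtain ⟨i, j, hij⟩ := exists_cumCoord_sub b m k
    have h3 := sub_le_spread (fun i => cumCoord b m i δ) i j
    have h4 := sub_le_spread (fun i => cumCoord b m i δ) j i
    have h5 : |(b.coord k).linear δ| ≤ 1 / 2 ^ m := by
      rw [le_div_iff₀ h2, ← abs_of_pos h2, ← abs_mul, mul_comm, hij, abs_le]
      constructor <;> linarith
    have h6 : ‖b k - b 0‖ ≤ Metric.diam (closedSimplex b) := by
      rw [← dist_eq_norm]
      exact Metric.dist_le_diam_of_mem (isCompact_closedSimplex b).isBounded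
        (subset_convexHull ℝ _ (mem_range_self k)) (subset_convexHull ℝ _ (mem_range_self 0))
    rw [norm_smul, Real.norm_eq_abs, div_eq_mul_one_div, mul_comm]
    exact mul_le_mul h6 h5 (abs_nonneg _) Metric.diam_nonneg
  calc ‖δ‖ = ‖∑ k, (b.coord k).linear δ • (b k - b 0)‖ := by rw [← hδ]
    _ ≤ ∑ k : Fin (n + 1), Metric.diam (closedSimplex b) / 2 ^ m := norm_sum_le_of_le _ fun k _ => hbd k
    _ = (n + 1) * Metric.diam (closedSimplex b) / 2 ^ m := by simp; ring

variable {b} in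
lemma one_le_coord_of_mem_interiorLattice {m : ℕ} {p : E n} (hp : p ∈ interiorLattice b m)
    (k : Fin (n + 1)) : ∃ c : ℕ, 1 ≤ c ∧ 2 ^ m * b.coord k p = c := by
  rw [mem_interiorLattice_iff, mem_lattice_iff, mem_openSimplex_basis] at hp
  obtain ⟨c, hc⟩ := hp.1 k
  refine ⟨c, ?_, hc⟩
  have : 0 < 2 ^ m * b.coord k p := mul_pos (by positivity) (hp.2 k)
  rw [hc] at this
  exact_mod_cast this

variable {b} in
/-- The star of an interior lattice point lies in the simplex. -/
lemma mem_openSimplex_of_kuhnHat_ne_zero {m : ℕ} {p x : E n} (hp : p ∈ interiorLattice b m)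
    (hx : kuhnHat b m (x - p) ≠ 0) : x ∈ openSimplex b := by
  rw [mem_openSimplex_basis]
  intro k
  rw [kuhnHat_ne_zero_iff] at hx
  obtain ⟨c, hc, hpc⟩ := one_le_coord_of_mem_interiorLattice hp k
  obtain ⟨i, j, hij⟩ := exists_cumCoord_sub b m k
  have h1 := sub_le_spread (fun i => cumCoord b m i (x - p)) j i
  have h2 := hij (x - p)
  have h3 := (b.coord k).linearMap_vsub x p
  simp only [vsub_eq_sub] at h3
  rw [h3, mul_sub, hpc] at h2
  have h4 : (1 : ℝ) ≤ c := by exact_mod_cast hc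
  have : 0 < 2 ^ m * b.coord k x := by linarith
  exact pos_of_mul_pos_right this (by positivity)

-- The scaled barycentric coordinates of an interior lattice point are integers at least 1 and drop
-- by at most 1, so they remain nonnegative integers.
variable {b} in
lemma add_mem_lattice {m : ℕ} {p δ : E n} (hp : p ∈ interiorLattice b m)
    (hδ : ∀ i, ∃ z : ℤ, cumCoord b m i δ = z) (h : spread (fun i => cumCoord b m i δ) ≤ 1) :
    p + δ ∈ lattice b m := by
  rw [mem_lattice_iff]
  intro k
  obtain ⟨c, hc, hpc⟩ := one_le_coord_of_mem_interiorLattice hp k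
  obtain ⟨i, j, hij⟩ := exists_cumCoord_sub b m k
  obtain ⟨zi, hzi⟩ := hδ i
  obtain ⟨zj, hzj⟩ := hδ j
  have h1 := (sub_le_spread (fun i => cumCoord b m i δ) j i).trans h
  have h2 := hij δ
  have h3 := (b.coord k).linearMap_vsub (p + δ) p
  simp only [vsub_eq_sub, add_sub_cancel_left] at h3
  rw [h3, mul_sub, hpc, hzi, hzj] at h2
  simp only [hzi, hzj] at h1
  have h4 : zj - zi ≤ 1 := by exact_mod_cast h1
  refine ⟨(c + (zi - zj)).toNat, ?_⟩
  have h5 : (((c + (zi - zj)).toNat : ℤ) : ℝ) = ((c + (zi - zj) : ℤ) : ℝ) := by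
    rw [Int.toNat_of_nonneg (by omega)]
  rw [Int.cast_natCast] at h5
  rw [h5]
  push_cast
  linarith

lemma closedSimplex_subset_of_mem_iterSubdivide {m : ℕ} {t : Simplex n}
    (ht : t ∈ iterSubdivide b m) : closedSimplex t ⊆ closedSimplex b := by
  refine convexHull_min ?_ (convex_closedSimplex _)
  rintro _ ⟨k, rfl⟩
  exact lattice_subset b m (mem_lattice_of_mem_iterSubdivide b ht k)

lemma openSimplex_subset_of_mem_iterSubdivide {m : ℕ} {t : Simplex n}
    (ht : t ∈ iterSubdivide b m) : openSimplex t ⊆ openSimplex b :=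
  interior_mono (closedSimplex_subset_of_mem_iterSubdivide b ht)

lemma closedSimplex_subset_closure : closedSimplex b ⊆ closure (openSimplex b) := by
  rw [openSimplex, (convex_closedSimplex b).closure_interior_eq_closure_of_nonempty_interior
    (openSimplex_nonempty b)]
  exact subset_closure

end Basis

/-! ### Vertex functions on a macro-element -/

lemma mem_fineMesh {𝒯 : Finset (Simplex n)} {m : ℕ} {t : Simplex n} :
    t ∈ fineMesh 𝒯 m ↔ ∃ y ∈ 𝒯, t ∈ iterSubdivide y m := by
  simp [fineMesh]

section Mesh

variable {Ω : Set (E n)} {𝒯 : Finset (Simplex n)} {m : ℕ}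
  {b b' : AffineBasis (Fin (n + 1)) ℝ (E n)}

lemma IsMacroMesh.exists_basis (hM : IsMacroMesh Ω 𝒯) {T : Simplex n} (hT : T ∈ 𝒯) :
    ∃ b : AffineBasis (Fin (n + 1)) ℝ (E n), ⇑b = T :=
  exists_affineBasis (hM.nondegenerate T hT)

/-- A point of the closed simplex `S` is a limit of points of its interior, so an open `T`
containing it would meet the interior of `S`. -/
lemma IsMacroMesh.eq_of_mem (hM : IsMacroMesh Ω 𝒯) {T S : Simplex n} (hT : T ∈ 𝒯) (hS : S ∈ 𝒯)
    {x : E n} (hx : x ∈ openSimplex T) (hx' : x ∈ closedSimplex S) : S = T := by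
  by_contra hne
  obtain ⟨b', rfl⟩ := hM.exists_basis hS
  obtain ⟨y, hy, hy'⟩ := mem_closure_iff.mp (closedSimplex_subset_closure b' hx') _
    (isOpen_openSimplex T) hx
  exact Set.disjoint_left.mp (hM.disjoint T hT _ hS (Ne.symm hne)) hy hy'

lemma vertexFun_nonneg (𝒮 : Finset (Simplex n)) (p x : E n) : 0 ≤ vertexFun 𝒮 p x := by
  unfold vertexFun
  split_ifs with h
  · exact Finset.sum_nonneg fun k _ => h.choose_spec.2.1 k
  · exact le_rfl

variable (hn : n = 1 ∨ n = 2 ∨ n = 3) (hM : IsMacroMesh Ω 𝒯) (hb : ⇑b ∈ 𝒯)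
include hn hM hb

/-- Inside a macro-element, vertex functions are barycentric coordinates of fine simplices. -/
lemma vertexFun_eq_sum {x : E n} (hx : x ∈ openSimplex b) {t : Simplex n}
    (ht : t ∈ iterSubdivide b m) {w : Fin (n + 1) → ℝ} (hw : IsBarycentric t x w) (q : E n)
    [∀ k, Decidable (t k = q)] :
    vertexFun (fineMesh 𝒯 m) q x = ∑ k with t k = q, w k := by
  classical
  have h : ∃ tw : Simplex n × (Fin (n + 1) → ℝ), tw.1 ∈ fineMesh 𝒯 m ∧
      IsBarycentric tw.1 x tw.2 := ⟨(t, w), mem_fineMesh.mpr ⟨_, hb, ht⟩, hw⟩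
  rw [vertexFun, dif_pos h]
  obtain ⟨h1, h2⟩ := h.choose_spec
  obtain ⟨S, hS, h3⟩ := mem_fineMesh.mp h1
  obtain ⟨b', rfl⟩ := hM.exists_basis hS
  -- The simplex selected by the definition of `vertexFun` must come from the same macro-element. At
  -- a lattice point both selections then give the value of one hat function.
  have h4 := hM.eq_of_mem hb hS hx (closedSimplex_subset_of_mem_iterSubdivide b' h3
    ((mem_closedSimplex_iff _ _).mpr ⟨_, h2⟩))
  rw [h4] at h3
  by_cases hq : q ∈ lattice b m
  · rw [sum_weights_eq_kuhnHat b hn ht hw hq]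
    convert sum_weights_eq_kuhnHat b hn h3 h2 hq
  · rw [Finset.sum_eq_zero, Finset.sum_eq_zero]
    · intro k hk
      rw [Finset.mem_filter] at hk
      exact absurd (hk.2 ▸ mem_lattice_of_mem_iterSubdivide b ht k) hq
    · intro k hk
      rw [Finset.mem_filter] at hk
      exact absurd (hk.2 ▸ mem_lattice_of_mem_iterSubdivide b h3 k) hq

lemma vertexFun_eq_kuhnHat {x : E n} (hx : x ∈ openSimplex b) {q : E n} (hq : q ∈ lattice b m) :
    vertexFun (fineMesh 𝒯 m) q x = kuhnHat b m (x - q) := by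
  classical
  obtain ⟨t, ht, w, hw⟩ := exists_mem_iterSubdivide hn m (openSimplex_subset _ hx)
  rw [vertexFun_eq_sum hn hM hb hx ht hw, sum_weights_eq_kuhnHat b hn ht hw hq]

lemma vertexFun_eq_zero {x : E n} (hx : x ∈ openSimplex b) {q : E n} (hq : q ∉ lattice b m) :
    vertexFun (fineMesh 𝒯 m) q x = 0 := by
  classical
  obtain ⟨t, ht, w, hw⟩ := exists_mem_iterSubdivide hn m (openSimplex_subset _ hx)
  rw [vertexFun_eq_sum hn hM hb hx ht hw]
  refine Finset.sum_eq_zero fun k hk => ?_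
  rw [Finset.mem_filter] at hk
  exact absurd (hk.2 ▸ mem_lattice_of_mem_iterSubdivide b ht k) hq

/-- The vertex function of an interior lattice point is a translated hat function. -/
lemma vertexFun_interior {p : E n} (hp : p ∈ interiorLattice b m) (x : E n) :
    vertexFun (fineMesh 𝒯 m) p x = kuhnHat b m (x - p) := by
  classical
  have hp' := (mem_interiorLattice_iff b m p).mp hp
  by_cases hx : x ∈ openSimplex b
  · exact vertexFun_eq_kuhnHat hn hM hb hx hp'.1
  have h0 : kuhnHat b m (x - p) = 0 := by
    by_contra h
    exact hx (mem_openSimplex_of_kuhnHat_ne_zero hp h)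
  rw [vertexFun]
  split_ifs with h
  · obtain ⟨h1, h2⟩ := h.choose_spec
    obtain ⟨S, hS, h3⟩ := mem_fineMesh.mp h1
    obtain ⟨b', rfl⟩ := hM.exists_basis hS
    by_cases hbb : ⇑b' = b
    · rw [hbb] at h3
      convert sum_weights_eq_kuhnHat b hn h3 h2 hp'.1
    -- A fine simplex of another macro-element cannot have `p` as a vertex, since `p` is interior to
    -- this one.
    · rw [h0]
      refine Finset.sum_eq_zero fun k hk => ?_
      rw [Finset.mem_filter] at hk
      have := lattice_subset b' m (mem_lattice_of_mem_iterSubdivide b' h3 k)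
      rw [hk.2] at this
      exact absurd (hM.eq_of_mem hb hS hp'.2 this) hbb
  · exact h0.symm

/-! ### Directions, overlaps and stencil domains -/

lemma refFun_eq (h : (interiorLattice b m).Nonempty) : refFun 𝒯 m b = kuhnHat b m := by
  ext y
  rw [refFun, dif_pos h, vertexFun_interior hn hM hb h.choose_spec, add_sub_cancel_right]

/-- This description of the directions does not mention a base point. Overlapping supports give a
coordinate spread below 2, which integrality sharpens to at most 1; conversely the midpoint `p + δ /
2` lies in both supports. -/
lemma mem_directions_iff {δ : E n} :
    δ ∈ directions 𝒯 m b ↔ (interiorLattice b m).Nonempty ∧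
      (∀ i, ∃ z : ℤ, cumCoord b m i δ = z) ∧ spread (fun i => cumCoord b m i δ) ≤ 1 := by
  constructor
  · rintro ⟨p, hp, q, hq, rfl, x, hxp, hxq⟩
    rw [Function.mem_support, vertexFun_interior hn hM hb hp] at hxp
    have hx := mem_openSimplex_of_kuhnHat_ne_zero hp hxp
    rw [Function.mem_support, vertexFun_eq_kuhnHat hn hM hb hx hq] at hxq
    rw [kuhnHat_ne_zero_iff] at hxp hxq
    have hint := exists_int_cumCoord_sub b hq ((mem_interiorLattice_iff b m p).mp hp).1
    refine ⟨⟨p, hp⟩, hint, spread_le fun i j => ?_⟩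
    obtain ⟨zi, hzi⟩ := hint i
    obtain ⟨zj, hzj⟩ := hint j
    have h1 := sub_le_spread (fun i => cumCoord b m i (x - p)) i j
    have h2 := sub_le_spread (fun i => cumCoord b m i (x - q)) j i
    have h3 : cumCoord b m i (q - p) - cumCoord b m j (q - p) < 2 := by
      simp only [map_sub] at h1 h2 hxp hxq ⊢
      linarith
    rw [hzi, hzj] at h3 ⊢
    have h4 : zi - zj < 2 := by exact_mod_cast h3
    have h5 : zi - zj ≤ 1 := by omega
    exact_mod_cast h5
  · rintro ⟨⟨p, hp⟩, hint, hs⟩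
    have hsp : spread (fun i => cumCoord b m i ((1 / 2 : ℝ) • δ)) < 1 := by
      refine lt_of_le_of_lt (spread_le (c := 1 / 2) fun i j => ?_) (by norm_num)
      have := sub_le_spread (fun i => cumCoord b m i δ) i j
      simp only [map_smul, smul_eq_mul]
      linarith
    have hxp : kuhnHat b m (p + (1 / 2 : ℝ) • δ - p) ≠ 0 := by
      rw [kuhnHat_ne_zero_iff, add_sub_cancel_left]; exact hsp
    refine ⟨p, hp, p + δ, add_mem_lattice hp hint hs, by abel, p + (1 / 2 : ℝ) • δ, ?_, ?_⟩
    · rw [Function.mem_support, vertexFun_interior hn hM hb hp]; exact hxp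
    · rw [Function.mem_support, vertexFun_eq_kuhnHat hn hM hb
        (mem_openSimplex_of_kuhnHat_ne_zero hp hxp) (add_mem_lattice hp hint hs),
        kuhnHat_ne_zero_iff, ← spread_neg]
      convert hsp using 2
      ext i
      rw [Pi.neg_apply, ← map_neg]
      congr 1
      module

lemma neg_mem_directions {δ : E n} (hδ : δ ∈ directions 𝒯 m b) : -δ ∈ directions 𝒯 m b := by
  rw [mem_directions_iff hn hM hb] at hδ ⊢
  obtain ⟨h1, h2, h3⟩ := hδ
  refine ⟨h1, fun i => ?_, ?_⟩
  · obtain ⟨z, hz⟩ := h2 i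
    exact ⟨-z, by rw [map_neg, hz]; push_cast; rfl⟩
  · rw [← spread_neg] at h3
    convert h3 using 2
    ext i
    rw [map_neg]; rfl

lemma add_direction_mem_lattice {p δ : E n} (hp : p ∈ interiorLattice b m)
    (hδ : δ ∈ directions 𝒯 m b) : p + δ ∈ lattice b m := by
  rw [mem_directions_iff hn hM hb] at hδ
  exact add_mem_lattice hp hδ.2.1 hδ.2.2

lemma norm_direction_le {δ : E n} (hδ : δ ∈ directions 𝒯 m b) :
    ‖δ‖ ≤ (n + 1) * Metric.diam (closedSimplex b) / 2 ^ m :=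
  norm_le_of_spread_le_one ((mem_directions_iff hn hM hb).mp hδ).2.2

lemma overlap_eq {δ : E n} (h : (interiorLattice b m).Nonempty) :
    overlap 𝒯 m b δ = {y | kuhnHat b m y ≠ 0 ∧ kuhnHat b m (y - δ) ≠ 0} := by
  ext y
  simp [overlap, refFunShift, refFun_eq hn hM hb h]

lemma isOpen_overlap {δ : E n} (h : (interiorLattice b m).Nonempty) :
    IsOpen (overlap 𝒯 m b δ) := by
  rw [overlap_eq hn hM hb h]
  have h1 := continuous_kuhnHat b m
  exact (isOpen_ne_fun h1 continuous_const).inter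
    (isOpen_ne_fun (h1.comp (continuous_id.sub continuous_const)) continuous_const)

/-- For `x` in the closure one only gets that `x + Ω_δ` lies in the closed simplex; being open, it
lies in the interior. -/
lemma add_mem_openSimplex_of_stencilDomain {δ x y : E n} (h : (interiorLattice b m).Nonempty)
    (hx : x ∈ stencilDomain 𝒯 m b δ) (hy : y ∈ overlap 𝒯 m b δ) : x + y ∈ openSimplex b := by
  have hsub : (fun y => x + y) '' overlap 𝒯 m b δ ⊆ closedSimplex b := by
    rintro _ ⟨z, hz, rfl⟩
    have : x ∈ (fun x => x + z) ⁻¹' closedSimplex b := by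
      refine closure_minimal ?_ ((isCompact_closedSimplex _).isClosed.preimage (by fun_prop)) hx
      intro x' hx'
      exact openSimplex_subset _ (hx'.2 z hz)
    exact this
  have hopen : IsOpen ((fun y => x + y) '' overlap 𝒯 m b δ) :=
    (Homeomorph.addLeft x).isOpenMap _ (isOpen_overlap hn hM hb h)
  exact interior_maximal hsub hopen ⟨y, hy, rfl⟩

lemma add_overlap_subset {p q : E n} (hpq : p ∈ interiorLattice b m ∨ q ∈ interiorLattice b m)
    {y : E n} (hy : y ∈ overlap 𝒯 m b (q - p)) : p + y ∈ openSimplex b := by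
  have h : (interiorLattice b m).Nonempty := by rcases hpq with h | h; exacts [⟨_, h⟩, ⟨_, h⟩]
  rw [overlap_eq hn hM hb h] at hy
  rcases hpq with hp | hq
  · refine mem_openSimplex_of_kuhnHat_ne_zero hp ?_
    rw [add_sub_cancel_left]; exact hy.1
  · refine mem_openSimplex_of_kuhnHat_ne_zero hq ?_
    convert hy.2 using 2
    abel

lemma right_add_overlap_subset {p q : E n} (hq : q ∈ interiorLattice b m)
    {y : E n} (hy : y ∈ overlap 𝒯 m b (q - p)) : q + y ∈ openSimplex b := by
  rw [overlap_eq hn hM hb ⟨_, hq⟩] at hy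
  refine mem_openSimplex_of_kuhnHat_ne_zero hq ?_
  rw [add_sub_cancel_left]; exact hy.1

lemma mem_stencilDomain {p q : E n} (hpq : p ∈ interiorLattice b m ∨ q ∈ interiorLattice b m)
    (hp : p ∈ lattice b m) : p ∈ stencilDomain 𝒯 m b (q - p) := by
  by_cases hpi : p ∈ interiorLattice b m
  · exact subset_closure ⟨((mem_interiorLattice_iff b m p).mp hpi).2,
      fun y hy => add_overlap_subset hn hM hb hpq hy⟩
  · have hq : q ∈ interiorLattice b m := hpq.resolve_left hpi
    have hqo := ((mem_interiorLattice_iff b m q).mp hq).2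
    have hpc := lattice_subset b m hp
    have hconv := convex_openSimplex b
    -- Here `p` may lie on the boundary of the macro-element. The points slightly towards `q` lie in
    -- `T_δ`, since the translates of the overlap by `p` and by `q` are both inside and the simplex
    -- is convex. So `p` belongs to the closure.
    have hmem : ∀ ε ∈ Ioo (0 : ℝ) 1, p + ε • (q - p) ∈
        {x | x ∈ openSimplex b ∧ ∀ y ∈ overlap 𝒯 m b (q - p), x + y ∈ openSimplex b} := by
      intro ε hε
      constructor
      · have := (convex_closedSimplex b).combo_self_interior_mem_interior hpc hqo
          (sub_nonneg.mpr hε.2.le) hε.1 (by ring : (1 - ε) + ε = 1)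
        have e : p + ε • (q - p) = (1 - ε) • p + ε • q := by module
        rw [e]; exact this
      · intro y hy
        have h1 := add_overlap_subset hn hM hb hpq hy
        have h2 := right_add_overlap_subset hn hM hb hq hy
        have := hconv h1 h2 (sub_nonneg.mpr hε.2.le) hε.1.le (by ring : (1 - ε) + ε = 1)
        have e : p + ε • (q - p) + y = (1 - ε) • (p + y) + ε • (q + y) := by module
        rw [e]; exact this
    have hlim : Filter.Tendsto (fun ε : ℝ => p + ε • (q - p)) (nhdsWithin 0 (Ioi 0)) (nhds p) := by
      have : Continuous fun ε : ℝ => p + ε • (q - p) := by fun_prop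
      have h := this.tendsto 0
      simp only [zero_smul, add_zero] at h
      exact h.mono_left nhdsWithin_le_nhds
    refine mem_closure_of_tendsto hlim ?_
    filter_upwards [Ioo_mem_nhdsGT (zero_lt_one' ℝ)] with ε hε using hmem ε hε

end Mesh

/-! ### Weak derivatives -/

lemma IsTestFunction.mono {U V : Set (E n)} (h : V ⊆ U) {φ : E n → ℝ} (hφ : IsTestFunction V φ) :
    IsTestFunction U φ := ⟨hφ.1, hφ.2.1, hφ.2.2.trans h⟩

lemma setIntegral_mul_test {U : Set (E n)} {φ : E n → ℝ} (hφ : IsTestFunction U φ)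
    (f : E n → ℝ) : ∫ x in U, f x * φ x = ∫ x, f x * φ x := by
  refine setIntegral_eq_integral_of_forall_compl_eq_zero fun x hx => ?_
  rw [image_eq_zero_of_notMem_tsupport fun h => hx (hφ.2.2 h), mul_zero]

lemma iteratedFDeriv_test_eq_zero {U : Set (E n)} {φ : E n → ℝ} (hφ : IsTestFunction U φ)
    {k : ℕ} {x : E n} (hx : x ∉ U) : iteratedFDeriv ℝ k φ x = 0 := by
  by_contra h
  exact hx (hφ.2.2 (support_iteratedFDeriv_subset k h))

lemma setIntegral_mul_iteratedFDeriv_test {U : Set (E n)} {φ : E n → ℝ} (hφ : IsTestFunction U φ)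
    (f : E n → ℝ) {k : ℕ} (e : Fin k → E n) :
    ∫ x in U, f x * iteratedFDeriv ℝ k φ x e = ∫ x, f x * iteratedFDeriv ℝ k φ x e := by
  refine setIntegral_eq_integral_of_forall_compl_eq_zero fun x hx => ?_
  simp [iteratedFDeriv_test_eq_zero hφ hx]

lemma IsWeakDeriv.integral_eq {U : Set (E n)} {k : ℕ} {ι : Fin k → Fin n} {f g : E n → ℝ}
    (h : IsWeakDeriv U ι f g) {φ : E n → ℝ} (hφ : IsTestFunction U φ) :
    ∫ x, f x * iteratedFDeriv ℝ k φ x (fun i => EuclideanSpace.single (ι i) (1 : ℝ)) =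
      (-1 : ℝ) ^ k * ∫ x, g x * φ x := by
  rw [← setIntegral_mul_test hφ, ← setIntegral_mul_iteratedFDeriv_test hφ]
  exact h.2.2 φ hφ

lemma IsWeakDeriv.mono {U V : Set (E n)} (hVU : V ⊆ U) {k : ℕ} {ι : Fin k → Fin n}
    {f g : E n → ℝ} (h : IsWeakDeriv U ι f g) : IsWeakDeriv V ι f g := by
  refine ⟨h.1.mono_set hVU, h.2.1.mono_set hVU, fun φ hφ => ?_⟩
  rw [setIntegral_mul_test hφ, setIntegral_mul_iteratedFDeriv_test hφ]
  exact h.integral_eq (hφ.mono hVU)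

lemma integrable_mul_test {U : Set (E n)} {φ : E n → ℝ} (hφ : IsTestFunction U φ)
    {f : E n → ℝ} (hf : LocallyIntegrableOn f U) : Integrable fun x => f x * φ x := by
  have h := (hf.mono_set hφ.2.2).integrableOn_isCompact hφ.2.1
  have h2 := (h.mul_continuousOn hφ.1.continuous.continuousOn hφ.2.1)
  rwa [integrableOn_iff_integrable_of_support_subset] at h2
  intro x hx
  exact subset_tsupport _ fun h0 => hx (by simp [h0])

/-- Weak derivatives are unique almost everywhere. -/
lemma IsWeakDeriv.ae_eq {U : Set (E n)} (hU : IsOpen U) {k : ℕ} {ι : Fin k → Fin n}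
    {f g g' : E n → ℝ} (h : IsWeakDeriv U ι f g) (h' : IsWeakDeriv U ι f g') :
    ∀ᵐ x, x ∈ U → g x = g' x := by
  have := hU.ae_eq_zero_of_integral_contDiff_smul_eq_zero (μ := volume) (f := fun x => g x - g' x)
    (h.2.1.sub h'.2.1) (fun φ h1 h2 h3 => ?_)
  · filter_upwards [this] with x hx hxU
    exact sub_eq_zero.mp (hx hxU)
  · have hφ : IsTestFunction U φ := ⟨h1, h2, h3⟩
    have e := (h.integral_eq hφ).symm.trans (h'.integral_eq hφ)
    have e' := mul_left_cancel₀ (pow_ne_zero k (by norm_num : (-1 : ℝ) ≠ 0)) e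
    simp_rw [smul_eq_mul, mul_sub, mul_comm (φ _)]
    rw [integral_sub (integrable_mul_test hφ h.2.1) (integrable_mul_test hφ h'.2.1), e', sub_self]

/-! ### Affine functions and their gradients -/

/-- The gradient of an affine function. -/
noncomputable def affineGrad (f : E n →ᵃ[ℝ] ℝ) : E n :=
  (InnerProductSpace.toDual ℝ (E n)).symm f.linear.toContinuousLinearMap

lemma inner_affineGrad (f : E n →ᵃ[ℝ] ℝ) (u : E n) : inner ℝ (affineGrad f) u = f.linear u := by
  rw [affineGrad, InnerProductSpace.toDual_symm_apply]; rfl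

lemma affineGrad_apply (f : E n →ᵃ[ℝ] ℝ) (a : Fin n) :
    affineGrad f a = f.linear (EuclideanSpace.single a 1) := by
  rw [← inner_affineGrad]; simp [EuclideanSpace.inner_single_right]

lemma hasFDerivAt_affine (f : E n →ᵃ[ℝ] ℝ) (x : E n) :
    HasFDerivAt f f.linear.toContinuousLinearMap x := by
  have h1 : (f : E n → ℝ) = fun x => f.linear.toContinuousLinearMap x + f 0 := by
    ext y
    have := f.linearMap_vsub y 0
    simp only [vsub_eq_sub, sub_zero] at this
    simp [this]
  rw [h1]
  exact (f.linear.toContinuousLinearMap.hasFDerivAt).add_const _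

lemma gradient_affine (f : E n →ᵃ[ℝ] ℝ) (x : E n) : gradient f x = affineGrad f := by
  rw [gradient, (hasFDerivAt_affine f x).fderiv, affineGrad]

lemma isWeakDeriv_affine {U : Set (E n)} (f : E n →ᵃ[ℝ] ℝ) (a : Fin n) :
    IsWeakDeriv U (fun _ : Fin 1 => a) f fun _ => affineGrad f a := by
  have hc : Continuous f := by
    rw [continuous_iff_continuousAt]; exact fun x => (hasFDerivAt_affine f x).continuousAt
  refine ⟨hc.locallyIntegrable.locallyIntegrableOn _,
    continuous_const.locallyIntegrable.locallyIntegrableOn _, fun φ hφ => ?_⟩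
  rw [setIntegral_mul_test hφ, setIntegral_mul_iteratedFDeriv_test hφ]
  simp_rw [iteratedFDeriv_one_apply]
  have hφd : Continuous fun x => fderiv ℝ φ x (EuclideanSpace.single a (1 : ℝ)) :=
    (hφ.1.continuous_fderiv (by simp)).clm_apply continuous_const
  have hφs : HasCompactSupport fun x => fderiv ℝ φ x (EuclideanSpace.single a (1 : ℝ)) :=
    hφ.2.1.fderiv_apply ℝ _
  have hfd : ∀ x, fderiv ℝ f x (EuclideanSpace.single a (1 : ℝ)) = affineGrad f a := fun x => by
    rw [(hasFDerivAt_affine f x).fderiv, affineGrad_apply]; rfl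
  rw [integral_mul_fderiv_eq_neg_fderiv_mul_of_integrable (μ := volume)]
  · simp_rw [hfd]; simp
  · simp_rw [hfd]
    exact (continuous_const.mul hφ.1.continuous).integrable_of_hasCompactSupport hφ.2.1.mul_left
  · exact (hc.mul hφd).integrable_of_hasCompactSupport hφs.mul_left
  · exact (hc.mul hφ.1.continuous).integrable_of_hasCompactSupport hφ.2.1.mul_left
  · exact fun x _ => (hasFDerivAt_affine f x).differentiableAt
  · exact fun x _ => hφ.1.differentiable (by simp) x

lemma IsWeakDeriv.congr_left {U : Set (E n)} (hU : MeasurableSet U) {k : ℕ} {ι : Fin k → Fin n}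
    {f f' g : E n → ℝ} (h : IsWeakDeriv U ι f g) (hff' : EqOn f f' U) :
    IsWeakDeriv U ι f' g := by
  refine ⟨?_, h.2.1, fun φ hφ => ?_⟩
  · intro x hx
    obtain ⟨s, hs, hs'⟩ := h.1 x hx
    refine ⟨s ∩ U, Filter.inter_mem hs self_mem_nhdsWithin, ?_⟩
    have h1 : IntegrableOn f (U ∩ s) := hs'.mono_set inter_subset_right
    rw [inter_comm]
    have : f =ᵐ[volume.restrict (U ∩ s)] f' :=
      ae_restrict_of_ae_restrict_of_subset inter_subset_left
        ((ae_restrict_iff' hU).mpr (Filter.Eventually.of_forall fun x hx => hff' hx))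
    exact h1.congr this
  · rw [← h.2.2 φ hφ]
    exact setIntegral_congr_fun hU fun x hx => by simp only [hff' hx]

/-- On an open set where a function is affine, its weak gradient is the gradient. -/
lemma ae_eq_affineGrad {Ω V : Set (E n)} (hV : IsOpen V) (hVΩ : V ⊆ Ω) {v : E n → ℝ}
    {g : E n → E n} (h : ∀ a : Fin n, IsWeakDeriv Ω (fun _ : Fin 1 => a) v (fun x => g x a))
    {f : E n →ᵃ[ℝ] ℝ} (hf : EqOn v f V) : ∀ᵐ x, x ∈ V → g x = affineGrad f := by
  have : ∀ a : Fin n, ∀ᵐ x, x ∈ V → g x a = affineGrad f a := fun a =>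
    IsWeakDeriv.ae_eq hV (((h a).mono hVΩ).congr_left hV.measurableSet hf)
      (isWeakDeriv_affine f a)
  filter_upwards [ae_all_iff.mpr this] with x hx hxV
  ext a
  exact hx a hxV

/-! ### Almost every point lies inside a fine simplex -/

lemma affine_sum_smul {κ : Type*} [Fintype κ] (f : E n →ᵃ[ℝ] ℝ) (w : κ → ℝ)
    (hw : ∑ j, w j = 1) (t : κ → E n) : f (∑ j, w j • t j) = ∑ j, w j * f (t j) := by
  rw [← Finset.affineCombination_eq_linear_combination _ _ _ hw,
    Finset.map_affineCombination _ _ _ hw, Finset.affineCombination_eq_linear_combination _ _ _ hw]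
  simp

lemma affine_eq_sum_coord (b : AffineBasis (Fin (n + 1)) ℝ (E n)) (f : E n →ᵃ[ℝ] ℝ) (x : E n) :
    f x = ∑ k, b.coord k x * f (b k) := by
  conv_lhs => rw [← b.linear_combination_coord_eq_self x]
  exact affine_sum_smul f _ (b.sum_coord_apply_eq_one x) _

lemma affineGrad_eq_sum (b : AffineBasis (Fin (n + 1)) ℝ (E n)) (f : E n →ᵃ[ℝ] ℝ) :
    affineGrad f = ∑ k, f (b k) • affineGrad (b.coord k) := by
  refine ext_inner_right ℝ fun u => ?_
  simp_rw [sum_inner, inner_smul_left, inner_affineGrad]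
  have h1 := f.linearMap_vsub u 0
  have h2 : ∀ k, (b.coord k).linear u = b.coord k u - b.coord k 0 := fun k => by
    simpa using (b.coord k).linearMap_vsub u 0
  simp only [vsub_eq_sub, sub_zero] at h1
  rw [h1, affine_eq_sum_coord b f u, affine_eq_sum_coord b f 0, ← Finset.sum_sub_distrib]
  refine Finset.sum_congr rfl fun k _ => ?_
  rw [h2, RCLike.conj_to_real]; ring

lemma affineGrad_sum_coord (b : AffineBasis (Fin (n + 1)) ℝ (E n)) :
    ∑ k, affineGrad (b.coord k) = 0 := by
  refine ext_inner_right ℝ fun u => ?_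
  simp_rw [sum_inner, inner_affineGrad, inner_zero_left]
  have h2 : ∀ k, (b.coord k).linear u = b.coord k u - b.coord k 0 := fun k => by
    simpa using (b.coord k).linearMap_vsub u 0
  simp_rw [h2, Finset.sum_sub_distrib, b.sum_coord_apply_eq_one, sub_self]

section Mesh

variable {Ω : Set (E n)} {𝒯 : Finset (Simplex n)} {m : ℕ}

lemma ae_mem_fine_openSimplex (hn : n = 1 ∨ n = 2 ∨ n = 3) (hM : IsMacroMesh Ω 𝒯) (m : ℕ) :
    ∀ᵐ x, x ∈ Ω → ∃ T ∈ 𝒯, ∃ t ∈ iterSubdivide T m, x ∈ openSimplex t := by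
  have hnull : volume (⋃ T ∈ 𝒯, ⋃ t ∈ iterSubdivide T m, closedSimplex t \ openSimplex t) = 0 := by
    refine (measure_biUnion_null_iff 𝒯.countable_toSet).mpr fun T _ => ?_
    exact (measure_biUnion_null_iff (iterSubdivide T m).countable_toSet).mpr fun t _ =>
      closedSimplex_diff_openSimplex_null t
  filter_upwards [measure_eq_zero_iff_ae_notMem.mp hnull] with x hx hxΩ
  have h1 := subset_closure hxΩ
  rw [hM.cover] at h1
  obtain ⟨T, hT, hxT⟩ := mem_iUnion₂.mp h1
  obtain ⟨t, ht, w, hw⟩ := exists_mem_iterSubdivide hn m hxT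
  refine ⟨T, hT, t, ht, ?_⟩
  by_contra h
  exact hx (mem_iUnion₂.mpr ⟨T, hT, mem_iUnion₂.mpr ⟨t, ht,
    (mem_closedSimplex_iff _ _).mpr ⟨w, hw⟩, h⟩⟩)

lemma ae_mem_openSimplex (hn : n = 1 ∨ n = 2 ∨ n = 3) (hM : IsMacroMesh Ω 𝒯) :
    ∀ᵐ x, x ∈ Ω → ∃ T ∈ 𝒯, x ∈ openSimplex T := by
  filter_upwards [ae_mem_fine_openSimplex hn hM 0] with x hx hxΩ
  obtain ⟨T, hT, t, ht, hxt⟩ := hx hxΩ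
  simp only [iterSubdivide, Finset.mem_singleton] at ht
  exact ⟨T, hT, ht ▸ hxt⟩

lemma mem_vertices {p : E n} : p ∈ vertices 𝒯 m ↔ ∃ T ∈ 𝒯, p ∈ lattice T m := by
  simp [vertices]

open scoped Classical in
lemma gradient_vertexFun_eq_sum (hn : n = 1 ∨ n = 2 ∨ n = 3) (hM : IsMacroMesh Ω 𝒯)
    {b bt : AffineBasis (Fin (n + 1)) ℝ (E n)} (hb : ⇑b ∈ 𝒯) (hbt : ⇑bt ∈ iterSubdivide b m)
    {x : E n} (hx : x ∈ openSimplex bt) (q : E n) :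
    gradient (vertexFun (fineMesh 𝒯 m) q) x = ∑ k with bt k = q, affineGrad (bt.coord k) := by
  have hev : vertexFun (fineMesh 𝒯 m) q =ᶠ[nhds x]
      ⇑(∑ k with bt k = q, (bt.coord k : E n →ᵃ[ℝ] ℝ)) := by
    filter_upwards [(isOpen_openSimplex bt).mem_nhds hx] with z hz
    obtain ⟨w, hw⟩ := (mem_closedSimplex_iff _ _).mp (openSimplex_subset _ hz)
    rw [vertexFun_eq_sum hn hM hb (openSimplex_subset_of_mem_iterSubdivide b hbt hz) hbt hw]
    have : ∀ s : Finset (Fin (n + 1)), (∑ k ∈ s, (bt.coord k : E n →ᵃ[ℝ] ℝ)) z =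
        ∑ k ∈ s, bt.coord k z := by
      intro s
      induction s using Finset.induction_on with
      | empty => simp
      | insert a s ha ih => rw [Finset.sum_insert ha, Finset.sum_insert ha, ← ih]; rfl
    rw [this]
    exact Finset.sum_congr rfl fun k _ => (coord_of_isBarycentric bt hw k).symm
  rw [gradient_congr hev, gradient_affine]
  generalize ({k | bt k = q} : Finset (Fin (n + 1))) = s
  refine ext_inner_right ℝ fun u => ?_
  simp_rw [sum_inner, inner_affineGrad]
  induction s using Finset.induction_on with
  | empty => simp
  | insert a s ha ih => rw [Finset.sum_insert ha, Finset.sum_insert ha, ← ih]; rfl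

lemma gradient_vertexFun_sum (hn : n = 1 ∨ n = 2 ∨ n = 3) (hM : IsMacroMesh Ω 𝒯)
    {b bt : AffineBasis (Fin (n + 1)) ℝ (E n)} (hb : ⇑b ∈ 𝒯) (hbt : ⇑bt ∈ iterSubdivide b m)
    {x : E n} (hx : x ∈ openSimplex bt) (v : E n → ℝ) :
    ∑ q ∈ vertices 𝒯 m, v q • gradient (vertexFun (fineMesh 𝒯 m) q) x =
      ∑ k, v (bt k) • affineGrad (bt.coord k) := by
  classical
  have hmaps : ∀ k ∈ (Finset.univ : Finset (Fin (n + 1))), bt k ∈ vertices 𝒯 m := fun k _ =>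
    mem_vertices.mpr ⟨_, hb, mem_lattice_of_mem_iterSubdivide b hbt k⟩
  rw [← Finset.sum_fiberwise_of_maps_to hmaps]
  refine Finset.sum_congr rfl fun q _ => ?_
  rw [gradient_vertexFun_eq_sum hn hM hb hbt hx, Finset.smul_sum]
  refine Finset.sum_congr rfl fun k hk => ?_
  rw [(Finset.mem_filter.mp hk).2]

lemma exists_vertex_of_vertexFun_ne_zero (hn : n = 1 ∨ n = 2 ∨ n = 3) (hM : IsMacroMesh Ω 𝒯)
    {b bt : AffineBasis (Fin (n + 1)) ℝ (E n)} (hb : ⇑b ∈ 𝒯) (hbt : ⇑bt ∈ iterSubdivide b m)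
    {x : E n} (hx : x ∈ openSimplex bt) {q : E n}
    (hq : vertexFun (fineMesh 𝒯 m) q x ≠ 0) : ∃ k, bt k = q := by
  classical
  obtain ⟨w, hw⟩ := (mem_closedSimplex_iff _ _).mp (openSimplex_subset _ hx)
  rw [vertexFun_eq_sum hn hM hb (openSimplex_subset_of_mem_iterSubdivide b hbt hx) hbt hw] at hq
  obtain ⟨k, hk, -⟩ := Finset.exists_ne_zero_of_sum_ne_zero hq
  exact ⟨k, (Finset.mem_filter.mp hk).2⟩

/-- What holds at almost every point of `Ω` for a finite element function `v` with weak gradient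
`g`. -/
structure IsRegularPoint (𝒯 : Finset (Simplex n)) (m : ℕ) (v : E n → ℝ) (g : E n → E n)
    (x : E n) : Prop where
  grad_eq : g x = ∑ q ∈ vertices 𝒯 m, v q • gradient (vertexFun (fineMesh 𝒯 m) q) x
  sum_grad : ∑ q ∈ vertices 𝒯 m, gradient (vertexFun (fineMesh 𝒯 m) q) x = 0
  inner_grad : ∀ p q, vertexFun (fineMesh 𝒯 m) p x ≠ 0 → vertexFun (fineMesh 𝒯 m) q x ≠ 0 →
    inner ℝ (g x) (q - p) = v q - v p
  exists_card : ∃ s : Finset (E n), s.card ≤ n + 1 ∧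
    ∀ p, vertexFun (fineMesh 𝒯 m) p x ≠ 0 → p ∈ s

/-- Almost every point of `Ω` lies inside a fine simplex on which `v` is affine. There `g` is the
constant gradient of that affine function, which makes the difference formula exact, and only the `n
+ 1` vertices of the simplex have nonzero hat functions. -/
lemma ae_isRegularPoint (hn : n = 1 ∨ n = 2 ∨ n = 3) (hM : IsMacroMesh Ω 𝒯)
    {v : E n → ℝ} (hv : v ∈ feSpace Ω (fineMesh 𝒯 m)) {g : E n → E n} (hg : IsH10 Ω v g) :
    ∀ᵐ x, x ∈ Ω → IsRegularPoint 𝒯 m v g x := by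
  classical
  have h1 : ∀ T ∈ 𝒯, ∀ t ∈ iterSubdivide T m, ∃ f : E n →ᵃ[ℝ] ℝ, EqOn v f (closedSimplex t) ∧
      ∀ᵐ x, x ∈ openSimplex t → g x = affineGrad f := by
    intro T hT t ht
    obtain ⟨f, hf⟩ := hv.2.2.2 t (mem_fineMesh.mpr ⟨T, hT, ht⟩)
    obtain ⟨b, rfl⟩ := hM.exists_basis hT
    exact ⟨f, hf, ae_eq_affineGrad (isOpen_openSimplex t)
      ((openSimplex_subset_of_mem_iterSubdivide b ht).trans (hM.subset _ hT)) hg.weak_grad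
      (hf.mono (openSimplex_subset t))⟩
  choose! f hf hfg using h1
  have h2 : ∀ᵐ x, ∀ T ∈ 𝒯, ∀ t ∈ iterSubdivide T m, x ∈ openSimplex t →
      g x = affineGrad (f T t) := by
    rw [Filter.eventually_all_finset]
    intro T hT
    rw [Filter.eventually_all_finset]
    exact fun t ht => hfg T hT t ht
  filter_upwards [h2, ae_mem_fine_openSimplex hn hM m] with x hx hx' hxΩ
  obtain ⟨T, hT, t, ht, hxt⟩ := hx' hxΩ
  have hgx := hx T hT t ht hxt
  have hfv := hf T hT t ht
  obtain ⟨b, rfl⟩ := hM.exists_basis hT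
  obtain ⟨bt, rfl⟩ := exists_affineBasis_of_interior ⟨x, hxt⟩
  have hvk : ∀ k, v (bt k) = f b bt (bt k) := fun k =>
    hfv (subset_convexHull ℝ _ (mem_range_self k))
  refine ⟨?_, ?_, ?_, ?_⟩
  · rw [gradient_vertexFun_sum hn hM hT ht hxt, hgx, affineGrad_eq_sum bt]
    simp_rw [hvk]
  · have := gradient_vertexFun_sum hn hM hT ht hxt fun _ => 1
    simp only [one_smul, affineGrad_sum_coord] at this
    exact this
  · intro p q hp hq
    obtain ⟨k, rfl⟩ := exists_vertex_of_vertexFun_ne_zero hn hM hT ht hxt hp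
    obtain ⟨l, rfl⟩ := exists_vertex_of_vertexFun_ne_zero hn hM hT ht hxt hq
    rw [hgx, inner_affineGrad, hvk, hvk]
    exact (f b bt).linearMap_vsub _ _
  · refine ⟨Finset.univ.image bt, Finset.card_image_le.trans (by simp), fun p hp => ?_⟩
    obtain ⟨k, rfl⟩ := exists_vertex_of_vertexFun_ne_zero hn hM hT ht hxt hp
    exact Finset.mem_image_of_mem _ (Finset.mem_univ k)

end Mesh

/-! ### Taylor approximation of functions with bounded weak derivatives -/

/-- The convolution of `g` with the kernel `φ`. -/
noncomputable def mollify (φ g : E n → ℝ) (x : E n) : ℝ := ∫ t, φ (x - t) * g t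

lemma mollify_eq_convolution (φ g : E n → ℝ) (x : E n) :
    mollify φ g x = convolution φ g (ContinuousLinearMap.lsmul ℝ ℝ) volume x := by
  rw [convolution_lsmul_swap]; rfl

lemma hasFDerivAt_mollify {φ g : E n → ℝ} (hφ : ContDiff ℝ ∞ φ) (hφc : HasCompactSupport φ)
    (hg : LocallyIntegrable g) (x : E n) :
    ∃ L : E n →L[ℝ] ℝ, HasFDerivAt (mollify φ g) L x ∧
      ∀ u, L u = mollify (fun y => fderiv ℝ φ y u) g x := by
  have h := hφc.hasFDerivAt_convolution_right (ContinuousLinearMap.mul ℝ ℝ) hg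
    (hφ.of_le (by simp)) x
  have e : convolution g φ (ContinuousLinearMap.mul ℝ ℝ) volume = mollify φ g := by
    ext y
    exact integral_congr_ae (Filter.Eventually.of_forall fun t => mul_comm _ _)
  rw [e] at h
  refine ⟨_, h, fun u => ?_⟩
  rw [convolution_precompR_apply _ hg (hφc.fderiv ℝ) (hφ.continuous_fderiv (by simp))]
  exact integral_congr_ae (Filter.Eventually.of_forall fun t => mul_comm _ _)

lemma isTestFunction_comp_sub {U : Set (E n)} {φ : E n → ℝ} (hφ : ContDiff ℝ ∞ φ)
    (hφc : HasCompactSupport φ) {x : E n} (hx : ∀ y ∈ tsupport φ, x - y ∈ U) :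
    IsTestFunction U fun t => φ (x - t) := by
  have hts : tsupport (fun t => φ (x - t)) ⊆ (fun t => x - t) ⁻¹' tsupport φ :=
    closure_minimal (fun t ht => subset_tsupport φ ht)
      ((isClosed_tsupport φ).preimage (by fun_prop))
  refine ⟨hφ.comp (contDiff_const.sub contDiff_id), ?_, fun t ht => ?_⟩
  · exact hφc.comp_homeomorph (Homeomorph.subLeft x)
  · simpa using hx _ (hts ht)

/-- As long as `x - supp φ` stays in `U`, the reflected kernel `t ↦ φ (x - t)` is a test function;
the sign from the reflection cancels the sign in the weak derivative. -/
lemma mollify_weakDeriv {U : Set (E n)} {a : Fin n} {g g' : E n → ℝ}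
    (h : IsWeakDeriv U (fun _ : Fin 1 => a) g g') {φ : E n → ℝ} (hφ : ContDiff ℝ ∞ φ)
    (hφc : HasCompactSupport φ) {x : E n} (hx : ∀ y ∈ tsupport φ, x - y ∈ U) :
    mollify (fun y => fderiv ℝ φ y (EuclideanSpace.single a 1)) g x = mollify φ g' x := by
  have hψ := isTestFunction_comp_sub hφ hφc hx
  have e := h.integral_eq hψ
  have hd : ∀ t, fderiv ℝ (fun t => φ (x - t)) t = -fderiv ℝ φ (x - t) := fun t => by
    have h1 := ((hφ.differentiable (by simp)) (x - t)).hasFDerivAt.comp t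
      ((hasFDerivAt_const x t).sub (hasFDerivAt_id t))
    refine h1.fderiv.trans ?_
    ext u
    simp
  simp_rw [iteratedFDeriv_one_apply, hd, neg_apply, mul_neg, integral_neg,
    pow_one, neg_one_mul, neg_inj] at e
  simp_rw [mollify, mul_comm _ (g _), mul_comm _ (g' _)]
  exact e

lemma abs_mollify_le {φ g : E n → ℝ} (hφc : Continuous φ) (hφs : HasCompactSupport φ)
    (hφ0 : ∀ x, 0 ≤ φ x) (hφ1 : ∫ x, φ x = 1)
    {B : ℝ} (hg : ∀ᵐ x, |g x| ≤ B) (x : E n) : |mollify φ g x| ≤ B := by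
  have hint : Integrable fun t => φ (x - t) :=
    (hφc.integrable_of_hasCompactSupport hφs).comp_sub_left x
  have h1 : ∫ t, φ (x - t) * B = B := by
    rw [integral_mul_const, integral_sub_left_eq_self φ volume x, hφ1, one_mul]
  rw [← h1, ← Real.norm_eq_abs, mollify]
  refine norm_integral_le_of_norm_le (hint.mul_const B) ?_
  filter_upwards [hg] with t ht
  rw [norm_mul, Real.norm_of_nonneg (hφ0 _)]
  exact mul_le_mul_of_nonneg_left ht (hφ0 _)

/-- Taylor's formula on `[0, 1]` for a chain of derivatives. -/
lemma abs_sub_taylor_le {k : ℕ} {F : ℕ → ℝ → ℝ} {M : ℝ}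
    (hF : ∀ j < k, ∀ t ∈ Icc (0 : ℝ) 1, HasDerivAt (F j) (F (j + 1) t) t)
    (hM : ∀ t ∈ Icc (0 : ℝ) 1, |F k t| ≤ M) :
    ∀ t ∈ Icc (0 : ℝ) 1,
      |F 0 t - ∑ j ∈ Finset.range k, F j 0 * (t ^ j / (j.factorial : ℝ))| ≤ M := by
  induction k generalizing F with
  | zero => simpa using hM
  | succ k ih =>
    intro t ht
    have hM0 : 0 ≤ M := (abs_nonneg _).trans (hM 0 (by simp))
    have ih' := ih (F := fun j => F (j + 1)) (fun j hj => hF (j + 1) (by omega)) hM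
    set p : ℝ → ℝ := fun t => F 0 t - ∑ j ∈ Finset.range (k + 1), F j 0 * (t ^ j / (j.factorial : ℝ))
      with hp
    have hder : ∀ s ∈ Icc (0 : ℝ) 1, HasDerivAt p
        (F 1 s - ∑ j ∈ Finset.range k, F (j + 1) 0 * (s ^ j / (j.factorial : ℝ))) s := by
      intro s hs
      refine (hF 0 (by omega) s hs).sub ?_
      have : HasDerivAt (fun t : ℝ => ∑ j ∈ Finset.range (k + 1),
          F j 0 * (t ^ j / (j.factorial : ℝ)))
          (∑ j ∈ Finset.range (k + 1), F j 0 * ((j * s ^ (j - 1)) / (j.factorial : ℝ))) s :=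
        HasDerivAt.fun_sum fun j _ => ((hasDerivAt_pow j s).div_const _).const_mul _
      have e : ∑ j ∈ Finset.range (k + 1), F j 0 * ((j * s ^ (j - 1)) / (j.factorial : ℝ)) =
          ∑ j ∈ Finset.range k, F (j + 1) 0 * (s ^ j / (j.factorial : ℝ)) := by
        rw [Finset.sum_range_succ']
        simp only [CharP.cast_eq_zero, zero_mul, zero_div, mul_zero, add_zero, Nat.add_sub_cancel]
        refine Finset.sum_congr rfl fun j _ => ?_
        rw [Nat.factorial_succ]
        push_cast
        have : (j.factorial : ℝ) ≠ 0 := by positivity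
        field_simp
      rwa [e] at this
    have h0 : p 0 = 0 := by
      rw [hp]
      simp [Finset.sum_range_succ']
    have := (convex_Icc (0 : ℝ) 1).norm_image_sub_le_of_norm_hasDerivWithin_le (f := p) (C := M)
      (fun s hs => (hder s hs).hasDerivWithinAt) (fun s hs => ih' s hs) (left_mem_Icc.mpr zero_le_one) ht
    rw [h0, sub_zero, sub_zero, Real.norm_eq_abs, Real.norm_eq_abs, abs_of_nonneg ht.1] at this
    exact this.trans (mul_le_of_le_one_right hM0 ht.2)

lemma eq_sum_single (u : E n) : u = ∑ a, u a • EuclideanSpace.single a (1 : ℝ) := by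
  ext i
  simp [Pi.single_apply, Finset.sum_apply]

/-- Mollification turns the weak derivatives into classical ones along a segment, where the
one-dimensional Taylor formula applies; then the mollification radius tends to zero. Convexity keeps
the segment in `U`. No continuous representative is needed, because convergence is used only at the
two end points. -/
lemma exists_taylor_approx {U : Set (E n)} (hU : IsOpen U) (hconv : Convex ℝ U) (r : ℕ)
    (G : ∀ j, (Fin j → Fin n) → E n → ℝ) (hloc : ∀ j ι, LocallyIntegrable (G j ι))
    (hG : ∀ j ≤ r, ∀ ι a, IsWeakDeriv U (fun _ : Fin 1 => a) (G j ι) (G (j + 1) (Fin.snoc ι a)))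
    {B D : ℝ} (hB : ∀ ι, ∀ᵐ x, |G (r + 1) ι x| ≤ B) (hD : ∀ x ∈ U, ∀ y ∈ U, dist x y ≤ D) :
    ∃ x₀ : E n, ∀ᵐ x, x ∈ U →
      |G 0 default x - ∑ j ∈ Finset.range (r + 1), (∑ ι : Fin j → Fin n,
        (∏ l, (x - x₀) (ι l)) * G j ι x₀) * (1 / (j.factorial : ℝ))| ≤ (n * D) ^ (r + 1) * B := by
  rcases U.eq_empty_or_nonempty with rfl | hne
  · exact ⟨0, Filter.Eventually.of_forall fun x hx => hx.elim⟩
  -- The ratio of outer to inner radius is kept at 2, as required for convergence of the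
  -- mollifications almost everywhere.
  let φ : ℕ → ContDiffBump (0 : E n) := fun i =>
    ⟨1 / (i + 1), 2 / (i + 1), by positivity, by gcongr; norm_num⟩
  have hφr : Filter.Tendsto (fun i => (φ i).rOut) Filter.atTop (nhds 0) := by
    have := (tendsto_one_div_add_atTop_nhds_zero_nat (𝕜 := ℝ)).const_mul 2
    simp only [mul_zero] at this
    refine this.congr fun i => ?_
    change 2 * (1 / ((i : ℝ) + 1)) = 2 / (i + 1)
    ring
  let ψ : ℕ → E n → ℝ := fun i => (φ i).normed volume
  have hψ1 : ∀ i, ContDiff ℝ ∞ (ψ i) := fun i => (φ i).contDiff_normed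
  have hψ2 : ∀ i, HasCompactSupport (ψ i) := fun i => (φ i).hasCompactSupport_normed
  have hgood : ∀ᵐ x : E n, ∀ j (ι : Fin j → Fin n),
      Filter.Tendsto (fun i => mollify (ψ i) (G j ι) x) Filter.atTop (nhds (G j ι x)) := by
    refine ae_all_iff.mpr fun j => ae_all_iff.mpr fun ι => ?_
    have := ContDiffBump.ae_convolution_tendsto_right_of_locallyIntegrable (φ := φ) (K := 2) hφr
      (Filter.Eventually.of_forall fun i => by
        change 2 / ((i : ℝ) + 1) ≤ 2 * (1 / (i + 1))
        exact le_of_eq (by ring)) (hloc j ι)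
    simpa only [mollify_eq_convolution] using this
  -- The centre of expansion is a point where the mollifications of all the derivatives converge at
  -- once.
  obtain ⟨x₀, hx₀U, hx₀⟩ : ∃ x ∈ U, ∀ j (ι : Fin j → Fin n),
      Filter.Tendsto (fun i => mollify (ψ i) (G j ι) x) Filter.atTop (nhds (G j ι x)) := by
    by_contra! hcon
    refine (hU.measure_pos volume hne).ne' (measure_mono_null (fun x hx => ?_) (ae_iff.mp hgood))
    intro h
    obtain ⟨j, ι, h'⟩ := hcon x hx
    exact h' (h j ι)
  refine ⟨x₀, ?_⟩
  filter_upwards [hgood] with x hx hxU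
  set u := x - x₀ with hu
  have hline : ∀ t ∈ Icc (0 : ℝ) 1, x₀ + t • u ∈ U := fun t ht => by
    have := hconv.add_smul_sub_mem hx₀U hxU ht
    exact this
  have hcomp : IsCompact ((fun t : ℝ => x₀ + t • u) '' Icc 0 1) :=
    isCompact_Icc.image (by fun_prop)
  -- The compact segment has a positive distance from the complement of `U`, so kernels of small
  -- radius see only points of `U`.
  obtain ⟨δ, hδ, hδU⟩ := hcomp.exists_cthickening_subset_open hU (by
    rintro _ ⟨t, ht, rfl⟩; exact hline t ht)
  let F : ℕ → ℕ → ℝ → ℝ := fun i j t =>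
    ∑ ι : Fin j → Fin n, (∏ l, u (ι l)) * mollify (ψ i) (G j ι) (x₀ + t • u)
  have hud : ∀ a, |u a| ≤ D := fun a => by
    have h1 : ‖u a‖ ≤ ‖u‖ := PiLp.norm_apply_le u a
    have h2 := hD x hxU x₀ hx₀U
    rw [dist_eq_norm] at h2
    exact h1.trans h2
  have hbound : ∀ᶠ i in Filter.atTop, |F i 0 1 - ∑ j ∈ Finset.range (r + 1),
      F i j 0 * (1 ^ j / (j.factorial : ℝ))| ≤ (n * D) ^ (r + 1) * B := by
    filter_upwards [hφr.eventually_le_const hδ] with i hi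
    have hsupp : ∀ t ∈ Icc (0 : ℝ) 1, ∀ y ∈ tsupport (ψ i), x₀ + t • u - y ∈ U := by
      intro t ht y hy
      rw [(φ i).tsupport_normed_eq, mem_closedBall_zero_iff] at hy
      refine hδU (Metric.mem_cthickening_of_dist_le _ (x₀ + t • u) δ _ ⟨t, ht, rfl⟩ ?_)
      rw [dist_eq_norm, sub_sub_cancel_left, norm_neg]
      exact hy.trans hi
    refine abs_sub_taylor_le (F := F i) ?_ ?_ 1 (by simp)
    · intro j hj t ht
      have hterm : ∀ ι : Fin j → Fin n, HasDerivAt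
          (fun t : ℝ => (∏ l, u (ι l)) * mollify (ψ i) (G j ι) (x₀ + t • u))
          (∑ a, (∏ l, u ((Fin.snoc ι a : Fin (j + 1) → Fin n) l)) *
            mollify (ψ i) (G (j + 1) (Fin.snoc ι a)) (x₀ + t • u)) t := by
        intro ι
        obtain ⟨L, hL, hL'⟩ := hasFDerivAt_mollify (hψ1 i) (hψ2 i) (hloc j ι) (x₀ + t • u)
        have hinner : HasDerivAt (fun t : ℝ => x₀ + t • u) u t := by
          simpa using ((hasDerivAt_id t).smul_const u).const_add x₀
        have h1 := (hL.comp_hasDerivAt t hinner).const_mul (∏ l, u (ι l))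
        refine h1.congr_deriv ?_
        conv_lhs => rw [eq_sum_single u, map_sum, Finset.mul_sum]
        refine Finset.sum_congr rfl fun a _ => ?_
        rw [map_smul, hL', mollify_weakDeriv (hG j (by omega) ι a) (hψ1 i) (hψ2 i) (hsupp t ht),
          Fin.prod_univ_castSucc]
        simp only [Fin.snoc_castSucc, Fin.snoc_last, smul_eq_mul, ← eq_sum_single u]
        ring
      refine (HasDerivAt.fun_sum fun ι _ => hterm ι).congr_deriv ?_
      change _ = ∑ ι : Fin (j + 1) → Fin n, _
      -- Differentiating along the segment appends one index to each multi-index, so the double sum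
      -- is reindexed as a sum over multi-indices of length `j + 1`.
      rw [← (Fin.snocEquiv fun _ : Fin (j + 1) => Fin n).sum_comp, Fintype.sum_prod_type_right]
      rfl
    · intro t ht
      calc |F i (r + 1) t| ≤ ∑ ι : Fin (r + 1) → Fin n,
            |(∏ l, u (ι l)) * mollify (ψ i) (G (r + 1) ι) (x₀ + t • u)| :=
          Finset.abs_sum_le_sum_abs _ _
        _ ≤ ∑ ι : Fin (r + 1) → Fin n, D ^ (r + 1) * B := by
          refine Finset.sum_le_sum fun ι _ => ?_
          rw [abs_mul, Finset.abs_prod]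
          refine mul_le_mul ?_ (abs_mollify_le (hψ1 i).continuous (hψ2 i)
            (fun y => (φ i).nonneg_normed y) (φ i).integral_normed (hB ι) _) (abs_nonneg _) ?_
          · calc ∏ l, |u (ι l)| ≤ ∏ _l : Fin (r + 1), D :=
                Finset.prod_le_prod (fun _ _ => abs_nonneg _) fun l _ => hud _
              _ = D ^ (r + 1) := by simp
          · have : 0 ≤ D := by simpa using hD x hxU x hxU
            positivity
        _ = (n * D) ^ (r + 1) * B := by simp; ring
  refine le_of_tendsto ?_ hbound
  refine (Filter.Tendsto.sub ?_ (tendsto_finsetSum _ fun j _ => ?_)).abs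
  · have e : ∀ i, F i 0 1 = mollify (ψ i) (G 0 default) x := fun i => by
      simp [F, hu]
    simp_rw [e]
    exact hx 0 default
  · simp only [one_pow]
    refine Filter.Tendsto.mul_const _ ?_
    have e : ∀ i, F i j 0 =
        ∑ ι : Fin j → Fin n, (∏ l, u (ι l)) * mollify (ψ i) (G j ι) x₀ := fun i => by simp [F]
    simp_rw [e]
    exact tendsto_finsetSum _ fun ι _ => (hx₀ j ι).const_mul _

/-! ### Successive weak derivatives and the Sobolev seminorm -/

lemma IsTestFunction.fderiv_apply {U : Set (E n)} {φ : E n → ℝ} (hφ : IsTestFunction U φ)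
    (e : E n) : IsTestFunction U fun x => fderiv ℝ φ x e := by
  refine ⟨(hφ.1.fderiv_right (by simp)).clm_apply contDiff_const, hφ.2.1.fderiv_apply ℝ e, ?_⟩
  exact (tsupport_fderiv_apply_subset ℝ e).trans hφ.2.2

lemma iteratedFDeriv_succ_snoc {φ : E n → ℝ} (hφ : ContDiff ℝ ∞ φ) {k : ℕ} (ι : Fin k → Fin n)
    (a : Fin n) (x : E n) :
    iteratedFDeriv ℝ (k + 1) φ x (fun i => EuclideanSpace.single
      ((Fin.snoc ι a : Fin (k + 1) → Fin n) i) (1 : ℝ)) =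
    iteratedFDeriv ℝ k (fun y => fderiv ℝ φ y (EuclideanSpace.single a 1)) x
      (fun i => EuclideanSpace.single (ι i) (1 : ℝ)) := by
  rw [iteratedFDeriv_succ_apply_right]
  have h := ContinuousLinearMap.iteratedFDeriv_comp_left (x := x) (n := (k : WithTop ℕ∞))
    (f := fun y => fderiv ℝ φ y)
    (ContinuousLinearMap.apply ℝ ℝ (EuclideanSpace.single a (1 : ℝ) : E n))
    ((hφ.fderiv_right (m := (k : WithTop ℕ∞)) (by exact_mod_cast le_top)).contDiffAt) le_rfl
  have h' := congrArg (fun M => M fun i => EuclideanSpace.single (ι i) (1 : ℝ)) h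
  refine Eq.trans ?_ h'.symm
  simp only [ContinuousLinearMap.compContinuousMultilinearMap_coe, Function.comp_apply,
    ContinuousLinearMap.apply_apply, Fin.snoc_last]
  congr 2
  ext i : 1
  exact congrArg (fun j => EuclideanSpace.single j (1 : ℝ))
    (Fin.snoc_castSucc (α := fun _ => Fin n) a ι i)

/-- Successive weak derivatives. -/
lemma IsWeakDeriv.of_snoc {U : Set (E n)} {k : ℕ} {ι : Fin k → Fin n} {a : Fin n}
    {f g g' : E n → ℝ} (h : IsWeakDeriv U ι f g)
    (h' : IsWeakDeriv U (Fin.snoc ι a : Fin (k + 1) → Fin n) f g') :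
    IsWeakDeriv U (fun _ : Fin 1 => a) g g' := by
  refine ⟨h.2.1, h'.2.1, fun φ hφ => ?_⟩
  rw [setIntegral_mul_test hφ, setIntegral_mul_iteratedFDeriv_test hφ]
  simp_rw [iteratedFDeriv_one_apply]
  -- Testing the derivative of order `k` with `∂ₐφ` and the one of order `k + 1` with `φ` produces
  -- the same left-hand side.
  have e1 := h.integral_eq (hφ.fderiv_apply (EuclideanSpace.single a 1))
  have e2 := h'.integral_eq hφ
  simp_rw [iteratedFDeriv_succ_snoc hφ.1] at e2
  rw [e1, pow_succ, mul_assoc] at e2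
  have := mul_left_cancel₀ (pow_ne_zero k (by norm_num : (-1 : ℝ) ≠ 0)) e2
  rw [this, pow_one]

lemma isWeakDeriv_zero {U : Set (E n)} {f : E n → ℝ} (hf : LocallyIntegrableOn f U)
    (ι : Fin 0 → Fin n) : IsWeakDeriv U ι f f :=
  ⟨hf, hf, fun φ _ => by simp⟩

lemma IsWeakDeriv.congr_right {U : Set (E n)} (hU : MeasurableSet U) {k : ℕ} {ι : Fin k → Fin n}
    {f g g' : E n → ℝ} (h : IsWeakDeriv U ι f g) (hgg' : EqOn g g' U) :
    IsWeakDeriv U ι f g' := by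
  have h0 := (isWeakDeriv_zero h.2.1 Fin.elim0).congr_left hU hgg'
  refine ⟨h.1, h0.1, fun φ hφ => ?_⟩
  rw [h.2.2 φ hφ]
  congr 1
  exact setIntegral_congr_fun hU fun x hx => by simp only [hgg' hx]

lemma IsWeakDeriv.eLpNorm_eq {U : Set (E n)} (hU : IsOpen U) {k : ℕ} {ι : Fin k → Fin n}
    {f g g' : E n → ℝ} (h : IsWeakDeriv U ι f g) (h' : IsWeakDeriv U ι f g') :
    eLpNorm g ∞ (volume.restrict U) = eLpNorm g' ∞ (volume.restrict U) :=
  eLpNorm_congr_ae ((ae_restrict_iff' hU.measurableSet).mpr (h.ae_eq hU h'))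

lemma IsWeakDeriv.eLpNorm_le_seminorm {U : Set (E n)} (hU : IsOpen U) {k : ℕ} {ι : Fin k → Fin n}
    {f g : E n → ℝ} (h : IsWeakDeriv U ι f g) :
    eLpNorm g ∞ (volume.restrict U) ≤ sobolevInfSeminorm U k f :=
  le_iSup_of_le ι (le_iInf₂ fun _ h' => (h.eLpNorm_eq hU h').le)

lemma sobolevInfSeminorm_le {U : Set (E n)} {k : ℕ} {f : E n → ℝ} {B : ℝ≥0∞}
    (h : ∀ ι : Fin k → Fin n, ∃ g, IsWeakDeriv U ι f g ∧ eLpNorm g ∞ (volume.restrict U) ≤ B) :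
    sobolevInfSeminorm U k f ≤ B :=
  iSup_le fun ι => by
    obtain ⟨g, hg, hB⟩ := h ι
    exact (iInf₂_le g hg).trans hB

lemma MemSobolevInf.seminorm_ne_top {U : Set (E n)} {k : ℕ} {f : E n → ℝ}
    (hf : MemSobolevInf U k f) : sobolevInfSeminorm U k f ≠ ⊤ := by
  choose g hg hgm using hf.2 k le_rfl
  refine ne_top_of_le_ne_top (b := ∑ ι, eLpNorm (g ι) ∞ (volume.restrict U)) ?_ ?_
  · exact ENNReal.sum_ne_top.mpr fun ι _ => (hgm ι).eLpNorm_ne_top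
  · exact sobolevInfSeminorm_le fun ι => ⟨g ι, hg ι,
      Finset.single_le_sum (f := fun ι => eLpNorm (g ι) ∞ (volume.restrict U))
        (fun _ _ => zero_le) (Finset.mem_univ ι)⟩

lemma ae_abs_le_of_eLpNorm_le {U : Set (E n)} (hU : MeasurableSet U) {g : E n → ℝ} {B : ℝ≥0∞}
    (hB : B ≠ ⊤) (h : eLpNorm g ∞ (volume.restrict U) ≤ B) :
    ∀ᵐ x, x ∈ U → |g x| ≤ B.toReal := by
  rw [← ae_restrict_iff' hU]
  rw [eLpNorm_exponent_top] at h
  filter_upwards [ae_le_eLpNormEssSup (f := g) (μ := volume.restrict U)] with x hx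
  have := ENNReal.toReal_mono hB (hx.trans h)
  simpa using this

/-- A function with bounded weak derivatives on a convex set is approximated by a Taylor
polynomial. -/
theorem MemSobolevInf.exists_taylor_approx {U : Set (E n)} (hU : IsOpen U) (hconv : Convex ℝ U)
    (hfin : volume U ≠ ⊤) {r : ℕ} {f : E n → ℝ} (hf : MemSobolevInf U (r + 1) f) {D : ℝ}
    (hD : ∀ x ∈ U, ∀ y ∈ U, dist x y ≤ D) :
    ∃ (x₀ : E n) (c : ∀ j, (Fin j → Fin n) → ℝ), ∀ᵐ x, x ∈ U →
      |f x - ∑ j ∈ Finset.range (r + 1), ∑ ι : Fin j → Fin n, c j ι * ∏ l, (x - x₀) (ι l)| ≤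
        (n * D) ^ (r + 1) * (sobolevInfSeminorm U (r + 1) f).toReal := by
  choose! g hg hgm using hf.2
  have : IsFiniteMeasure (volume.restrict U) := ⟨by simpa using hfin.lt_top⟩
  -- Extension by zero makes the derivatives integrable on the whole space, so they can be mollified
  -- everywhere. Orders above `r + 1` are irrelevant and are set to zero.
  let G : ∀ j, (Fin j → Fin n) → E n → ℝ := fun j ι =>
    if j ≤ r + 1 then U.indicator (g j ι) else 0
  have hGeq : ∀ j ≤ r + 1, ∀ ι, G j ι = U.indicator (g j ι) := fun j hj ι => if_pos hj
  have hind : ∀ g : E n → ℝ, EqOn g (U.indicator g) U := fun g x hx =>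
    (indicator_of_mem hx g).symm
  have hloc : ∀ j ι, LocallyIntegrable (G j ι) := by
    intro j ι
    by_cases hj : j ≤ r + 1
    · rw [hGeq j hj]
      have : IntegrableOn (g j ι) U := (hgm j hj ι).integrable le_top
      exact (this.integrable_indicator hU.measurableSet).locallyIntegrable
    · have : G j ι = 0 := if_neg hj
      rw [this]
      exact (integrable_zero _ _ _).locallyIntegrable
  have hder : ∀ j ≤ r, ∀ ι a,
      IsWeakDeriv U (fun _ : Fin 1 => a) (G j ι) (G (j + 1) (Fin.snoc ι a)) := by
    intro j hj ι a
    rw [hGeq j (by omega), hGeq (j + 1) (by omega)]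
    exact (((hg j (by omega) ι).of_snoc (hg (j + 1) (by omega) _)).congr_left hU.measurableSet
      (hind _)).congr_right hU.measurableSet (hind _)
  have htop : ∀ ι, ∀ᵐ x, |G (r + 1) ι x| ≤ (sobolevInfSeminorm U (r + 1) f).toReal := by
    intro ι
    rw [hGeq _ le_rfl]
    filter_upwards [ae_abs_le_of_eLpNorm_le hU.measurableSet hf.seminorm_ne_top
      ((hg _ le_rfl ι).eLpNorm_le_seminorm hU)] with x hx
    by_cases hxU : x ∈ U
    · rw [indicator_of_mem hxU]; exact hx hxU
    · rw [indicator_of_notMem hxU, abs_zero]; exact ENNReal.toReal_nonneg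
  obtain ⟨x₀, hx₀⟩ := Surrogate.exists_taylor_approx hU hconv r G hloc hder htop hD
  refine ⟨x₀, fun j ι => G j ι x₀ * (1 / (j.factorial : ℝ)), ?_⟩
  have h0 := (hg 0 (by omega) default).ae_eq hU
    (isWeakDeriv_zero (hg 0 (by omega) default).1 default)
  filter_upwards [hx₀, h0] with x hx hx' hxU
  refine le_trans (le_of_eq ?_) (hx hxU)
  rw [hGeq 0 (by omega), indicator_of_mem hxU, hx' hxU]
  congr 2
  refine Finset.sum_congr rfl fun j _ => ?_
  rw [Finset.sum_mul]
  exact Finset.sum_congr rfl fun ι _ => by ring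

/-! ### Correlation of a kernel with a bounded function -/

lemma integrable_mul_shift {s k : E n → ℝ} (hs : Integrable s) (hk : AEStronglyMeasurable k volume)
    {C : ℝ} (hC : ∀ᵐ z, |k z| ≤ C) (x : E n) : Integrable fun y => s y * k (x + y) := by
  have hmp := measurePreserving_add_left (volume : Measure (E n)) x
  refine hs.mul_bdd (c := C) (hk.comp_measurePreserving hmp) ?_
  exact hmp.quasiMeasurePreserving.ae hC

/-- Approximate `s` in `L¹` by continuous compactly supported kernels. Their correlations are
convolutions with the reflected kernel, hence continuous, and they converge uniformly because `k` is
essentially bounded. Continuity matters because the projections are controlled only on continuous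
functions. -/
lemma continuous_correlation {s k : E n → ℝ} (hs : Integrable s)
    (hk : AEStronglyMeasurable k volume) {C : ℝ} (hC : ∀ᵐ z, |k z| ≤ C) :
    Continuous fun x => ∫ y, s y * k (x + y) := by
  have hkl : LocallyIntegrable k := by
    refine MeasureTheory.locallyIntegrable_iff.mpr fun K hK => ?_
    have : IsFiniteMeasure (volume.restrict K) := ⟨by simpa using hK.measure_lt_top⟩
    exact Integrable.of_bound hk.restrict C (ae_restrict_of_ae hC)
  have hC0 : 0 ≤ C := by
    obtain ⟨z, hz⟩ := hC.exists
    exact (abs_nonneg _).trans hz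
  refine continuous_of_uniform_approx_of_continuous fun u hu => ?_
  obtain ⟨ε, hε, hεu⟩ := Metric.mem_uniformity_dist.mp hu
  obtain ⟨χ, hχs, hχ, hχc, hχi⟩ := hs.exists_hasCompactSupport_integral_sub_le
    (ε := ε / (2 * (C + 1))) (by positivity)
  refine ⟨fun x => ∫ y, χ y * k (x + y), ?_, fun x => hεu ?_⟩
  · have h1 : Continuous (mollify (fun y => χ (-y)) k) := by
      have := HasCompactSupport.continuous_convolution_left (ContinuousLinearMap.lsmul ℝ ℝ)
        (hχs.comp_homeomorph (Homeomorph.neg (E n))) (hχc.comp continuous_neg) hkl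
      convert this using 1
      ext x
      exact mollify_eq_convolution _ _ _
    convert h1 using 1
    ext x
    rw [mollify, ← integral_add_left_eq_self (fun t => χ (-(x - t)) * k t) x]
    simp
  · rw [Real.dist_eq, ← integral_sub (integrable_mul_shift hs hk hC x)
      (integrable_mul_shift hχi hk hC x), ← Real.norm_eq_abs]
    have hmp := measurePreserving_add_left (volume : Measure (E n)) x
    have h2 : ‖∫ y, (s y * k (x + y) - χ y * k (x + y))‖ ≤ ∫ y, ‖s y - χ y‖ * C := by
      refine norm_integral_le_of_norm_le ((hs.sub hχi).norm.mul_const C) ?_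
      filter_upwards [hmp.quasiMeasurePreserving.ae hC] with y hy
      rw [← sub_mul, norm_mul]
      exact mul_le_mul_of_nonneg_left hy (norm_nonneg _)
    refine h2.trans_lt ?_
    rw [integral_mul_const]
    calc (∫ y, ‖s y - χ y‖) * C ≤ ε / (2 * (C + 1)) * C := mul_le_mul_of_nonneg_right hχ hC0
      _ < ε := by
        rw [div_mul_eq_mul_div, div_lt_iff₀ (by positivity)]
        nlinarith

/-- Expanding each factor as `x + (y - x₀)` separates the variables: the powers of `x` leave the
integral and its coefficients are moments of `s`. -/
lemma exists_poly_prod {s : E n → ℝ} {V : Set (E n)} (hV : Bornology.IsBounded V)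
    (hs : Integrable s) (hsV : ∀ y, y ∉ V → s y = 0) (x₀ : E n) {j : ℕ} (ι : Fin j → Fin n) :
    ∃ p : MvPolynomial (Fin n) ℝ, p.totalDegree ≤ j ∧
      ∀ x : E n, (Integrable fun y => s y * ∏ l, (x + y - x₀) (ι l)) ∧
        ∫ y, s y * ∏ l, (x + y - x₀) (ι l) = MvPolynomial.eval (fun a => x a) p := by
  classical
  have hint : ∀ t : Finset (Fin j), Integrable fun y => s y * ∏ l ∈ t, (y - x₀) (ι l) := by
    intro t
    have hc : Continuous fun y : E n => ∏ l ∈ t, (y - x₀) (ι l) := by fun_prop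
    obtain ⟨C, hC⟩ := (hV.isCompact_closure.image hc).isBounded.exists_norm_le
    have : (fun y => s y * ∏ l ∈ t, (y - x₀) (ι l)) =
        fun y => s y * (closure V).indicator (fun y => ∏ l ∈ t, (y - x₀) (ι l)) y := by
      ext y
      by_cases hy : y ∈ V
      · rw [indicator_of_mem (subset_closure hy)]
      · rw [hsV y hy, zero_mul, zero_mul]
    rw [this]
    refine hs.mul_bdd (c := max C 0) (hc.aestronglyMeasurable.indicator
      isClosed_closure.measurableSet) (Filter.Eventually.of_forall fun y => ?_)
    by_cases hy : y ∈ closure V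
    · rw [indicator_of_mem hy]; exact (hC _ ⟨y, hy, rfl⟩).trans (le_max_left _ _)
    · rw [indicator_of_notMem hy, norm_zero]; exact le_max_right _ _
  have hexp : ∀ x y : E n, s y * ∏ l, (x + y - x₀) (ι l) =
      ∑ t ∈ Finset.univ.powerset, (∏ l ∈ t, x (ι l)) *
        (s y * ∏ l ∈ Finset.univ \ t, (y - x₀) (ι l)) := by
    intro x y
    have : ∏ l, (x + y - x₀) (ι l) = ∏ l, (x (ι l) + (y - x₀) (ι l)) :=
      Finset.prod_congr rfl fun l _ => by simp; ring
    rw [this, Finset.prod_add, Finset.mul_sum]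
    exact Finset.sum_congr rfl fun t _ => by ring
  refine ⟨∑ t ∈ (Finset.univ : Finset (Fin j)).powerset,
    MvPolynomial.C (∫ y, s y * ∏ l ∈ Finset.univ \ t, (y - x₀) (ι l)) *
      ∏ l ∈ t, MvPolynomial.X (ι l), ?_, fun x => ⟨?_, ?_⟩⟩
  · refine MvPolynomial.totalDegree_finsetSum_le fun t _ => ?_
    refine (MvPolynomial.totalDegree_mul _ _).trans ?_
    rw [MvPolynomial.totalDegree_C, zero_add]
    refine (MvPolynomial.totalDegree_finsetProd _ _).trans ?_
    simp only [MvPolynomial.totalDegree_X, Finset.sum_const, smul_eq_mul, mul_one]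
    exact (Finset.card_le_univ t).trans (by simp)
  · simp_rw [hexp]
    exact integrable_finsetSum _ fun t _ => (hint _).const_mul _
  · simp_rw [hexp]
    rw [integral_finsetSum _ fun t _ => (hint _).const_mul _]
    simp only [integral_const_mul, map_sum, map_mul, MvPolynomial.eval_C, map_prod,
      MvPolynomial.eval_X]
    exact Finset.sum_congr rfl fun t _ => mul_comm _ _

/-- This is why projecting is accurate: a polynomial coefficient yields a polynomial stencil
function of no higher degree. -/
lemma exists_poly_correlation {s : E n → ℝ} {V : Set (E n)} (hV : Bornology.IsBounded V)
    (hs : Integrable s) (hsV : ∀ y, y ∉ V → s y = 0) (x₀ : E n) (r : ℕ)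
    (c : ∀ j, (Fin j → Fin n) → ℝ) :
    ∃ p : MvPolynomial (Fin n) ℝ, p.totalDegree ≤ r ∧ ∀ x : E n,
      (Integrable fun y => s y * ∑ j ∈ Finset.range (r + 1), ∑ ι : Fin j → Fin n,
        c j ι * ∏ l, (x + y - x₀) (ι l)) ∧
      ∫ y, s y * ∑ j ∈ Finset.range (r + 1), ∑ ι : Fin j → Fin n,
        c j ι * ∏ l, (x + y - x₀) (ι l) = MvPolynomial.eval (fun a => x a) p := by
  choose p hp hp' using fun j (ι : Fin j → Fin n) => exists_poly_prod hV hs hsV x₀ ι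
  have hexp : ∀ x y : E n, s y * ∑ j ∈ Finset.range (r + 1), ∑ ι : Fin j → Fin n,
        c j ι * ∏ l, (x + y - x₀) (ι l) = ∑ j ∈ Finset.range (r + 1), ∑ ι : Fin j → Fin n,
        c j ι * (s y * ∏ l, (x + y - x₀) (ι l)) := by
    intro x y
    simp_rw [Finset.mul_sum]
    exact Finset.sum_congr rfl fun j _ => Finset.sum_congr rfl fun ι _ => by ring
  refine ⟨∑ j ∈ Finset.range (r + 1), ∑ ι : Fin j → Fin n, MvPolynomial.C (c j ι) * p j ι,
    ?_, fun x => ⟨?_, ?_⟩⟩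
  · refine MvPolynomial.totalDegree_finsetSum_le fun j hj => ?_
    refine MvPolynomial.totalDegree_finsetSum_le fun ι _ => ?_
    refine (MvPolynomial.totalDegree_mul _ _).trans ?_
    rw [MvPolynomial.totalDegree_C, zero_add]
    have := Finset.mem_range.mp hj
    exact (hp j ι).trans (by omega)
  · simp_rw [hexp]
    exact integrable_finsetSum _ fun j _ => integrable_finsetSum _ fun ι _ =>
      (hp' j ι x).1.const_mul _
  · simp_rw [hexp]
    rw [integral_finsetSum _ fun j _ => integrable_finsetSum _ fun ι _ =>
      (hp' j ι x).1.const_mul _]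
    simp only [map_sum, map_mul, MvPolynomial.eval_C]
    refine Finset.sum_congr rfl fun j _ => ?_
    rw [integral_finsetSum _ fun ι _ => (hp' j ι x).1.const_mul _]
    exact Finset.sum_congr rfl fun ι _ => by rw [integral_const_mul, (hp' j ι x).2]

/-! ### Approximation of stencil functions by their projections -/

lemma measurable_gradient (f : E n → ℝ) : Measurable (gradient f) :=
  (InnerProductSpace.toDual ℝ (E n)).symm.continuous.measurable.comp (measurable_fderiv ℝ f)

lemma measurable_gradient_apply (f : E n → ℝ) (a : Fin n) : Measurable fun x => gradient f x a := by
  have : Continuous fun u : E n => u a := by fun_prop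
  exact this.measurable.comp (measurable_gradient f)

lemma abs_apply_le_norm (u : E n) (a : Fin n) : |u a| ≤ ‖u‖ := PiLp.norm_apply_le u a

lemma seminorm_le_brokenSeminorm (K : E n → Matrix (Fin n) (Fin n) ℝ) {𝒯 : Finset (Simplex n)}
    {T : Simplex n} (hT : T ∈ 𝒯) (k : ℕ) (a c : Fin n) :
    sobolevInfSeminorm (openSimplex T) k (fun x => K x a c) ≤ brokenSeminorm K 𝒯 k :=
  le_iSup₂_of_le T hT (le_iSup₂_of_le a c le_rfl)

lemma MemBrokenSobolev.brokenSeminorm_ne_top {K : E n → Matrix (Fin n) (Fin n) ℝ}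
    {𝒯 : Finset (Simplex n)} {k : ℕ} (hK : MemBrokenSobolev K 𝒯 k) :
    brokenSeminorm K 𝒯 k ≠ ⊤ := by
  refine ne_top_of_le_ne_top (b := ∑ T ∈ 𝒯, ∑ a, ∑ c,
    sobolevInfSeminorm (openSimplex T) k (fun x => K x a c)) ?_ ?_
  · exact ENNReal.sum_ne_top.mpr fun T hT => ENNReal.sum_ne_top.mpr fun a _ =>
      ENNReal.sum_ne_top.mpr fun c _ => (hK T hT a c).seminorm_ne_top
  · refine iSup₂_le fun T hT => iSup₂_le fun a c => ?_
    calc sobolevInfSeminorm (openSimplex T) k (fun x => K x a c)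
        ≤ ∑ c, sobolevInfSeminorm (openSimplex T) k (fun x => K x a c) :=
          Finset.single_le_sum (f := fun c => sobolevInfSeminorm (openSimplex T) k fun x => K x a c)
            (fun _ _ => zero_le) (Finset.mem_univ c)
      _ ≤ ∑ a, ∑ c, sobolevInfSeminorm (openSimplex T) k (fun x => K x a c) :=
          Finset.single_le_sum
            (f := fun a => ∑ c, sobolevInfSeminorm (openSimplex T) k fun x => K x a c)
            (fun _ _ => zero_le) (Finset.mem_univ a)
      _ ≤ _ := Finset.single_le_sum
            (f := fun T => ∑ a, ∑ c, sobolevInfSeminorm (openSimplex T) k fun x => K x a c)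
            (fun _ _ => zero_le) hT

lemma volume_openSimplex_ne_top (T : Simplex n) : volume (openSimplex T) ≠ ⊤ :=
  ((measure_mono (openSimplex_subset T)).trans_lt (isCompact_closedSimplex T).measure_lt_top).ne

lemma MemSobolevInf.exists_ae_abs_le {U : Set (E n)} (hU : MeasurableSet U) {k : ℕ} {f : E n → ℝ}
    (hf : MemSobolevInf U k f) : ∃ C, ∀ᵐ x, x ∈ U → |f x| ≤ C :=
  ⟨_, ae_abs_le_of_eLpNorm_le hU hf.1.eLpNorm_ne_top le_rfl⟩

/-- Quasi-optimality of bounded projections onto polynomials. -/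
lemma IsPolyProjection.abs_sub_le {S : Set (E n)} {q : ℕ} {Λ : ℝ} {P : (E n → ℝ) → E n → ℝ}
    (hP : IsPolyProjection S q Λ P) {f : E n → ℝ} (hf : ContinuousOn f S)
    {p : MvPolynomial (Fin n) ℝ} (hp : p.totalDegree ≤ q) {B : ℝ}
    (hB : ∀ x ∈ S, |f x - MvPolynomial.eval (fun a => x a) p| ≤ B) {x : E n} (hx : x ∈ S) :
    |f x - P f x| ≤ (1 + |Λ|) * B := by
  set e : E n → ℝ := fun x => MvPolynomial.eval (fun a => x a) p with he
  have hec : Continuous e := by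
    have h1 : Continuous fun x : E n => (fun a => x a : Fin n → ℝ) := by fun_prop
    exact (MvPolynomial.continuous_eval p).comp h1
  have hfe : ContinuousOn (f - e) S := hf.sub hec.continuousOn
  have h1 := hP.map_add (f - e) e hfe hec.continuousOn hx
  rw [sub_add_cancel] at h1
  have h2 := hP.apply_poly p hp hx
  have h3 := hP.bound (f - e) B hfe hB x hx
  have h4 := hB x hx
  have hB0 : 0 ≤ B := (abs_nonneg _).trans h4
  have h5 : Λ * B ≤ |Λ| * B := mul_le_mul_of_nonneg_right (le_abs_self Λ) hB0
  change P e x = e x at h2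
  rw [h1, Pi.add_apply, h2]
  calc |f x - (P (f - e) x + e x)| = |(f x - e x) - P (f - e) x| := by congr 1; ring
    _ ≤ |f x - e x| + |P (f - e) x| := abs_sub _ _
    _ ≤ (1 + |Λ|) * B := by linarith

section Mesh

variable {Ω : Set (E n)} {𝒯 : Finset (Simplex n)} {m : ℕ}
  {b : AffineBasis (Fin (n + 1)) ℝ (E n)}

/-- The kernel of a stencil function. -/
noncomputable def stencilKernel (𝒯 : Finset (Simplex n)) (m : ℕ) (T : Simplex n) (δ : E n)
    (a c : Fin n) : E n → ℝ :=
  (overlap 𝒯 m T δ).indicator fun y =>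
    gradient (refFunShift 𝒯 m T δ) y a * gradient (refFun 𝒯 m T) y c

variable (hn : n = 1 ∨ n = 2 ∨ n = 3) (hM : IsMacroMesh Ω 𝒯) (hb : ⇑b ∈ 𝒯)
  (hne : (interiorLattice b m).Nonempty)
include hn hM hb hne

lemma isBounded_overlap (δ : E n) : Bornology.IsBounded (overlap 𝒯 m b δ) := by
  obtain ⟨p, hp⟩ := hne
  have h : overlap 𝒯 m b δ ⊆ (fun y => p + y) ⁻¹' closedSimplex b := by
    intro y hy
    rw [overlap_eq hn hM hb ⟨p, hp⟩] at hy
    refine openSimplex_subset _ (mem_openSimplex_of_kuhnHat_ne_zero hp ?_)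
    rw [add_sub_cancel_left]; exact hy.1
  exact ((Homeomorph.addLeft p).isCompact_preimage.mpr
    (isCompact_closedSimplex b)).isBounded.subset h

lemma volume_overlap_ne_top (δ : E n) : volume (overlap 𝒯 m b δ) ≠ ⊤ :=
  (isBounded_overlap hn hM hb hne δ).measure_lt_top.ne

variable {z : E n} {ρ : ℝ} (hρ : 0 < ρ) (hball : Metric.ball z (ρ / 2) ⊆ closedSimplex b)
include hρ hball

lemma abs_stencilKernel_le (δ : E n) (a c : Fin n) (y : E n) :
    |stencilKernel 𝒯 m b δ a c y| ≤
      (overlap 𝒯 m b δ).indicator (fun _ => (8 * 2 ^ m / ρ) ^ 2) y := by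
  rw [stencilKernel]
  by_cases hy : y ∈ overlap 𝒯 m b δ
  · rw [indicator_of_mem hy, indicator_of_mem hy, abs_mul, sq]
    have h1 : ‖gradient (refFun 𝒯 m b) y‖ ≤ 8 * 2 ^ m / ρ := by
      rw [refFun_eq hn hM hb hne]; exact norm_gradient_kuhnHat_le hρ hball m y
    have h2 : ‖gradient (refFunShift 𝒯 m b δ) y‖ ≤ 8 * 2 ^ m / ρ := by
      have : refFunShift 𝒯 m b δ = fun y => kuhnHat b m (y - δ) := by
        ext y; rw [refFunShift, refFun_eq hn hM hb hne]
      rw [this, gradient_comp_sub]; exact norm_gradient_kuhnHat_le hρ hball m _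
    exact mul_le_mul ((abs_apply_le_norm _ a).trans h2) ((abs_apply_le_norm _ c).trans h1)
      (abs_nonneg _) (by positivity)
  · rw [indicator_of_notMem hy, indicator_of_notMem hy, abs_zero]

lemma integrable_stencilKernel (δ : E n) (a c : Fin n) :
    Integrable (stencilKernel 𝒯 m b δ a c) := by
  have hV := (isOpen_overlap hn hM hb hne (δ := δ)).measurableSet
  have h1 : Integrable ((overlap 𝒯 m b δ).indicator fun _ => (8 * 2 ^ m / ρ) ^ 2) := by
    rw [integrable_indicator_iff hV]
    exact integrableOn_const (volume_overlap_ne_top hn hM hb hne δ)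
  refine h1.mono' ?_ (Filter.Eventually.of_forall fun y =>
    abs_stencilKernel_le hn hM hb hne hρ hball δ a c y)
  exact (((measurable_gradient_apply _ a).mul (measurable_gradient_apply _ c)).indicator
    hV).aestronglyMeasurable

/-- On the stencil domain all points `x + y` with `y` in the overlap lie in the macro-element. So
`K` may be extended by zero outside it, and the stencil function becomes a sum of correlations over
the whole space. -/
lemma stencil_eq_sum {K : E n → Matrix (Fin n) (Fin n) ℝ} {k : ℕ} (hK : MemBrokenSobolev K 𝒯 k)
    {δ x : E n} (hx : x ∈ stencilDomain 𝒯 m b δ) :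
    stencil K 𝒯 m b δ x = ∑ a, ∑ c, ∫ y, stencilKernel 𝒯 m b δ a c y *
      (openSimplex b).indicator (fun z => K z a c) (x + y) := by
  have hV := (isOpen_overlap hn hM hb hne (δ := δ)).measurableSet
  have hU := (isOpen_openSimplex b).measurableSet
  have hint : ∀ a c, Integrable fun y => stencilKernel 𝒯 m b δ a c y *
      (openSimplex b).indicator (fun z => K z a c) (x + y) := by
    intro a c
    obtain ⟨C, hC⟩ := (hK _ hb a c).exists_ae_abs_le hU
    refine integrable_mul_shift (C := max C 0)
      (integrable_stencilKernel hn hM hb hne hρ hball δ a c) ?_ ?_ x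
    · exact (aestronglyMeasurable_indicator_iff hU).mpr (hK _ hb a c).1.aestronglyMeasurable
    · filter_upwards [hC] with z hz
      by_cases hzU : z ∈ openSimplex b
      · rw [indicator_of_mem hzU]; exact (hz hzU).trans (le_max_left _ _)
      · rw [indicator_of_notMem hzU, abs_zero]; exact le_max_right _ _
  rw [stencil, ← integral_indicator hV]
  simp_rw [← integral_finsetSum Finset.univ fun c _ => hint _ c]
  rw [← integral_finsetSum _ fun a _ => integrable_finsetSum _ fun c _ => hint a c]
  congr 1
  ext y
  by_cases hy : y ∈ overlap 𝒯 m b δ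
  · simp only [stencilKernel, indicator_of_mem hy,
      indicator_of_mem (add_mem_openSimplex_of_stencilDomain hn hM hb hne hx hy)]
    exact Finset.sum_congr rfl fun a _ => Finset.sum_congr rfl fun c _ => by ring
  · simp [stencilKernel, indicator_of_notMem hy]

/-- Quasi-optimality reduces the estimate to one polynomial, the stencil function of the
componentwise Taylor polynomials of `K`. The remaining factors are the squared gradient bound of the
hat functions, the Taylor remainder, the volume of the overlap, and `n ^ 2` for the entries of `K`.
-/
theorem abs_stencil_sub_proj_le {K : E n → Matrix (Fin n) (Fin n) ℝ} {r q : ℕ} (hrq : r ≤ q)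
    (hK : MemBrokenSobolev K 𝒯 (r + 1)) {δ : E n} {Λ : ℝ} {P : (E n → ℝ) → E n → ℝ}
    (hP : IsPolyProjection (stencilDomain 𝒯 m b δ) q Λ P) {x : E n}
    (hx : x ∈ stencilDomain 𝒯 m b δ) :
    |stencil K 𝒯 m b δ x - P (stencil K 𝒯 m b δ) x| ≤ (1 + |Λ|) * (n ^ 2 *
      ((8 * 2 ^ m / ρ) ^ 2 * ((n * Metric.diam (closedSimplex b)) ^ (r + 1) *
        (brokenSeminorm K 𝒯 (r + 1)).toReal) * (volume (overlap 𝒯 m b δ)).toReal)) := by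
  have hV := (isOpen_overlap hn hM hb hne (δ := δ)).measurableSet
  have hU := (isOpen_openSimplex b).measurableSet
  have hs := integrable_stencilKernel hn hM hb hne hρ hball δ
  set kt : Fin n → Fin n → E n → ℝ := fun a c => (openSimplex b).indicator fun z => K z a c with hkt
  have hktm : ∀ a c, AEStronglyMeasurable (kt a c) volume := fun a c =>
    (aestronglyMeasurable_indicator_iff hU).mpr (hK _ hb a c).1.aestronglyMeasurable
  have hktb : ∀ a c, ∃ C, ∀ᵐ z, |kt a c z| ≤ C := fun a c => by
    obtain ⟨C, hC⟩ := (hK _ hb a c).exists_ae_abs_le hU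
    refine ⟨max C 0, ?_⟩
    filter_upwards [hC] with z hz
    by_cases hzU : z ∈ openSimplex b
    · rw [hkt]; simp only; rw [indicator_of_mem hzU]; exact (hz hzU).trans (le_max_left _ _)
    · rw [hkt]; simp only; rw [indicator_of_notMem hzU, abs_zero]; exact le_max_right _ _
  choose C hC using hktb
  have hcont : ContinuousOn (stencil K 𝒯 m b δ) (stencilDomain 𝒯 m b δ) := by
    refine ContinuousOn.congr (f := fun x => ∑ a, ∑ c, ∫ y, stencilKernel 𝒯 m b δ a c y *
      kt a c (x + y)) (Continuous.continuousOn ?_) fun x hx =>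
      stencil_eq_sum hn hM hb hne hρ hball hK hx
    exact continuous_finsetSum _ fun a _ => continuous_finsetSum _ fun c _ =>
      continuous_correlation (hs a c) (hktm a c) (hC a c)
  have hdiam : ∀ x ∈ openSimplex b, ∀ y ∈ openSimplex b,
      dist x y ≤ Metric.diam (closedSimplex b) := fun x hx y hy =>
    Metric.dist_le_diam_of_mem (isCompact_closedSimplex b).isBounded (openSimplex_subset _ hx)
      (openSimplex_subset _ hy)
  choose x₀ co hco using fun a c => (hK _ hb a c).exists_taylor_approx (isOpen_openSimplex b)
    (convex_openSimplex b) (volume_openSimplex_ne_top b) hdiam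
  choose p hp hp' using fun a c => exists_poly_correlation (isBounded_overlap hn hM hb hne δ)
    (hs a c) (fun y hy => by rw [stencilKernel, indicator_of_notMem hy]) (x₀ a c) r (co a c)
  set D := (n * Metric.diam (closedSimplex b)) ^ (r + 1) *
    (brokenSeminorm K 𝒯 (r + 1)).toReal with hD
  refine hP.abs_sub_le hcont (p := ∑ a, ∑ c, p a c) ?_ ?_ hx
  · exact MvPolynomial.totalDegree_finsetSum_le fun a _ =>
      MvPolynomial.totalDegree_finsetSum_le fun c _ => (hp a c).trans hrq
  · intro x hx
    rw [stencil_eq_sum hn hM hb hne hρ hball hK hx]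
    simp only [map_sum]
    simp_rw [← (hp' _ _ x).2]
    rw [← Finset.sum_sub_distrib]
    simp_rw [← Finset.sum_sub_distrib]
    have hterm : ∀ a c, |(∫ y, stencilKernel 𝒯 m b δ a c y * kt a c (x + y)) -
        ∫ y, stencilKernel 𝒯 m b δ a c y * ∑ j ∈ Finset.range (r + 1), ∑ ι : Fin j → Fin n,
          co a c j ι * ∏ l, (x + y - x₀ a c) (ι l)| ≤
        (8 * 2 ^ m / ρ) ^ 2 * D * (volume (overlap 𝒯 m b δ)).toReal := by
      intro a c
      rw [← integral_sub (integrable_mul_shift (hs a c) (hktm a c) (hC a c) x) (hp' a c x).1]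
      have hval : ∫ y, (overlap 𝒯 m b δ).indicator (fun _ => (8 * 2 ^ m / ρ) ^ 2 * D) y =
          (8 * 2 ^ m / ρ) ^ 2 * D * (volume (overlap 𝒯 m b δ)).toReal := by
        rw [integral_indicator hV, setIntegral_const, smul_eq_mul, mul_comm]; rfl
      rw [← hval, ← Real.norm_eq_abs]
      refine norm_integral_le_of_norm_le ?_ ?_
      · rw [integrable_indicator_iff hV]
        exact integrableOn_const (volume_overlap_ne_top hn hM hb hne δ)
      have hmp := measurePreserving_add_left (volume : Measure (E n)) x
      filter_upwards [hmp.quasiMeasurePreserving.ae (hco a c)] with y hy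
      rw [← mul_sub, norm_mul, Real.norm_eq_abs, Real.norm_eq_abs]
      have h1 := abs_stencilKernel_le hn hM hb hne hρ hball δ a c y
      by_cases hyV : y ∈ overlap 𝒯 m b δ
      · have hxy := add_mem_openSimplex_of_stencilDomain hn hM hb hne hx hyV
        rw [indicator_of_mem hyV] at h1 ⊢
        have h2 := hy hxy
        have h3 : kt a c (x + y) = K (x + y) a c := indicator_of_mem hxy _
        rw [h3]
        refine mul_le_mul h1 (h2.trans ?_) (abs_nonneg _) (by positivity)
        refine mul_le_mul_of_nonneg_left ?_ (pow_nonneg (mul_nonneg n.cast_nonneg Metric.diam_nonneg) _)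
        exact ENNReal.toReal_mono hK.brokenSeminorm_ne_top (seminorm_le_brokenSeminorm K hb _ a c)
      · rw [indicator_of_notMem hyV] at h1 ⊢
        rw [le_antisymm h1 (abs_nonneg _), zero_mul]
    calc _ ≤ ∑ a : Fin n, ∑ c : Fin n, (8 * 2 ^ m / ρ) ^ 2 * D * (volume (overlap 𝒯 m b δ)).toReal :=
          (Finset.abs_sum_le_sum_abs _ _).trans (Finset.sum_le_sum fun a _ =>
            (Finset.abs_sum_le_sum_abs _ _).trans (Finset.sum_le_sum fun c _ => hterm a c))
      _ = _ := by simp; ring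

end Mesh

/-! ### The true stiffness matrix -/

lemma exists_norm_gradient_kuhnHat_le (b : AffineBasis (Fin (n + 1)) ℝ (E n)) (m : ℕ) :
    ∃ C, ∀ u, ‖gradient (kuhnHat b m) u‖ ≤ C := by
  obtain ⟨c, hc⟩ := openSimplex_nonempty b
  obtain ⟨r, hr, hball⟩ := Metric.isOpen_iff.mp (isOpen_openSimplex b) c hc
  have hball' : Metric.ball c ((2 * r) / 2) ⊆ closedSimplex b := by
    rw [mul_div_cancel_left₀ _ two_ne_zero]; exact hball.trans (openSimplex_subset b)
  exact ⟨_, fun u => norm_gradient_kuhnHat_le (by positivity) hball' m u⟩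

lemma gradient_vertexFun_eq_zero {𝒮 : Finset (Simplex n)} {p x : E n}
    (h : vertexFun 𝒮 p x = 0) : gradient (vertexFun 𝒮 p) x = 0 :=
  gradient_eq_zero_of_eq_zero (vertexFun_nonneg 𝒮 p) h

section Mesh

variable {Ω : Set (E n)} {𝒯 : Finset (Simplex n)} {m : ℕ}
  {b : AffineBasis (Fin (n + 1)) ℝ (E n)}

lemma volume_ne_top_of_mesh (hM : IsMacroMesh Ω 𝒯) : volume Ω ≠ ⊤ := by
  have h : Ω ⊆ ⋃ y ∈ 𝒯, closedSimplex y := hM.cover ▸ subset_closure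
  refine ((measure_mono h).trans_lt ?_).ne
  exact (𝒯.finite_toSet.isCompact_biUnion fun y _ => isCompact_closedSimplex y).measure_lt_top

variable (hn : n = 1 ∨ n = 2 ∨ n = 3) (hM : IsMacroMesh Ω 𝒯)
include hn hM

lemma gradient_vertexFun_eq (hb : ⇑b ∈ 𝒯) {x : E n} (hx : x ∈ openSimplex b) {q : E n}
    (hq : q ∈ lattice b m) :
    gradient (vertexFun (fineMesh 𝒯 m) q) x = gradient (kuhnHat b m) (x - q) := by
  rw [← gradient_comp_sub]
  refine gradient_congr ?_
  filter_upwards [(isOpen_openSimplex b).mem_nhds hx] with y hy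
  exact vertexFun_eq_kuhnHat hn hM hb hy hq

lemma exists_ae_norm_gradient_vertexFun_le (m : ℕ) (q : E n) :
    ∃ C, ∀ᵐ x, x ∈ Ω → ‖gradient (vertexFun (fineMesh 𝒯 m) q) x‖ ≤ C := by
  have h : ∀ T ∈ 𝒯, ∃ C, 0 ≤ C ∧
      ∀ x ∈ openSimplex T, ‖gradient (vertexFun (fineMesh 𝒯 m) q) x‖ ≤ C := by
    intro T hT
    obtain ⟨b, rfl⟩ := hM.exists_basis hT
    obtain ⟨C, hC⟩ := exists_norm_gradient_kuhnHat_le b m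
    refine ⟨C, (norm_nonneg _).trans (hC 0), fun x hx => ?_⟩
    by_cases hq : q ∈ lattice b m
    · rw [gradient_vertexFun_eq hn hM hT hx hq]; exact hC _
    · rw [gradient_vertexFun_eq_zero (vertexFun_eq_zero hn hM hT hx hq), norm_zero]
      exact (norm_nonneg _).trans (hC 0)
  choose! C hC0 hC using h
  refine ⟨∑ T ∈ 𝒯, C T, ?_⟩
  filter_upwards [ae_mem_openSimplex hn hM] with x hx hxΩ
  obtain ⟨T, hT, hxT⟩ := hx hxΩ
  exact (hC T hT x hxT).trans (Finset.single_le_sum hC0 hT)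

/-- Regularity of `K` is assumed only inside the macro-elements; up to a null set they cover `Ω`. -/
lemma MemBrokenSobolev.aestronglyMeasurable {K : E n → Matrix (Fin n) (Fin n) ℝ} {k : ℕ}
    (hK : MemBrokenSobolev K 𝒯 k) (a c : Fin n) :
    AEStronglyMeasurable (fun x => K x a c) (volume.restrict Ω) := by
  have h : AEStronglyMeasurable (fun x => K x a c)
      (volume.restrict (⋃ T : 𝒯, openSimplex T.1)) :=
    AEStronglyMeasurable.iUnion fun T => (hK T.1 T.2 a c).1.aestronglyMeasurable
  refine h.mono_measure (Measure.restrict_mono_ae ?_)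
  filter_upwards [ae_mem_openSimplex hn hM] with x hx hxΩ
  obtain ⟨T, hT, hxT⟩ := hx hxΩ
  exact mem_iUnion.mpr ⟨⟨T, hT⟩, hxT⟩

lemma MemBrokenSobolev.exists_ae_abs_le {K : E n → Matrix (Fin n) (Fin n) ℝ} {k : ℕ}
    (hK : MemBrokenSobolev K 𝒯 k) (a c : Fin n) : ∃ C, ∀ᵐ x, x ∈ Ω → |K x a c| ≤ C := by
  have h := fun T (hT : T ∈ 𝒯) =>
    (hK T hT a c).exists_ae_abs_le (isOpen_openSimplex T).measurableSet
  choose! C hC using h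
  refine ⟨∑ T ∈ 𝒯, |C T|, ?_⟩
  filter_upwards [ae_mem_openSimplex hn hM, (Filter.eventually_all_finset 𝒯).mpr hC]
    with x hx hx' hxΩ
  obtain ⟨T, hT, hxT⟩ := hx hxΩ
  exact ((hx' T hT hxT).trans (le_abs_self _)).trans
    (Finset.single_le_sum (f := fun T => |C T|) (fun _ _ => abs_nonneg _) hT)

variable (hΩ : IsOpen Ω) {K : E n → Matrix (Fin n) (Fin n) ℝ} {k : ℕ}
  (hK : MemBrokenSobolev K 𝒯 k)
include hΩ hK

lemma integrableOn_gradient_form (p q : E n) (a c : Fin n) :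
    IntegrableOn (fun x => gradient (vertexFun (fineMesh 𝒯 m) q) x a * K x a c *
      gradient (vertexFun (fineMesh 𝒯 m) p) x c) Ω := by
  obtain ⟨C₁, h1⟩ := exists_ae_norm_gradient_vertexFun_le hn hM m q
  obtain ⟨C₂, h2⟩ := exists_ae_norm_gradient_vertexFun_le hn hM m p
  obtain ⟨C₃, h3⟩ := hK.exists_ae_abs_le hn hM a c
  have : IsFiniteMeasure (volume.restrict Ω) := ⟨by simpa using (volume_ne_top_of_mesh hM).lt_top⟩
  refine Integrable.of_bound (((measurable_gradient_apply _ a).aestronglyMeasurable.mul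
    (hK.aestronglyMeasurable hn hM a c)).mul
    (measurable_gradient_apply _ c).aestronglyMeasurable) (|C₁| * |C₃| * |C₂|) ?_
  rw [ae_restrict_iff' hΩ.measurableSet]
  filter_upwards [h1, h2, h3] with x h1 h2 h3 hx
  rw [norm_mul, norm_mul]
  refine mul_le_mul (mul_le_mul ?_ ?_ (norm_nonneg _) (abs_nonneg _)) ?_ (norm_nonneg _)
    (by positivity)
  · exact ((abs_apply_le_norm _ a).trans (h1 hx)).trans (le_abs_self _)
  · exact (h3 hx).trans (le_abs_self _)
  · exact ((abs_apply_le_norm _ c).trans (h2 hx)).trans (le_abs_self _)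

lemma integrableOn_stiffness (p q : E n) :
    IntegrableOn (fun x => ∑ a, ∑ c, gradient (vertexFun (fineMesh 𝒯 m) q) x a * K x a c *
      gradient (vertexFun (fineMesh 𝒯 m) p) x c) Ω :=
  integrable_finsetSum _ fun a _ => integrable_finsetSum _ fun c _ =>
    integrableOn_gradient_form hn hM hΩ hK p q a c

omit hK hn hM hΩ in
lemma stiffness_comm (hsym : ∀ᵐ x ∂(volume.restrict Ω), (K x).IsSymm) (p q : E n) :
    stiffness Ω K 𝒯 m p q = stiffness Ω K 𝒯 m q p := by
  refine integral_congr_ae ?_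
  filter_upwards [hsym] with x hx
  rw [Finset.sum_comm]
  refine Finset.sum_congr rfl fun a _ => Finset.sum_congr rfl fun c _ => ?_
  rw [← hx.apply a c]; ring

variable {v : E n → ℝ} {g : E n → E n} (hreg : ∀ᵐ x, x ∈ Ω → IsRegularPoint 𝒯 m v g x)
include hreg

/-- The gradients of all hat functions, including those on `∂Ω`, sum to zero almost everywhere. -/
lemma sum_stiffness_eq_zero (p : E n) : ∑ q ∈ vertices 𝒯 m, stiffness Ω K 𝒯 m p q = 0 := by
  simp only [stiffness, poissonForm]
  rw [← integral_finsetSum _ fun q _ => integrableOn_stiffness hn hM hΩ hK p q]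
  refine integral_eq_zero_of_ae ?_
  filter_upwards [(ae_restrict_iff' hΩ.measurableSet).mpr hreg] with x hx
  have h : ∀ a, ∑ q ∈ vertices 𝒯 m, gradient (vertexFun (fineMesh 𝒯 m) q) x a = 0 := fun a => by
    have := congrArg (fun u : E n => u a) hx.sum_grad
    simpa using this
  rw [Finset.sum_comm]
  refine Finset.sum_eq_zero fun a _ => ?_
  rw [Finset.sum_comm]
  refine Finset.sum_eq_zero fun c _ => ?_
  simp_rw [mul_assoc]
  rw [← Finset.sum_mul, h, zero_mul]

lemma poissonForm_eq_sum : poissonForm Ω K g g =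
    ∑ p ∈ vertices 𝒯 m, ∑ q ∈ vertices 𝒯 m, stiffness Ω K 𝒯 m p q * v q * v p := by
  simp only [stiffness, poissonForm]
  simp_rw [← integral_mul_const]
  have hint : ∀ p q, IntegrableOn (fun x => (∑ a, ∑ c,
      gradient (vertexFun (fineMesh 𝒯 m) q) x a * K x a c *
      gradient (vertexFun (fineMesh 𝒯 m) p) x c) * v q * v p) Ω := fun p q =>
    ((integrableOn_stiffness hn hM hΩ hK p q).mul_const _).mul_const _
  simp_rw [← integral_finsetSum _ fun q _ => hint _ q]
  rw [← integral_finsetSum _ fun p _ => integrable_finsetSum _ fun q _ => hint p q]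
  refine integral_congr_ae ?_
  filter_upwards [(ae_restrict_iff' hΩ.measurableSet).mpr hreg] with x hx
  have h : ∀ a, g x a = ∑ q ∈ vertices 𝒯 m,
      v q * gradient (vertexFun (fineMesh 𝒯 m) q) x a := fun a => by
    have := congrArg (fun u : E n => u a) hx.grad_eq
    simpa using this
  calc ∑ a, ∑ c, g x a * K x a c * g x c = ∑ a, ∑ c, ∑ p ∈ vertices 𝒯 m, ∑ q ∈ vertices 𝒯 m,
        gradient (vertexFun (fineMesh 𝒯 m) q) x a * K x a c *
          gradient (vertexFun (fineMesh 𝒯 m) p) x c * v q * v p := by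
        refine Finset.sum_congr rfl fun a _ => Finset.sum_congr rfl fun c _ => ?_
        rw [h a, h c, Finset.mul_sum]
        refine Finset.sum_congr rfl fun p _ => ?_
        rw [Finset.sum_mul, Finset.sum_mul]
        exact Finset.sum_congr rfl fun q _ => by ring
    _ = _ := by
        simp_rw [Finset.sum_mul]
        rw [Finset.sum_congr rfl fun a _ => Finset.sum_comm, Finset.sum_comm]
        refine Finset.sum_congr rfl fun p _ => ?_
        rw [Finset.sum_congr rfl fun a _ => Finset.sum_comm, Finset.sum_comm]

end Mesh

/-! ### Stiffness entries as values of stencil functions -/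

section Stencil

variable {Ω : Set (E n)} {𝒯 : Finset (Simplex n)} {m : ℕ}
  {b : AffineBasis (Fin (n + 1)) ℝ (E n)} (hn : n = 1 ∨ n = 2 ∨ n = 3) (hM : IsMacroMesh Ω 𝒯)
  (hb : ⇑b ∈ 𝒯) {p q : E n} (hpq : p ∈ interiorLattice b m ∨ q ∈ interiorLattice b m)
include hn hM hb hpq

/-- Both vertex functions are nonzero only inside the macro-element of the interior vertex. -/
lemma mem_of_vertexFun_ne_zero {x : E n} (hp : vertexFun (fineMesh 𝒯 m) p x ≠ 0)
    (hq : vertexFun (fineMesh 𝒯 m) q x ≠ 0) :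
    x ∈ openSimplex b ∧ p ∈ lattice b m ∧ q ∈ lattice b m := by
  have hx : x ∈ openSimplex b := by
    rcases hpq with h | h
    · rw [vertexFun_interior hn hM hb h] at hp
      exact mem_openSimplex_of_kuhnHat_ne_zero h hp
    · rw [vertexFun_interior hn hM hb h] at hq
      exact mem_openSimplex_of_kuhnHat_ne_zero h hq
  refine ⟨hx, ?_, ?_⟩
  · by_contra h; exact hp (vertexFun_eq_zero hn hM hb hx h)
  · by_contra h; exact hq (vertexFun_eq_zero hn hM hb hx h)

lemma sub_mem_directions {x : E n} (hp : vertexFun (fineMesh 𝒯 m) p x ≠ 0)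
    (hq : vertexFun (fineMesh 𝒯 m) q x ≠ 0) : q - p ∈ directions 𝒯 m b := by
  obtain ⟨-, hpl, hql⟩ := mem_of_vertexFun_ne_zero hn hM hb hpq hp hq
  rcases hpq with h | h
  · exact ⟨p, h, q, hql, rfl, x, hp, hq⟩
  · rw [← neg_sub]
    exact neg_mem_directions hn hM hb ⟨q, h, p, hpl, rfl, x, hq, hp⟩

/-- A nonnegative function has zero gradient at its zeros, so only points where both hat functions
are nonzero contribute, and such a point would make `q - p` a direction. -/
lemma stiffness_eq_zero (K : E n → Matrix (Fin n) (Fin n) ℝ) (hδ : q - p ∉ directions 𝒯 m b) :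
    stiffness Ω K 𝒯 m p q = 0 := by
  rw [stiffness, poissonForm]
  refine integral_eq_zero_of_ae (Filter.Eventually.of_forall fun x => ?_)
  simp only [Pi.zero_apply]
  by_cases hp : vertexFun (fineMesh 𝒯 m) p x = 0
  · simp [gradient_vertexFun_eq_zero hp]
  by_cases hq : vertexFun (fineMesh 𝒯 m) q x = 0
  · simp [gradient_vertexFun_eq_zero hq]
  exact absurd (sub_mem_directions hn hM hb hpq hp hq) hδ

/-- Translation by `p` carries the overlap onto the common support of the two hat functions; outside
it the stiffness integrand vanishes. -/
lemma stencil_eq_stiffness (hΩ : IsOpen Ω) (K : E n → Matrix (Fin n) (Fin n) ℝ)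
    (hp : p ∈ lattice b m) (hq : q ∈ lattice b m) :
    stencil K 𝒯 m b (q - p) p = stiffness Ω K 𝒯 m p q := by
  have hne : (interiorLattice b m).Nonempty := by rcases hpq with h | h; exacts [⟨_, h⟩, ⟨_, h⟩]
  rw [stiffness, poissonForm, stencil, ← integral_indicator hΩ.measurableSet,
    ← integral_indicator (isOpen_overlap hn hM hb hne).measurableSet,
    ← integral_add_left_eq_self (Ω.indicator fun x => ∑ a, ∑ c,
      gradient (vertexFun (fineMesh 𝒯 m) q) x a * K x a c *
        gradient (vertexFun (fineMesh 𝒯 m) p) x c) p]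
  congr 1
  ext y
  by_cases hy : y ∈ overlap 𝒯 m b (q - p)
  · have hx := add_overlap_subset hn hM hb hpq hy
    rw [indicator_of_mem hy, indicator_of_mem (hM.subset _ hb hx)]
    have h1 : gradient (refFun 𝒯 m b) y = gradient (vertexFun (fineMesh 𝒯 m) p) (p + y) := by
      rw [gradient_vertexFun_eq hn hM hb hx hp, refFun_eq hn hM hb hne, add_sub_cancel_left]
    have h2 : gradient (refFunShift 𝒯 m b (q - p)) y =
        gradient (vertexFun (fineMesh 𝒯 m) q) (p + y) := by
      have : refFunShift 𝒯 m b (q - p) = fun y => kuhnHat b m (y - (q - p)) := by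
        ext y; rw [refFunShift, refFun_eq hn hM hb hne]
      rw [gradient_vertexFun_eq hn hM hb hx hq, this, gradient_comp_sub]
      congr 1
      abel
    rw [h1, h2]
  · rw [indicator_of_notMem hy]
    by_cases hx : p + y ∈ Ω
    · rw [indicator_of_mem hx]
      by_cases hp0 : vertexFun (fineMesh 𝒯 m) p (p + y) = 0
      · simp [gradient_vertexFun_eq_zero hp0]
      by_cases hq0 : vertexFun (fineMesh 𝒯 m) q (p + y) = 0
      · simp [gradient_vertexFun_eq_zero hq0]
      refine absurd ?_ hy
      have hxo := (mem_of_vertexFun_ne_zero hn hM hb hpq hp0 hq0).1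
      rw [vertexFun_eq_kuhnHat hn hM hb hxo hp, add_sub_cancel_left] at hp0
      rw [vertexFun_eq_kuhnHat hn hM hb hxo hq] at hq0
      rw [overlap_eq hn hM hb hne]
      refine ⟨hp0, ?_⟩
      convert hq0 using 2
      abel
    · rw [indicator_of_notMem hx]

end Stencil

/-! ### The consistency error of the surrogate form -/

/-- A symmetric matrix with zero row sums induces the form `-½ ∑ M_pq (v_q - v_p)²`. -/
lemma sum_mul_mul_eq_of_row_sum_zero {ι : Type*} (D : Finset ι) (M : ι → ι → ℝ) (v : ι → ℝ)
    (hsymm : ∀ p ∈ D, ∀ q ∈ D, M p q = M q p) (hrow : ∀ p ∈ D, ∑ q ∈ D, M p q = 0) :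
    ∑ p ∈ D, ∑ q ∈ D, M p q * v q * v p =
      -(1 / 2) * ∑ p ∈ D, ∑ q ∈ D, M p q * (v q - v p) ^ 2 := by
  have h1 : ∑ p ∈ D, ∑ q ∈ D, M p q * v p ^ 2 = 0 := by
    refine Finset.sum_eq_zero fun p hp => ?_
    rw [← Finset.sum_mul, hrow p hp, zero_mul]
  have h2 : ∑ p ∈ D, ∑ q ∈ D, M p q * v q ^ 2 = 0 := by
    rw [Finset.sum_comm]
    refine Finset.sum_eq_zero fun p hp => ?_
    rw [← Finset.sum_mul, Finset.sum_congr rfl fun q hq => hsymm q hq p hp, hrow p hp, zero_mul]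
  have h3 : ∑ p ∈ D, ∑ q ∈ D, M p q * (v q - v p) ^ 2 =
      ∑ p ∈ D, ∑ q ∈ D, M p q * v q ^ 2 + ∑ p ∈ D, ∑ q ∈ D, M p q * v p ^ 2 -
        2 * ∑ p ∈ D, ∑ q ∈ D, M p q * v q * v p := by
    simp_rw [Finset.mul_sum, ← Finset.sum_add_distrib, ← Finset.sum_sub_distrib]
    exact Finset.sum_congr rfl fun p _ => Finset.sum_congr rfl fun q _ => by ring
  rw [h3, h1, h2]; ring

section Mesh

variable {Ω : Set (E n)} {𝒯 : Finset (Simplex n)} {m : ℕ}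
  {b : AffineBasis (Fin (n + 1)) ℝ (E n)} (hn : n = 1 ∨ n = 2 ∨ n = 3) (hM : IsMacroMesh Ω 𝒯)
include hn hM

omit hn in
lemma not_mem_interfaceVertices (hb : ⇑b ∈ 𝒯) {p : E n} (hp : p ∈ interiorLattice b m) :
    p ∉ interfaceVertices 𝒯 m := by
  classical
  simp only [interfaceVertices, boundaryLattice, Finset.mem_biUnion, Finset.mem_sdiff, not_exists,
    not_and, not_not]
  intro T hT hpT
  obtain ⟨b', rfl⟩ := hM.exists_basis hT
  rw [hM.eq_of_mem hb hT ((mem_interiorLattice_iff b m p).mp hp).2 (lattice_subset b' m hpT)]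
  exact hp

lemma mem_lattice_of_sub_mem_directions (hb : ⇑b ∈ 𝒯) {p q : E n}
    (hpq : p ∈ interiorLattice b m ∨ q ∈ interiorLattice b m) (hδ : q - p ∈ directions 𝒯 m b) :
    p ∈ lattice b m ∧ q ∈ lattice b m := by
  rcases hpq with h | h
  · refine ⟨((mem_interiorLattice_iff b m p).mp h).1, ?_⟩
    simpa using add_direction_mem_lattice hn hM hb h hδ
  · refine ⟨?_, ((mem_interiorLattice_iff b m q).mp h).1⟩
    simpa using add_direction_mem_lattice hn hM hb h (neg_mem_directions hn hM hb hδ)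

/-- The sum over macro-elements has at most one nonzero term: any other admissible element would
contain, in its closed simplex, the vertex that is interior to `b`. -/
lemma surrogateOffDiag_eq (hb : ⇑b ∈ 𝒯) (K : E n → Matrix (Fin n) (Fin n) ℝ)
    (P : Simplex n → E n → (E n → ℝ) → E n → ℝ) {p q : E n}
    (hpq : p ∈ interiorLattice b m ∨ q ∈ interiorLattice b m)
    [Decidable (q - p ∈ directions 𝒯 m b)] :
    surrogateOffDiag Ω K 𝒯 m P p q =
      if q - p ∈ directions 𝒯 m b then P b (q - p) (stencil K 𝒯 m b (q - p)) p else 0 := by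
  classical
  rw [surrogateOffDiag, if_neg, Finset.sum_eq_single_of_mem _ hb]
  · simp [hpq]
  · rintro T hT hne
    refine if_neg ?_
    rintro ⟨hδ, h⟩
    obtain ⟨b', rfl⟩ := hM.exists_basis hT
    obtain ⟨h1, h2⟩ := mem_lattice_of_sub_mem_directions hn hM hT h hδ
    refine hne ?_
    rcases hpq with hp | hq
    · exact hM.eq_of_mem hb hT ((mem_interiorLattice_iff b m p).mp hp).2 (lattice_subset b' m h1)
    · exact hM.eq_of_mem hb hT ((mem_interiorLattice_iff b m q).mp hq).2 (lattice_subset b' m h2)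
  · rintro ⟨h1, h2⟩
    rcases hpq with hp | hq
    · exact not_mem_interfaceVertices hM hb hp h1
    · exact not_mem_interfaceVertices hM hb hq h2

omit hn in
lemma exists_interior_of_not_interface {p q : E n} (hp : p ∈ vertices 𝒯 m)
    (hq : q ∈ vertices 𝒯 m)
    (h : ¬ (p ∈ interfaceVertices 𝒯 m ∧ q ∈ interfaceVertices 𝒯 m)) :
    ∃ b : AffineBasis (Fin (n + 1)) ℝ (E n), ⇑b ∈ 𝒯 ∧
      (p ∈ interiorLattice b m ∨ q ∈ interiorLattice b m) := by
  classical
  have key : ∀ z ∈ vertices 𝒯 m, z ∉ interfaceVertices 𝒯 m →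
      ∃ b : AffineBasis (Fin (n + 1)) ℝ (E n), ⇑b ∈ 𝒯 ∧ z ∈ interiorLattice b m := by
    intro z hz hzi
    obtain ⟨T, hT, hzT⟩ := mem_vertices.mp hz
    obtain ⟨b, rfl⟩ := hM.exists_basis hT
    refine ⟨b, hT, ?_⟩
    by_contra hcon
    exact hzi (Finset.mem_biUnion.mpr ⟨_, hT, Finset.mem_sdiff.mpr ⟨hzT, hcon⟩⟩)
  rw [not_and_or] at h
  rcases h with h | h
  · obtain ⟨b, hb, h⟩ := key p hp h; exact ⟨b, hb, Or.inl h⟩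
  · obtain ⟨b, hb, h⟩ := key q hq h; exact ⟨b, hb, Or.inr h⟩

variable {K : E n → Matrix (Fin n) (Fin n) ℝ} {P : Simplex n → E n → (E n → ℝ) → E n → ℝ}
  {q' : ℕ} {Λ : ℝ} (hP : IsProjectionFamily K 𝒯 m q' Λ P)
include hP

/-- Between interface vertices this is the symmetry of `K`; elsewhere it is exactly the relation
imposed on projections for opposite directions. -/
lemma surrogateOffDiag_comm (hsym : ∀ᵐ x ∂(volume.restrict Ω), (K x).IsSymm) {p q : E n}
    (hp : p ∈ vertices 𝒯 m) (hq : q ∈ vertices 𝒯 m) :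
    surrogateOffDiag Ω K 𝒯 m P p q = surrogateOffDiag Ω K 𝒯 m P q p := by
  classical
  by_cases h : p ∈ interfaceVertices 𝒯 m ∧ q ∈ interfaceVertices 𝒯 m
  · rw [surrogateOffDiag, surrogateOffDiag, if_pos h, if_pos h.symm, stiffness_comm hsym]
  obtain ⟨b, hb, hpq⟩ := exists_interior_of_not_interface hM hp hq h
  rw [surrogateOffDiag_eq hn hM hb K P hpq, surrogateOffDiag_eq hn hM hb K P hpq.symm]
  have hneg := neg_sub q p
  by_cases hδ : q - p ∈ directions 𝒯 m b
  · have hδ' : p - q ∈ directions 𝒯 m b := hneg ▸ neg_mem_directions hn hM hb hδ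
    rw [if_pos hδ, if_pos hδ']
    have hmem := mem_stencilDomain hn hM hb hpq (mem_lattice_of_sub_mem_directions hn hM hb hpq hδ).1
    rw [hP.related _ hb _ hδ p hmem, hneg, add_sub_cancel]
  · have hδ' : p - q ∉ directions 𝒯 m b := fun h' => hδ (by
      rw [← neg_sub]; exact neg_mem_directions hn hM hb h')
    rw [if_neg hδ, if_neg hδ']

omit hP in
/-- On the common support of two vertex functions the weak gradient controls the difference
quotient. -/
lemma volume_overlap_mul_sq_le (hb : ⇑b ∈ 𝒯) {p q : E n}
    (hpq : p ∈ interiorLattice b m ∨ q ∈ interiorLattice b m) (hp : p ∈ lattice b m)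
    (hq : q ∈ lattice b m) {v : E n → ℝ} {g : E n → E n}
    (hg : IntegrableOn (fun x => ‖g x‖ ^ 2) Ω)
    (hreg : ∀ᵐ x, x ∈ Ω → IsRegularPoint 𝒯 m v g x) :
    ∃ A ⊆ Ω, MeasurableSet A ∧
      (∀ x ∈ A, vertexFun (fineMesh 𝒯 m) p x ≠ 0 ∧ vertexFun (fineMesh 𝒯 m) q x ≠ 0) ∧
      (volume (overlap 𝒯 m b (q - p))).toReal * (v q - v p) ^ 2 ≤
        ‖q - p‖ ^ 2 * ∫ x in A, ‖g x‖ ^ 2 := by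
  have hne : (interiorLattice b m).Nonempty := by rcases hpq with h | h; exacts [⟨_, h⟩, ⟨_, h⟩]
  have hV := (isOpen_overlap hn hM hb hne (δ := q - p)).measurableSet
  have hmem : ∀ x, -p + x ∈ overlap 𝒯 m b (q - p) → x ∈ openSimplex b := fun x hx => by
    simpa using add_overlap_subset hn hM hb hpq hx
  have hA : MeasurableSet ((fun x => -p + x) ⁻¹' overlap 𝒯 m b (q - p)) :=
    (measurable_const_add (-p)) hV
  have hAΩ : (fun x => -p + x) ⁻¹' overlap 𝒯 m b (q - p) ⊆ Ω :=
    fun x hx => hM.subset _ hb (hmem x hx)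
  have hφ : ∀ x ∈ (fun x => -p + x) ⁻¹' overlap 𝒯 m b (q - p),
      vertexFun (fineMesh 𝒯 m) p x ≠ 0 ∧ vertexFun (fineMesh 𝒯 m) q x ≠ 0 := by
    intro x hx
    have hxb := hmem x hx
    rw [mem_preimage, overlap_eq hn hM hb hne] at hx
    rw [vertexFun_eq_kuhnHat hn hM hb hxb hp, vertexFun_eq_kuhnHat hn hM hb hxb hq]
    refine ⟨?_, ?_⟩
    · convert hx.1 using 2; abel
    · convert hx.2 using 2; abel
  refine ⟨_, hAΩ, hA, hφ, ?_⟩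
  rw [← measure_preimage_add volume (-p) (overlap 𝒯 m b (q - p)), ← integral_const_mul]
  have hfin : volume ((fun x => -p + x) ⁻¹' overlap 𝒯 m b (q - p)) ≠ ⊤ := by
    rw [measure_preimage_add]; exact volume_overlap_ne_top hn hM hb hne _
  calc _ = ∫ x in (fun x => -p + x) ⁻¹' overlap 𝒯 m b (q - p), (v q - v p) ^ 2 := by
        rw [setIntegral_const, smul_eq_mul]; rfl
    _ ≤ _ := by
        refine setIntegral_mono_on_ae (integrableOn_const hfin)
          ((hg.mono_set hAΩ).const_mul _) hA ?_
        filter_upwards [hreg] with x hx hxA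
        obtain ⟨h1, h2⟩ := hφ x hxA
        rw [← (hx (hAΩ hxA)).inner_grad p q h1 h2, ← mul_pow, ← sq_abs]
        refine pow_le_pow_left₀ (abs_nonneg _) ?_ 2
        rw [mul_comm]
        exact abs_real_inner_le_norm _ _

/-- The error of an off-diagonal entry, weighted by the squared difference of the nodal values. -/
lemma abs_sub_surrogateOffDiag_mul_sq_le (hΩ : IsOpen Ω) {σ : ℝ} (hσ : ShapeRegular σ 𝒯) {r : ℕ}
    (hrq : r ≤ q') (hK : MemBrokenSobolev K 𝒯 (r + 1)) {p q : E n}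
    (hp : p ∈ vertices 𝒯 m) (hq : q ∈ vertices 𝒯 m) {v : E n → ℝ} {g : E n → E n}
    (hg : IntegrableOn (fun x => ‖g x‖ ^ 2) Ω)
    (hreg : ∀ᵐ x, x ∈ Ω → IsRegularPoint 𝒯 m v g x) :
    ∃ A ⊆ Ω, MeasurableSet A ∧
      (∀ x ∈ A, vertexFun (fineMesh 𝒯 m) p x ≠ 0 ∧ vertexFun (fineMesh 𝒯 m) q x ≠ 0) ∧
      |stiffness Ω K 𝒯 m p q - surrogateOffDiag Ω K 𝒯 m P p q| * (v q - v p) ^ 2 ≤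
        (1 + |Λ|) * n ^ 2 * (64 * (n + 1) ^ 2 * σ ^ 2) * n ^ (r + 1) * meshSize 𝒯 ^ (r + 1) *
          (brokenSeminorm K 𝒯 (r + 1)).toReal * ∫ x in A, ‖g x‖ ^ 2 := by
  classical
  by_cases h : p ∈ interfaceVertices 𝒯 m ∧ q ∈ interfaceVertices 𝒯 m
  · exact ⟨∅, empty_subset _, MeasurableSet.empty, by simp, by
      rw [surrogateOffDiag, if_pos h]; simp⟩
  obtain ⟨b, hb, hpq⟩ := exists_interior_of_not_interface hM hp hq h
  rw [surrogateOffDiag_eq hn hM hb K P hpq]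
  by_cases hδ : q - p ∈ directions 𝒯 m b
  swap
  · exact ⟨∅, empty_subset _, MeasurableSet.empty, by simp, by
      rw [if_neg hδ, stiffness_eq_zero hn hM hb hpq K hδ]; simp⟩
  obtain ⟨hpl, hql⟩ := mem_lattice_of_sub_mem_directions hn hM hb hpq hδ
  obtain ⟨A, hAΩ, hA, hφ, hle⟩ := volume_overlap_mul_sq_le hn hM hb hpq hpl hql hg hreg
  refine ⟨A, hAΩ, hA, hφ, ?_⟩
  rw [if_pos hδ, ← stencil_eq_stiffness hn hM hb hpq hΩ K hpl hql]
  have hne : (interiorLattice b m).Nonempty := by rcases hpq with h | h; exacts [⟨_, h⟩, ⟨_, h⟩]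
  obtain ⟨c, ρ, hρ, hball, hdiam⟩ := hσ _ hb
  have hmain := abs_stencil_sub_proj_le hn hM hb hne hρ hball hrq hK (hP.proj _ hb _ hδ)
    (mem_stencilDomain hn hM hb hpq hpl)
  have hd0 : 0 ≤ Metric.diam (closedSimplex b) := Metric.diam_nonneg
  have hdH : Metric.diam (closedSimplex b) ≤ meshSize 𝒯 :=
    le_ciSup (f := fun y : 𝒯 => Metric.diam (closedSimplex y.1)) (finite_range _).bddAbove ⟨_, hb⟩
  have hH0 := hd0.trans hdH
  have hI : 0 ≤ ∫ x in A, ‖g x‖ ^ 2 := integral_nonneg fun x => by positivity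
  -- The scale `2 ^ m` cancels between the gradient bound and the length of the direction, and shape
  -- regularity cancels `ρ`. Hence the constant is independent of `m`.
  have hgeom : (8 * 2 ^ m / ρ) ^ 2 * ‖q - p‖ ^ 2 ≤ 64 * (n + 1) ^ 2 * σ ^ 2 := by
    have h1 : 8 * 2 ^ m / ρ * ‖q - p‖ ≤ 8 * (n + 1) * σ := by
      calc 8 * 2 ^ m / ρ * ‖q - p‖
          ≤ 8 * 2 ^ m / ρ * ((n + 1) * (σ * ρ) / 2 ^ m) := by
            gcongr
            exact (norm_direction_le hn hM hb hδ).trans (by gcongr)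
        _ = _ := by field_simp
    calc _ = (8 * 2 ^ m / ρ * ‖q - p‖) ^ 2 := by ring
      _ ≤ (8 * (n + 1) * σ) ^ 2 := by gcongr
      _ = _ := by ring
  set κ := (brokenSeminorm K 𝒯 (r + 1)).toReal
  have hκ : 0 ≤ κ := ENNReal.toReal_nonneg
  set W := (volume (overlap 𝒯 m b (q - p))).toReal
  set I := ∫ x in A, ‖g x‖ ^ 2
  calc _ ≤ (1 + |Λ|) * (n ^ 2 * ((8 * 2 ^ m / ρ) ^ 2 *
        ((n * Metric.diam (closedSimplex b)) ^ (r + 1) * κ) * W)) * (v q - v p) ^ 2 := by gcongr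
    _ = (1 + |Λ|) * n ^ 2 * (8 * 2 ^ m / ρ) ^ 2 *
        (n * Metric.diam (closedSimplex b)) ^ (r + 1) * κ * (W * (v q - v p) ^ 2) := by ring
    _ ≤ (1 + |Λ|) * n ^ 2 * (8 * 2 ^ m / ρ) ^ 2 *
        (n * meshSize 𝒯) ^ (r + 1) * κ * (‖q - p‖ ^ 2 * I) := by gcongr
    _ = (1 + |Λ|) * n ^ 2 * ((8 * 2 ^ m / ρ) ^ 2 * ‖q - p‖ ^ 2) *
        (n ^ (r + 1) * meshSize 𝒯 ^ (r + 1)) * κ * I := by rw [mul_pow]; ring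
    _ ≤ (1 + |Λ|) * n ^ 2 * (64 * (n + 1) ^ 2 * σ ^ 2) *
        (n ^ (r + 1) * meshSize 𝒯 ^ (r + 1)) * κ * I := by
        gcongr
    _ = _ := by ring

end Mesh

/-- Finite overlap: almost every point of `Ω` lies in at most `N` of the sets, so the indicator
functions add up to at most `N`. -/
lemma sum_setIntegral_le {ι α : Type*} [MeasurableSpace α] {μ : Measure α} {Ω : Set α}
    (hΩ : MeasurableSet Ω) (D : Finset ι) {A : ι → Set α}
    (hA : ∀ i ∈ D, MeasurableSet (A i) ∧ A i ⊆ Ω) {f : α → ℝ} (hf0 : ∀ x, 0 ≤ f x)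
    (hf : IntegrableOn f Ω μ) {N : ℕ}
    (hN : ∀ᵐ x ∂μ, x ∈ Ω → ∃ s : Finset ι, s.card ≤ N ∧ ∀ i ∈ D, x ∈ A i → i ∈ s) :
    ∑ i ∈ D, ∫ x in A i, f x ∂μ ≤ N * ∫ x in Ω, f x ∂μ := by
  classical
  have h1 : ∀ i ∈ D, ∫ x in A i, f x ∂μ = ∫ x in Ω, (A i).indicator f x ∂μ := fun i hi => by
    rw [setIntegral_indicator (hA i hi).1, inter_eq_self_of_subset_right (hA i hi).2]
  have hint : ∀ i ∈ D, IntegrableOn ((A i).indicator f) Ω μ := fun i hi => hf.indicator (hA i hi).1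
  rw [Finset.sum_congr rfl h1, ← integral_finsetSum _ hint, ← integral_const_mul]
  refine setIntegral_mono_on_ae (integrable_finsetSum _ hint) (hf.const_mul _) hΩ ?_
  filter_upwards [hN] with x hx hxΩ
  obtain ⟨s, hs, hsA⟩ := hx hxΩ
  have hmem : ∀ i ∈ D, (A i).indicator f x ≠ 0 → i ∈ s := fun i hi h =>
    hsA i hi (mem_of_indicator_ne_zero h)
  rw [← Finset.sum_filter_of_ne hmem]
  refine (Finset.sum_le_card_nsmul _ _ (f x) fun i _ => indicator_le_self' (fun _ _ => hf0 x) x).trans ?_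
  rw [nsmul_eq_mul]
  refine mul_le_mul_of_nonneg_right ?_ (hf0 x)
  exact_mod_cast (Finset.card_le_card fun i hi => (Finset.mem_filter.mp hi).2).trans hs

lemma meshSize_nonneg (𝒯 : Finset (Simplex n)) : 0 ≤ meshSize 𝒯 :=
  Real.iSup_nonneg fun _ => Metric.diam_nonneg

lemma IsH10.integrableOn_norm_sq {Ω : Set (E n)} {u : E n → ℝ} {g : E n → E n}
    (h : IsH10 Ω u g) : IntegrableOn (fun x => ‖g x‖ ^ 2) Ω :=
  h.memLp_grad.integrable_norm_pow two_ne_zero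

section Mesh

variable {Ω : Set (E n)} {𝒯 : Finset (Simplex n)} {m : ℕ} (hn : n = 1 ∨ n = 2 ∨ n = 3)
  (hM : IsMacroMesh Ω 𝒯) (hΩ : IsOpen Ω) {K : E n → Matrix (Fin n) (Fin n) ℝ}
include hn hM hΩ

/-- The error is the quadratic form of a symmetric matrix with zero row sums, so it is a sum of
squared nodal differences. Each is bounded by the gradient energy on one common support, and these
supports overlap finitely often. -/
theorem abs_poissonForm_sub_surrogateForm_le
    (hsym : ∀ᵐ x ∂(volume.restrict Ω), (K x).IsSymm) {σ : ℝ} (hσ : ShapeRegular σ 𝒯) {q r : ℕ}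
    (hrq : r ≤ q) (hK : MemBrokenSobolev K 𝒯 (r + 1)) {Λ : ℝ}
    {P : Simplex n → E n → (E n → ℝ) → E n → ℝ} (hP : IsProjectionFamily K 𝒯 m q Λ P)
    {v : E n → ℝ} (hv : v ∈ feSpace Ω (fineMesh 𝒯 m)) {g : E n → E n} (hg : IsH10 Ω v g) :
    |poissonForm Ω K g g - surrogateForm Ω K 𝒯 m P v v| ≤
      1 / 2 * ((1 + |Λ|) * n ^ 2 * (64 * (n + 1) ^ 2 * σ ^ 2) * n ^ (r + 1)) *
        (n + 1) ^ 2 * meshSize 𝒯 ^ (r + 1) *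
        (brokenSeminorm K 𝒯 (r + 1)).toReal * ∫ x in Ω, ‖g x‖ ^ 2 := by
  classical
  have hreg := ae_isRegularPoint hn hM hv hg
  have hg2 := hg.integrableOn_norm_sq
  have hDS : dofs Ω 𝒯 m ⊆ vertices 𝒯 m := Finset.filter_subset _ _
  have hv0 : ∀ p ∈ vertices 𝒯 m, p ∉ dofs Ω 𝒯 m → v p = 0 := fun p hp hpD =>
    hv.2.1 p fun h => hpD (Finset.mem_filter.mpr ⟨hp, h⟩)
  set D := dofs Ω 𝒯 m with hD
  set M : E n → E n → ℝ := fun p q => stiffness Ω K 𝒯 m p q - surrogateStiffness Ω K 𝒯 m P p q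
    with hMdef
  have hrow : ∀ p ∈ D, ∑ q ∈ D, M p q = 0 := by
    intro p hp
    have h1 := sum_stiffness_eq_zero hn hM hΩ hK hreg p
    rw [← Finset.sum_sdiff hDS] at h1
    -- The surrogate row sum over the interior vertices leaves minus the true entries of the columns
    -- on `∂Ω`, just as the true row sum does, so the two cancel.
    have h2 : ∑ q ∈ D, surrogateStiffness Ω K 𝒯 m P p q =
        - ∑ z ∈ vertices 𝒯 m \ D, stiffness Ω K 𝒯 m p z := by
      have hdiag : surrogateStiffness Ω K 𝒯 m P p p =
          -((∑ z ∈ D.erase p, surrogateOffDiag Ω K 𝒯 m P p z) +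
            ∑ z ∈ vertices 𝒯 m \ D, stiffness Ω K 𝒯 m p z) := if_pos rfl
      have hoff : ∀ z ∈ D.erase p, surrogateStiffness Ω K 𝒯 m P p z =
          surrogateOffDiag Ω K 𝒯 m P p z := fun z hz => if_neg (Finset.ne_of_mem_erase hz).symm
      rw [← Finset.add_sum_erase D _ hp, hdiag, Finset.sum_congr rfl hoff]
      ring
    rw [Finset.sum_sub_distrib, h2]
    linarith
  have hMne : ∀ p q, p ≠ q → M p q = stiffness Ω K 𝒯 m p q - surrogateOffDiag Ω K 𝒯 m P p q :=
    fun p q h => by rw [hMdef]; simp only [surrogateStiffness, if_neg h]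
  have hsymm : ∀ p ∈ D, ∀ q ∈ D, M p q = M q p := by
    intro p hp q hq
    rcases eq_or_ne p q with rfl | h
    · rfl
    · rw [hMne p q h, hMne q p h.symm, stiffness_comm hsym,
        surrogateOffDiag_comm hn hM hP hsym (hDS hp) (hDS hq)]
  have hform : poissonForm Ω K g g - surrogateForm Ω K 𝒯 m P v v =
      ∑ p ∈ D, ∑ q ∈ D, M p q * v q * v p := by
    have h1 : poissonForm Ω K g g =
        ∑ p ∈ D, ∑ q ∈ D, stiffness Ω K 𝒯 m p q * v q * v p := by
      rw [poissonForm_eq_sum hn hM hΩ hK hreg]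
      refine (Finset.sum_subset hDS fun p hp hpD => ?_).symm.trans
        (Finset.sum_congr rfl fun p _ => (Finset.sum_subset hDS fun q hq hqD => ?_).symm)
      · simp [hv0 p hp hpD]
      · simp [hv0 q hq hqD]
    rw [h1, surrogateForm, ← Finset.sum_sub_distrib]
    refine Finset.sum_congr rfl fun p _ => ?_
    rw [← Finset.sum_sub_distrib]
    exact Finset.sum_congr rfl fun q _ => by ring
  have hpair := fun (z : E n × E n) (hz : z ∈ D ×ˢ D) =>
    abs_sub_surrogateOffDiag_mul_sq_le hn hM hP hΩ hσ hrq hK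
      (hDS (Finset.mem_product.mp hz).1) (hDS (Finset.mem_product.mp hz).2) hg2 hreg
  choose! A hAΩ hA hφ hle using hpair
  -- Both vertices of a pair belong to the fine simplex containing `x`, which leaves at most `(n +
  -- 1) ^ 2` ordered pairs.
  have hcount := sum_setIntegral_le (μ := volume) hΩ.measurableSet (D ×ˢ D)
    (fun z hz => ⟨hA z hz, hAΩ z hz⟩) (fun x => by positivity) hg2 (N := (n + 1) ^ 2) (by
      filter_upwards [hreg] with x hx hxΩ
      obtain ⟨s, hs, hsp⟩ := (hx hxΩ).exists_card
      refine ⟨s ×ˢ s, ?_, fun z hz hxz => ?_⟩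
      · rw [Finset.card_product, sq]; exact Nat.mul_le_mul hs hs
      · exact Finset.mem_product.mpr ⟨hsp _ (hφ z hz x hxz).1, hsp _ (hφ z hz x hxz).2⟩)
  rw [hform, sum_mul_mul_eq_of_row_sum_zero D M v hsymm hrow, abs_mul, ← Finset.sum_product']
  have hhalf : |(-(1 / 2) : ℝ)| = 1 / 2 := by norm_num [abs_of_neg]
  rw [hhalf]
  have hH0 := meshSize_nonneg 𝒯
  set c : ℝ := (1 + |Λ|) * n ^ 2 * (64 * (n + 1) ^ 2 * σ ^ 2) * n ^ (r + 1) * meshSize 𝒯 ^ (r + 1) *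
    (brokenSeminorm K 𝒯 (r + 1)).toReal with hc
  have hc0 : 0 ≤ c := by positivity
  have hsum : |∑ z ∈ D ×ˢ D, M z.1 z.2 * (v z.2 - v z.1) ^ 2| ≤
      c * ((n + 1) ^ 2 * ∫ x in Ω, ‖g x‖ ^ 2) := by
    calc _ ≤ ∑ z ∈ D ×ˢ D, |M z.1 z.2 * (v z.2 - v z.1) ^ 2| := Finset.abs_sum_le_sum_abs _ _
      _ ≤ ∑ z ∈ D ×ˢ D, c * ∫ x in A z, ‖g x‖ ^ 2 := by
          refine Finset.sum_le_sum fun z hz => ?_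
          rw [abs_mul, abs_of_nonneg (sq_nonneg (v z.2 - v z.1))]
          by_cases h : z.1 = z.2
          · rw [h, sub_self, zero_pow two_ne_zero, mul_zero]
            exact mul_nonneg hc0 (integral_nonneg fun x => by positivity)
          · rw [hMne _ _ h]; exact hle z hz
      _ ≤ _ := by
          rw [← Finset.mul_sum]
          refine mul_le_mul_of_nonneg_left ?_ hc0
          exact_mod_cast hcount
  calc _ ≤ 1 / 2 * (c * ((n + 1) ^ 2 * ∫ x in Ω, ‖g x‖ ^ 2)) := by gcongr
    _ = _ := by rw [hc]; ring

-- Weak derivatives on `T` and on `T'` restrict to weak derivatives on `T ∩ T'` and agree there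
-- almost everywhere. Since the `T'` cover `Ω` up to a null set, the bound from one mesh holds on
-- the other.
omit hM hΩ in
lemma brokenSeminorm_le_of_mesh {𝒯' : Finset (Simplex n)} (hM : IsMacroMesh Ω 𝒯)
    (hM' : IsMacroMesh Ω 𝒯') {k : ℕ} (hK : MemBrokenSobolev K 𝒯 k)
    (hK' : MemBrokenSobolev K 𝒯' k) : brokenSeminorm K 𝒯 k ≤ brokenSeminorm K 𝒯' k := by
  refine iSup₂_le fun T hT => iSup_le fun a => iSup_le fun c => iSup_le fun ι => ?_
  obtain ⟨g, hg, -⟩ := (hK T hT a c).2 k le_rfl ι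
  refine (iInf₂_le g hg).trans ?_
  rw [eLpNorm_exponent_top]
  refine eLpNormEssSup_le_of_ae_enorm_bound ?_
  rw [ae_restrict_iff' (isOpen_openSimplex T).measurableSet]
  have h : ∀ T' ∈ 𝒯', ∀ᵐ x, x ∈ openSimplex T' → x ∈ openSimplex T →
      ‖g x‖ₑ ≤ brokenSeminorm K 𝒯' k := by
    intro T' hT'
    obtain ⟨g', hg', -⟩ := (hK' T' hT' a c).2 k le_rfl ι
    have hU := (isOpen_openSimplex T).inter (isOpen_openSimplex T')
    have heq := (hg.mono inter_subset_left).ae_eq hU (hg'.mono inter_subset_right)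
    have hb : ∀ᵐ x ∂(volume.restrict (openSimplex T')), ‖g' x‖ₑ ≤ brokenSeminorm K 𝒯' k := by
      filter_upwards [enorm_ae_le_eLpNormEssSup g' (volume.restrict (openSimplex T'))] with x hx
      refine hx.trans ?_
      rw [← eLpNorm_exponent_top]
      exact (hg'.eLpNorm_le_seminorm (isOpen_openSimplex T')).trans
        (seminorm_le_brokenSeminorm K hT' k a c)
    rw [ae_restrict_iff' (isOpen_openSimplex T').measurableSet] at hb
    filter_upwards [heq, hb] with x h1 h2 hx' hx
    rw [h1 ⟨hx, hx'⟩]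
    exact h2 hx'
  filter_upwards [(Filter.eventually_all_finset 𝒯').mpr h, ae_mem_openSimplex hn hM'] with x hx hx' hxT
  obtain ⟨T', hT', hxT'⟩ := hx' (hM.subset T hT hxT)
  exact hx T' hT' hxT' hxT

end Mesh

end Surrogate

/-! ### Consistency and coercivity of the surrogate form -/

theorem mainTheorem4 (n : ℕ) (hn : n = 1 ∨ n = 2 ∨ n = 3) (q r : ℕ) (hrq : r ≤ q) (σ Λ : ℝ) :
    ∃ C : ℝ, 0 < C ∧
      ∀ (Ω : Set (Surrogate.E n)) (K : Surrogate.E n → Matrix (Fin n) (Fin n) ℝ),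
        IsOpen Ω → (∀ᵐ x ∂(MeasureTheory.volume.restrict Ω), (K x).IsSymm) →
        (∀ (𝒯 : Finset (Surrogate.Simplex n)) (m : ℕ)
            (P : Surrogate.Simplex n → Surrogate.E n →
              (Surrogate.E n → ℝ) → Surrogate.E n → ℝ),
            Surrogate.IsMacroMesh Ω 𝒯 → Surrogate.ShapeRegular σ 𝒯 →
            Surrogate.MemBrokenSobolev K 𝒯 (r + 1) →
            Surrogate.IsProjectionFamily K 𝒯 m q Λ P →
            ∀ v ∈ Surrogate.feSpace Ω (Surrogate.fineMesh 𝒯 m),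
            ∀ g : Surrogate.E n → Surrogate.E n, Surrogate.IsH10 Ω v g →
              |Surrogate.poissonForm Ω K g g - Surrogate.surrogateForm Ω K 𝒯 m P v v| ≤
                C * Surrogate.meshSize 𝒯 ^ (r + 1) *
                  (Surrogate.brokenSeminorm K 𝒯 (r + 1)).toReal *
                  ∫ x in Ω, ‖g x‖ ^ 2) ∧
        (Surrogate.PoissonCoercive Ω K →
          ∃ H₀ : ℝ, 0 < H₀ ∧ ∃ α' : ℝ, 0 < α' ∧
            ∀ (𝒯 : Finset (Surrogate.Simplex n)) (m : ℕ)
              (P : Surrogate.Simplex n → Surrogate.E n →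
                (Surrogate.E n → ℝ) → Surrogate.E n → ℝ),
              Surrogate.IsMacroMesh Ω 𝒯 → Surrogate.ShapeRegular σ 𝒯 →
              Surrogate.MemBrokenSobolev K 𝒯 (r + 1) →
              Surrogate.meshSize 𝒯 < H₀ →
              Surrogate.IsProjectionFamily K 𝒯 m q Λ P →
              ∀ v ∈ Surrogate.feSpace Ω (Surrogate.fineMesh 𝒯 m),
              ∀ g : Surrogate.E n → Surrogate.E n, Surrogate.IsH10 Ω v g →
                α' * Surrogate.h1NormSq Ω v g ≤ Surrogate.surrogateForm Ω K 𝒯 m P v v) := by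
  open Surrogate in
  -- The summand 1 keeps `C` positive even for `σ = 0`.
  set C : ℝ := 1 / 2 * ((1 + |Λ|) * n ^ 2 * (64 * (n + 1) ^ 2 * σ ^ 2) * n ^ (r + 1)) *
    (n + 1) ^ 2 + 1 with hC
  have hC0 : 0 < C := by positivity
  refine ⟨C, hC0, fun Ω K hΩ hsym => ?_⟩
  have hpart : ∀ (𝒯 : Finset (Simplex n)) (m : ℕ)
      (P : Simplex n → E n → (E n → ℝ) → E n → ℝ), IsMacroMesh Ω 𝒯 → ShapeRegular σ 𝒯 →
      MemBrokenSobolev K 𝒯 (r + 1) → IsProjectionFamily K 𝒯 m q Λ P →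
      ∀ v ∈ feSpace Ω (fineMesh 𝒯 m), ∀ g : E n → E n, IsH10 Ω v g →
        |poissonForm Ω K g g - surrogateForm Ω K 𝒯 m P v v| ≤
          C * meshSize 𝒯 ^ (r + 1) * (brokenSeminorm K 𝒯 (r + 1)).toReal *
            ∫ x in Ω, ‖g x‖ ^ 2 := by
    intro 𝒯 m P hM hσ hK hP v hv g hg
    refine (abs_poissonForm_sub_surrogateForm_le hn hM hΩ hsym hσ hrq hK hP hv hg).trans ?_
    have hH := meshSize_nonneg 𝒯
    have hI : 0 ≤ ∫ x in Ω, ‖g x‖ ^ 2 := integral_nonneg fun x => by positivity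
    gcongr
    exact (lt_add_one _).le
  refine ⟨hpart, ?_⟩
  rintro ⟨α, hα, hcoer⟩
  -- A single reference mesh provides the bound `κ` on the seminorm for all meshes. If no mesh is
  -- admissible, the claim is vacuous.
  by_cases hex : ∃ 𝒯₀ : Finset (Simplex n), IsMacroMesh Ω 𝒯₀ ∧ MemBrokenSobolev K 𝒯₀ (r + 1)
  swap
  · exact ⟨1, one_pos, 1, one_pos, fun 𝒯 m P hM _ hK => absurd ⟨𝒯, hM, hK⟩ hex⟩
  obtain ⟨𝒯₀, hM₀, hK₀⟩ := hex
  set κ := (brokenSeminorm K 𝒯₀ (r + 1)).toReal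
  have hκ : 0 ≤ κ := ENNReal.toReal_nonneg
  -- The bound 1 gives `H ^ (r + 1) ≤ H`; the other one makes the error at most half of the
  -- coercivity constant, with `+ 1` guarding against `κ = 0`.
  refine ⟨min 1 (α / (2 * (C * κ + 1))), lt_min one_pos (by positivity), α / 2, half_pos hα, ?_⟩
  intro 𝒯 m P hM hσ hK hH hP v hv g hg
  have h1 := hpart 𝒯 m P hM hσ hK hP v hv g hg
  have h2 := hcoer v g hg
  have hκ' : (brokenSeminorm K 𝒯 (r + 1)).toReal ≤ κ :=
    ENNReal.toReal_mono hK₀.brokenSeminorm_ne_top (brokenSeminorm_le_of_mesh hn hM hM₀ hK hK₀)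
  have hH0 := meshSize_nonneg 𝒯
  obtain ⟨hH1, hH2⟩ := lt_min_iff.mp hH
  have hHr : meshSize 𝒯 ^ (r + 1) ≤ meshSize 𝒯 := pow_le_of_le_one hH0 hH1.le (by omega)
  have hI : ∫ x in Ω, ‖g x‖ ^ 2 ≤ h1NormSq Ω v g :=
    le_add_of_nonneg_left (integral_nonneg fun x => by positivity)
  have hI0 : 0 ≤ ∫ x in Ω, ‖g x‖ ^ 2 := integral_nonneg fun x => by positivity
  have hsmall : C * meshSize 𝒯 * κ ≤ α / 2 := by
    rw [lt_div_iff₀ (by positivity)] at hH2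
    nlinarith
  have h3 : |poissonForm Ω K g g - surrogateForm Ω K 𝒯 m P v v| ≤ α / 2 * h1NormSq Ω v g :=
    calc _ ≤ C * meshSize 𝒯 ^ (r + 1) * (brokenSeminorm K 𝒯 (r + 1)).toReal *
          ∫ x in Ω, ‖g x‖ ^ 2 := h1
      _ ≤ C * meshSize 𝒯 * κ * h1NormSq Ω v g := by gcongr
      _ ≤ _ := mul_le_mul_of_nonneg_right hsmall (hI0.trans hI)
  linarith [(abs_le.mp h3).2]
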